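/- Let $G$ be a finite simple graph with $n\ge 4$ vertices, and let $\Gamma$ be a generic shortest-path triangulation of the unit sphere $S^2$ with graph $G$ in which the north pole $(0,0,1)$ and the south pole $(0,0,-1)$ lie in different faces. Here $\Gamma$ is an embedding of $G$ on $S^2$ such that every edge is a great-circular arc of length less than $\pi$, every face (connected component of the complement of the drawing) is bounded by a cycle of three distinct edges, no great circle contains more than two vertices, and no great circle through the poles contains more than one vertex. A longitude is an open great-circular arc from the north pole to the south pole; a point is due north of another if both lie on one longitude and the first is closer to the north pole. The north face $f_{\mathsf{north}}$ and the south face $f_{\mathsf{south}}$ are the faces containing the north and south pole. A down-face is a non-polar face with one vertex (its apex) due south of a point of the opposite edge (its base); its other two edges are its legs. A shelling of $\Gamma$ is an ordering $f_1,\dots,f_m$ of all its faces such that every prefix union $U_k=\bigcup_{i\le k}\overline{f_i}$ is empty ($k=0$), the entire sphere ($k=m$), or a topological disk. It is longitudinal if every disk $U_k$ is $\theta$-monotone, that is, connected and such that every longitude is disjoint from $U_k$ or has connected intersection with it. $\Gamma$ is longitudinally shellable if it has a longitudinal shelling. Define three directed graphs. $\mathrm{Dn}(\Gamma)$ has the faces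 as vertices, with an edge from $f$ to $f'$ if $f\neq f'$ share an edge of $\Gamma$ and some point of $f$ is due north of some point of $f'$. $\mathrm{Rt}(\Gamma)$ has the vertices of $G$ as vertices, with an edge from $i$ to $j$ if $ij$ is an edge of $G$ and $x_iy_j-x_jy_i>0$ (that is, $j$ is east of $i$), where $(x_i,y_i,z_i)$ is the position of $i$. $\mathrm{DnVee}(\Gamma)$ has the vertices of $G$ as vertices; its edges are the legs of all down-faces, each directed toward its apex. Then the following conditions are equivalent: (a) $\Gamma$ is longitudinally shellable. (b) $\mathrm{Dn}(\Gamma)$ is acyclic. (c) $\mathrm{Rt}(\Gamma)$ is strongly connected. (d) $\mathrm{Rt}(\Gamma)$ contains a directed path (possibly of length zero) from a vertex of $f_{\mathsf{north}}$ to a vertex of $f_{\mathsf{south}}$, and one from a vertex of $f_{\mathsf{south}}$ to a vertex of $f_{\mathsf{north}}$. (e) $\mathrm{DnVee}(\Gamma)$ is acyclic. -/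

import Mathlib

open scoped InnerProductSpace

noncomputable section

namespace SphereTriang

/-! ### The sphere, great circles, longitudes -/

/-- The unit sphere in three-dimensional Euclidean space. -/
abbrev S2 : Type := Metric.sphere (0 : EuclideanSpace ℝ (Fin 3)) 1

/-- The north pole `(0,0,1)`. -/
def northPole : S2 := ⟨EuclideanSpace.single 2 1, by simp⟩

/-- The south pole `(0,0,-1)`. -/
def southPole : S2 := -northPole

/-- A great circle is the intersection of the sphere with a plane through the origin. -/
def IsGreatCircle (C : Set S2) : Prop :=
  ∃ u : EuclideanSpace ℝ (Fin 3), u ≠ 0 ∧ C = {p : S2 | ⟪u, p.1⟫_ℝ = 0}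

/-- The longitude at angle `θ`: the open half great circle from the north pole to the south
pole consisting of the points `(r cos θ, r sin θ, z)` of the sphere with `r > 0`. -/
def longitude (θ : ℝ) : Set S2 :=
  {p : S2 | ∃ r : ℝ, 0 < r ∧ p.1 0 = r * Real.cos θ ∧ p.1 1 = r * Real.sin θ}

/-- `p` is due north of `q`: both lie on a common longitude, and `p` is strictly closer to the
north pole. -/
def DueNorth (p q : S2) : Prop :=
  (∃ θ : ℝ, p ∈ longitude θ ∧ q ∈ longitude θ) ∧ q.1 2 < p.1 2

/-- A connected region is `θ`-monotone if every longitude is disjoint from it or has connected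
intersection with it. -/
def ThetaMonotone (R : Set S2) : Prop :=
  IsConnected R ∧ ∀ θ : ℝ, Disjoint (longitude θ) R ∨ IsConnected (longitude θ ∩ R)

/-- The shortest arc between two points of the sphere that are not antipodal, endpoints included:
the points of the sphere in the cone spanned by `p` and `q`. -/
def arc (p q : S2) : Set S2 :=
  {x : S2 | ∃ a b : ℝ, 0 ≤ a ∧ 0 ≤ b ∧ x.1 = a • p.1 + b • q.1}

/-- A topological disk: a set homeomorphic to the closed unit disk of the plane. -/
def IsTopologicalDisk (R : Set S2) : Prop :=
  Nonempty (R ≃ₜ Metric.closedBall (0 : EuclideanSpace ℝ (Fin 2)) 1)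

/-! ### Directed graphs -/

/-- A directed graph is acyclic if it has no directed closed walk of positive length. -/
def Acyclic {α : Type*} (D : Digraph α) : Prop :=
  ∀ a : α, ¬ Relation.TransGen D.Adj a a

/-- `D` contains a directed path, possibly of length zero, from `a` to `b`. -/
def HasPath {α : Type*} (D : Digraph α) (a b : α) : Prop :=
  Relation.ReflTransGen D.Adj a b

/-- A directed graph is strongly connected if it has directed paths between all ordered pairs of
vertices. -/
def StronglyConnected {α : Type*} (D : Digraph α) : Prop :=
  ∀ a b : α, HasPath D a b

/-! ### Shortest-path embeddings and triangulations -/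

/-- A shortest-path embedding of a simple graph on the sphere: vertices go to distinct points, every
edge is drawn as the great-circular arc of length less than `π` between its ends, no vertex lies on
an edge of which it is not an end, and distinct edges meet only in common ends. -/
structure ShortestPathEmbedding {V : Type*} (G : SimpleGraph V) where
  /-- the position of each vertex -/
  pos : V → S2
  pos_injective : Function.Injective pos
  not_antipodal : ∀ i j, G.Adj i j → pos j ≠ -pos i
  vertex_mem_arc : ∀ i j k, G.Adj i j → pos k ∈ arc (pos i) (pos j) → k = i ∨ k = j
  arc_inter_arc : ∀ i j k l, G.Adj i j → G.Adj k l → s(i, j) ≠ s(k, l) →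
    ∀ x, x ∈ arc (pos i) (pos j) → x ∈ arc (pos k) (pos l) →
      ∃ v, v ∈ s(i, j) ∧ v ∈ s(k, l) ∧ x = pos v

namespace ShortestPathEmbedding

variable {V : Type*} {G : SimpleGraph V} (Γ : ShortestPathEmbedding G)

/-- The image of the graph: all vertices and all edges. -/
def drawing : Set S2 :=
  Set.range Γ.pos ∪ ⋃ (i : V) (j : V) (_ : G.Adj i j), arc (Γ.pos i) (Γ.pos j)

/-- The (open) faces: the connected components of the complement of the drawing. -/
def faces : Set (Set S2) :=
  {F | ∃ x ∈ Γ.drawingᶜ, F = connectedComponentIn Γ.drawingᶜ x}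

/-- The boundary of `F` is the 3-cycle through `i`, `j`, `k`. -/
def IsBoundedBy (F : Set S2) (i j k : V) : Prop :=
  G.Adj i j ∧ G.Adj j k ∧ G.Adj k i ∧
    frontier F = arc (Γ.pos i) (Γ.pos j) ∪ arc (Γ.pos j) (Γ.pos k) ∪ arc (Γ.pos k) (Γ.pos i)

/-- A triangulation: every face is bounded by a cycle of three distinct edges. -/
def IsTriangulation : Prop :=
  ∀ F ∈ Γ.faces, ∃ i j k : V, Γ.IsBoundedBy F i j k

/-- Genericity: no great circle contains more than two vertices, and no great circle through the
poles contains more than one vertex. -/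
def IsGeneric : Prop :=
  (∀ C : Set S2, IsGreatCircle C → (Γ.pos ⁻¹' C).encard ≤ 2) ∧
  (∀ C : Set S2, IsGreatCircle C → northPole ∈ C → southPole ∈ C → (Γ.pos ⁻¹' C).encard ≤ 1)

/-- `F` is the north face. -/
def IsNorthFace (F : Set S2) : Prop := F ∈ Γ.faces ∧ northPole ∈ F

/-- `F` is the south face. -/
def IsSouthFace (F : Set S2) : Prop := F ∈ Γ.faces ∧ southPole ∈ F

/-- No face contains both poles: the north face and the south face are different. -/
def PolesSeparated : Prop :=
  ∀ F : Set S2, ¬ (Γ.IsNorthFace F ∧ Γ.IsSouthFace F)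

/-- `F` is a non-polar face with vertices `v`, `u`, `w` whose vertex `v` (the apex) is directly
south of its opposite edge `uw` (the base); the legs of `F` are `uv` and `wv`. -/
def IsDownFace (F : Set S2) (v u w : V) : Prop :=
  F ∈ Γ.faces ∧ ¬ Γ.IsNorthFace F ∧ ¬ Γ.IsSouthFace F ∧ Γ.IsBoundedBy F v u w ∧
    ∃ x ∈ arc (Γ.pos u) (Γ.pos w), DueNorth x (Γ.pos v)

/-- Two different faces share an edge of the graph. -/
def ShareEdge (F F' : Set S2) : Prop :=
  F ≠ F' ∧ ∃ i j : V, G.Adj i j ∧ arc (Γ.pos i) (Γ.pos j) ⊆ frontier F ∩ frontier F'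

/-- The directed dual graph: an edge from `F` to `F'` if they share an edge and some point of `F` is
due north of some point of `F'`. -/
def Dn : Digraph Γ.faces where
  Adj F F' := Γ.ShareEdge F.1 F'.1 ∧ ∃ p ∈ F.1, ∃ q ∈ F'.1, DueNorth p q

/-- The oriented primal graph: every edge is directed from west to east. -/
def Rt : Digraph V where
  Adj i j := G.Adj i j ∧
    0 < Matrix.det !![(Γ.pos i).1 0, (Γ.pos i).1 1; (Γ.pos j).1 0, (Γ.pos j).1 1]

/-- The directed graph of the legs of all down-faces, each directed toward the apex. -/
def DnVee : Digraph V where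
  Adj u v := ∃ (F : Set S2) (w : V), Γ.IsDownFace F v u w

/-- `Rt Γ` contains a directed path from a vertex of the face `F` to a vertex of the face `F'`. -/
def HasFacePath (F F' : Set S2) : Prop :=
  ∃ i j : V, Γ.pos i ∈ frontier F ∧ Γ.pos j ∈ frontier F' ∧ HasPath Γ.Rt i j

/-- The union of the first `k` (closed) faces in an ordering of the faces. -/
def prefixUnion {m : ℕ} (f : Fin m ≃ Γ.faces) (k : ℕ) : Set S2 :=
  ⋃ (i : Fin m) (_ : (i : ℕ) < k), closure (f i).1

/-- An ordering of the faces is a shelling if the union of any prefix is empty (no faces), the whole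
sphere (all faces), or a topological disk. -/
def IsShelling {m : ℕ} (f : Fin m ≃ Γ.faces) : Prop :=
  ∀ k : ℕ, k ≤ m →
    (k = 0 ∧ Γ.prefixUnion f k = ∅) ∨
    (k = m ∧ Γ.prefixUnion f k = Set.univ) ∨
    IsTopologicalDisk (Γ.prefixUnion f k)

/-- A shelling is longitudinal if every prefix union that is a disk is `θ`-monotone. -/
def IsLongitudinalShelling {m : ℕ} (f : Fin m ≃ Γ.faces) : Prop :=
  Γ.IsShelling f ∧ ∀ k : ℕ, k ≤ m →
    IsTopologicalDisk (Γ.prefixUnion f k) → ThetaMonotone (Γ.prefixUnion f k)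

/-- `Γ` has a longitudinal shelling. -/
def LongitudinallyShellable : Prop :=
  ∃ (m : ℕ) (f : Fin m ≃ Γ.faces), Γ.IsLongitudinalShelling f

end ShortestPathEmbedding

end SphereTriang

end

/-! Replace each face by the cone over it in ℝ³. A longitude becomes a vertical half-plane, and on
the line over a fixed horizontal direction "due north" means "higher". By genericity and the
separation of the poles, every nonpolar face is a convex triangle. The nonpolar faces therefore give
disjoint convex cones that avoid the vertical axis. For two such cones, "above" is consistent over
all common directions (`ConeFamily.asymm`), and it is transitive over a direction common to three
cones. A cycle can thus arise only by going around the axis.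

The implications proved are (a) ↔ (b) and (b) → (e) → (c) → (d) → (b). The relation `Ab` ("some
point due north of some point", adjacent or not) is contained in the transitive closure of `Dn`
(`transGen_dn_of_ab`), so the two are acyclic together.

(d) → (b): a shortest cycle of cones always turns in the same sense and covers all directions
(`exists_winding`, `Winding.cover`). An edge path going in that sense cannot get from above the
cycle to below it (`Winding.exists_under`). Vertices of the north face are above the cycle and those
of the south face are not, so a path from north to south going east, or the reverse of a path from
south to north, gives a contradiction.

(b) → (e): a leg from v to v' makes the face just above v lie above the down-face with apex v', so a
cycle of legs gives a cycle in `Ab`. (e) → (c): a vertex off the north face is the apex of a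
down-face, with an edge entering from its western leg and one leaving along its eastern leg.
Induction along `DnVee` reduces to the north face, whose boundary is a directed cycle.

(b) → (a): order the faces by a linear extension of `Ab`. A proper nonempty prefix is the region
above the graph of a continuous, positively homogeneous height function, hence a θ-monotone disk
(`IsSplit`). (a) → (b): once one pole is covered, θ-monotonicity makes the shelling order respect
the vertical order among later faces, so a cycle would have to be finished before either pole is
covered. That would give a pole-free disk meeting every longitude in a connected set, and hence a
continuous section of ℝ → S¹. -/

open scoped Topology

noncomputable section

namespace SphereTriang

/-! ### Disjoint convex cones and their vertical order -/

/-- A family of pairwise disjoint convex cones in `ℝ³` avoiding the vertical axis. -/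
structure ConeFamily {α : Type*} (K : α → ℝ → ℝ → ℝ → Prop) : Prop where
  add : ∀ {a x y z x' y' z'}, K a x y z → K a x' y' z' → K a (x + x') (y + y') (z + z')
  smul : ∀ {a r x y z}, 0 < r → K a x y z → K a (r * x) (r * y) (r * z)
  disj : ∀ {a b x y z}, K a x y z → K b x y z → a = b
  axis : ∀ {a z}, ¬ K a 0 0 z

/-- The horizontal direction `(x, y)` occurs in the cone `K a`. -/
def Dir {α : Type*} (K : α → ℝ → ℝ → ℝ → Prop) (a : α) (x y : ℝ) : Prop := ∃ z, K a x y z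

/-- In the direction `(x, y)`, some point of `K a` is above some point of `K b`. -/
def Over {α : Type*} (K : α → ℝ → ℝ → ℝ → Prop) (a b : α) (x y : ℝ) : Prop :=
  ∃ z z', K a x y z ∧ K b x y z' ∧ z' < z

/-- Two different cones such that some point of the first is above some point of the second. -/
def AboveRel {α : Type*} (K : α → ℝ → ℝ → ℝ → Prop) (a b : α) : Prop :=
  a ≠ b ∧ ∃ x y, Over K a b x y

/-- Some point of the cone `K a` is below the point `(x, y, z)`. -/
def Under {α : Type*} (K : α → ℝ → ℝ → ℝ → Prop) (a : α) (x y z : ℝ) : Prop :=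
  ∃ z', z' < z ∧ K a x y z'

namespace ConeFamily

variable {α : Type*} {K : α → ℝ → ℝ → ℝ → Prop} (hK : ConeFamily K)

include hK

theorem comb {a : α} {r s x y z x' y' z' : ℝ} (hr : 0 < r) (hs : 0 < s) (h : K a x y z)
    (h' : K a x' y' z') : K a (r * x + s * x') (r * y + s * y') (r * z + s * z') :=
  hK.add (hK.smul hr h) (hK.smul hs h')

theorem of_smul {a : α} {r x y z : ℝ} (hr : 0 < r) (h : K a (r * x) (r * y) (r * z)) :
    K a x y z := by
  have := hK.smul (inv_pos.2 hr) h
  simpa [← mul_assoc, inv_mul_cancel₀ hr.ne'] using this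

theorem mid {a : α} {x y z w t : ℝ} (h : K a x y z) (h' : K a x y w) (hz : z < t) (hw : t < w) :
    K a x y t := by
  have h1 : 0 < w - t := by linarith
  have h2 : 0 < t - z := by linarith
  have := hK.comb h1 h2 h h'
  apply hK.of_smul (r := w - z) (by linarith)
  convert this using 1 <;> ring

/-- If the order were reversed over two directions, weight the points over each direction by the
vertical gap over the other. The offsets cancel, so the two convex cones would share a point. -/
theorem asymm {a b : α} (hab : AboveRel K a b) {x y : ℝ} : ¬ Over K b a x y := by
  obtain ⟨hne, x', y', z, z', h1, h2, h3⟩ := hab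
  rintro ⟨w, w', h4, h5, h6⟩
  have e1 := hK.comb (sub_pos.2 h6) (sub_pos.2 h3) h1 h5
  have e2 := hK.comb (sub_pos.2 h6) (sub_pos.2 h3) h2 h4
  apply hne
  refine hK.disj e1 ?_
  convert e2 using 1
  ring

theorem over_of_dir {a b : α} (hab : AboveRel K a b) {x y : ℝ} (ha : Dir K a x y)
    (hb : Dir K b x y) : Over K a b x y := by
  obtain ⟨z, hz⟩ := ha
  obtain ⟨w, hw⟩ := hb
  rcases lt_trichotomy w z with h | h | h
  · exact ⟨z, w, hz, hw, h⟩
  · subst h; exact (hab.1 (hK.disj hz hw)).elim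
  · exact (hK.asymm hab ⟨w, z, hw, hz, h⟩).elim

/-- If the point of `b` were not under the given height, it would lie vertically between two points
of `a`, hence in `a` by convexity. -/
theorem under_of_above {a b : α} (hab : AboveRel K a b) {x y z : ℝ} (ha : Under K a x y z)
    (hb : Dir K b x y) : Under K b x y z := by
  obtain ⟨z1, h1, h1'⟩ := ha
  obtain ⟨w, w', hw, hw', h2⟩ := hK.over_of_dir hab ⟨_, h1'⟩ hb
  refine ⟨w', ?_, hw'⟩
  by_contra! h3
  exact hab.1 (hK.disj (hK.mid h1' hw (h1.trans_le h3) h2) hw')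

/-- The common direction is essential: without one, the relation can be cyclic. -/
theorem above_trans {a b c : α} (hab : AboveRel K a b) (hbc : AboveRel K b c) {x y : ℝ}
    (ha : Dir K a x y) (hb : Dir K b x y) (hc : Dir K c x y) : AboveRel K a c := by
  obtain ⟨z, z', h1, h2, h3⟩ := hK.over_of_dir hab ha hb
  obtain ⟨w, hw, hw'⟩ := hK.under_of_above hbc ⟨z', h3, h2⟩ hc
  refine ⟨?_, x, y, z, w, h1, hw', hw⟩
  rintro rfl
  exact hK.asymm hab (hK.over_of_dir hbc hb hc)

theorem dir_smul {a : α} {r x y : ℝ} (hr : 0 < r) (h : Dir K a x y) : Dir K a (r * x) (r * y) :=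
  let ⟨z, hz⟩ := h; ⟨r * z, hK.smul hr hz⟩

theorem dir_of_smul {a : α} {r x y : ℝ} (hr : 0 < r) (h : Dir K a (r * x) (r * y)) :
    Dir K a x y := by
  have := hK.dir_smul (inv_pos.2 hr) h
  simpa [← mul_assoc, inv_mul_cancel₀ hr.ne'] using this

theorem dir_comb {a : α} {r s x y x' y' : ℝ} (hr : 0 ≤ r) (hs : 0 ≤ s) (hrs : 0 < r + s)
    (h : Dir K a x y) (h' : Dir K a x' y') : Dir K a (r * x + s * x') (r * y + s * y') := by
  rcases hr.eq_or_lt with rfl | hr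
  · simpa using hK.dir_smul (by linarith) h'
  rcases hs.eq_or_lt with rfl | hs
  · simpa using hK.dir_smul (by linarith) h
  obtain ⟨z, hz⟩ := h
  obtain ⟨z', hz'⟩ := h'
  exact ⟨_, hK.comb hr hs hz hz'⟩

/-- By Cramer, det(d₁,d₂)·d = det(d,d₂)·d₁ + det(d₁,d)·d₂. The hypotheses say that, for the
orientation given by `σ`, `d` lies in the angle from `d₁` to `d₂`. -/
theorem dir_between {a : α} {σ x₁ y₁ x₂ y₂ x y : ℝ} (h₁ : Dir K a x₁ y₁) (h₂ : Dir K a x₂ y₂)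
    (h : 0 < σ * (x₁ * y₂ - x₂ * y₁)) (h1 : 0 ≤ σ * (x₁ * y - x * y₁))
    (h2 : 0 ≤ σ * (x * y₂ - x₂ * y))
    (h3 : 0 < σ * (x * y₂ - x₂ * y) + σ * (x₁ * y - x * y₁)) : Dir K a x y := by
  have := hK.dir_comb h2 h1 h3 h₁ h₂
  apply hK.dir_of_smul h
  convert this using 1 <;> ring

/-- Two parallel directions of one cone cannot be opposite, as a positive combination would land on
the axis. They are positive multiples of each other, and cones are scale invariant. -/
theorem dir_parallel {a b : α} {x y x' y' : ℝ} (h : Dir K a x y) (h' : Dir K a x' y')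
    (hd : x * y' - x' * y = 0) (hb : Dir K b x y) : Dir K b x' y' := by
  have hne : 0 < x * x + y * y := by
    by_contra hc
    have hx : x = 0 := by nlinarith [mul_self_nonneg x, mul_self_nonneg y]
    have hy : y = 0 := by nlinarith [mul_self_nonneg x, mul_self_nonneg y]
    subst hx hy
    obtain ⟨z, hz⟩ := h
    exact hK.axis hz
  have e1 : (x * x' + y * y') * x = (x * x + y * y) * x' := by linear_combination y * hd
  have e2 : (x * x' + y * y') * y = (x * x + y * y) * y' := by linear_combination (-x) * hd
  rcases lt_or_ge 0 (x * x' + y * y') with hp | hp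
  · apply hK.dir_of_smul hne
    rw [← e1, ← e2]
    exact hK.dir_smul hp hb
  · exfalso
    obtain ⟨z, hz⟩ := hK.dir_comb (r := -(x * x' + y * y')) (s := x * x + y * y) (by linarith)
      hne.le (by linarith) h h'
    apply hK.axis (a := a) (z := z)
    convert hz using 1 <;> linarith

/-- The cancellation of `asymm` again: if the cone were below one end and above the other, the
combination weighted by the gaps would put a point of the segment inside the cone. -/
theorem under_of_free {a : α} {x y z x' y' z' : ℝ} (h : Under K a x y z) (h' : Dir K a x' y')
    (free : ∀ s t : ℝ, 0 ≤ s → 0 ≤ t → ¬ K a (s * x + t * x') (s * y + t * y') (s * z + t * z')) :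
    Under K a x' y' z' := by
  obtain ⟨z1, h1, h1'⟩ := h
  obtain ⟨w, hw⟩ := h'
  rcases lt_trichotomy w z' with h | h | h
  · exact ⟨w, h, hw⟩
  · subst h
    exact (free 0 1 le_rfl zero_le_one (by simpa using hw)).elim
  · exfalso
    apply free (w - z') (z - z1) (by linarith) (by linarith)
    convert hK.comb (sub_pos.2 h) (sub_pos.2 h1) h1' hw using 1
    ring

end ConeFamily

/-! ### Minimal cycles -/

/-- The sequence `c` runs periodically around a directed cycle of length `n`. -/
structure IsCycle {α : Type*} (R : α → α → Prop) (n : ℕ) (c : ℕ → α) : Prop where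
  pos : 0 < n
  per : ∀ k, c (k + n) = c k
  step : ∀ k, R (c k) (c (k + 1))

theorem exists_isCycle_of_walk {α : Type*} {R : α → α → Prop} {n : ℕ} (hn : 0 < n) (w : ℕ → α)
    (h : ∀ k < n, R (w k) (w (k + 1))) (hw : w n = w 0) :
    ∃ c, IsCycle R n c ∧ ∀ k, ∃ j, c k = w j := by
  refine ⟨fun k => w (k % n), ⟨hn, fun k => by simp, fun k => ?_⟩, fun k => ⟨_, rfl⟩⟩
  have hk := Nat.mod_lt k hn
  have := h _ hk
  rw [Nat.add_mod]
  rcases hk.nat_succ_le.eq_or_lt with h1 | h1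
  · have h2 : (k % n + 1 % n) % n = 0 := by
      rw [← Nat.add_mod, ← Nat.mod_add_mod, ← Nat.succ_eq_add_one, h1, Nat.mod_self]
    rw [h2, ← hw]
    have h3 : k % n + 1 = n := h1
    rwa [h3] at this
  · have h2 : (k % n + 1 % n) % n = k % n + 1 := by
      rw [← Nat.add_mod, ← Nat.mod_add_mod]
      exact Nat.mod_eq_of_lt h1
    rwa [h2]

theorem exists_walk_of_transGen {α : Type*} {R : α → α → Prop} {a b : α}
    (h : Relation.TransGen R a b) :
    ∃ (n : ℕ) (w : ℕ → α), 0 < n ∧ w 0 = a ∧ w n = b ∧ ∀ k < n, R (w k) (w (k + 1)) := by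
  induction h using Relation.TransGen.head_induction_on with
  | @single a h =>
    refine ⟨1, fun k => if k = 0 then a else b, one_pos, by simp, by simp, fun k hk => ?_⟩
    obtain rfl : k = 0 := by omega
    simpa using h
  | @head a c h _ ih =>
    obtain ⟨n, w, hn, h0, h1, h2⟩ := ih
    refine ⟨n + 1, fun k => if k = 0 then a else w (k - 1), by omega, by simp, by simpa using h1,
      fun k hk => ?_⟩
    rcases k with _ | k
    · simpa [h0] using h
    · simpa using h2 k (by omega)

/-- In a cycle of least length, a step from `c k` to `c (k + 2)` would be a shortcut giving a cycle
with one vertex less. Irreflexivity excludes length one, where there is nothing to shorten. -/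
theorem exists_minimal_cycle {α : Type*} {R : α → α → Prop} (hR : ∀ a, ¬ R a a) {a : α}
    (h : Relation.TransGen R a a) :
    ∃ n c, IsCycle R n c ∧ ∀ k, ¬ R (c k) (c (k + 2)) := by
  classical
  have hex : ∃ n, ∃ c, IsCycle R n c := by
    obtain ⟨n, w, hn, h0, h1, h2⟩ := exists_walk_of_transGen h
    obtain ⟨c, hc, -⟩ := exists_isCycle_of_walk hn w h2 (h1.trans h0.symm)
    exact ⟨n, c, hc⟩
  obtain ⟨c, hc⟩ := Nat.find_spec hex
  refine ⟨_, c, hc, fun k hk => ?_⟩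
  set n := Nat.find hex with hn
  have hn1 : n ≠ 1 := by
    intro h1
    have := hc.step 0
    have h2 := hc.per 0
    rw [h1] at h2
    rw [h2] at this
    exact hR _ this
  have hpos := hc.pos
  obtain ⟨c', hc', -⟩ := exists_isCycle_of_walk (R := R) (n := n - 1) (by omega)
    (fun j => if j = 0 then c k else c (k + j + 1)) (fun j _ => by
      rcases j with _ | j
      · simpa using hk
      · have := hc.step (k + (j + 1) + 1)
        simpa [add_assoc] using this) (by
      have h1 : n - 1 ≠ 0 := by omega
      have h2 : k + (n - 1) + 1 = k + n := by omega
      simp only [h1, if_false, if_true, h2]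
      exact hc.per k)
  exact Nat.find_min hex (m := n - 1) (by omega) ⟨c', hc'⟩

/-! ### Winding cycles -/

/-- A cycle of cones, each above the next, which always turns in the direction given by the sign
of `σ`. -/
structure Winding {α : Type*} (K : α → ℝ → ℝ → ℝ → Prop) (n : ℕ) (c : ℕ → α) (σ : ℝ)
    (dx dy : ℕ → ℝ) : Prop where
  cyc : IsCycle (AboveRel K) n c
  perx : ∀ k, dx (k + n) = dx k
  pery : ∀ k, dy (k + n) = dy k
  left : ∀ k, Dir K (c k) (dx k) (dy k)
  right : ∀ k, Dir K (c (k + 1)) (dx k) (dy k)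
  notriple : ∀ k x y, Dir K (c k) x y → Dir K (c (k + 1)) x y → ¬ Dir K (c (k + 2)) x y
  turn : ∀ k, 0 < σ * (dx k * dy (k + 1) - dx (k + 1) * dy k)

/-- In a shortest cycle, three consecutive cones have no common direction, since `above_trans` would
give a shortcut. Choose a direction `d k` common to `c k` and `c (k + 1)`. Consecutive choices are
not parallel. If the turn changed sign, `d k` and `d (k + 2)` would be on the same side of `d (k +
1)`, and the one nearer to it would belong to three consecutive cones. -/
theorem ConeFamily.exists_winding {α : Type*} {K : α → ℝ → ℝ → ℝ → Prop} (hK : ConeFamily K)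
    {a : α} (h : Relation.TransGen (AboveRel K) a a) :
    ∃ n c σ dx dy, Winding K n c σ dx dy := by
  obtain ⟨n, c, hc, hmin⟩ := exists_minimal_cycle (fun a h => h.1 rfl) h
  have hd : ∀ k, ∃ x y, Dir K (c k) x y ∧ Dir K (c (k + 1)) x y := fun k => by
    obtain ⟨-, x, y, z, z', h1, h2, -⟩ := hc.step k
    exact ⟨x, y, ⟨z, h1⟩, ⟨z', h2⟩⟩
  choose dx dy hl hr using hd
  have perM : ∀ k, c (k % n) = c k := fun k => by
    conv_rhs => rw [← Nat.mod_add_div k n]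
    generalize k / n = j
    induction j with
    | zero => simp
    | succ j ih => rw [Nat.mul_succ, ← add_assoc, hc.per, ih]
  have perM1 : ∀ k, c (k % n + 1) = c (k + 1) := fun k => by
    rw [← perM (k % n + 1), ← perM (k + 1), Nat.mod_add_mod]
  have notriple : ∀ k x y, Dir K (c k) x y → Dir K (c (k + 1)) x y → ¬ Dir K (c (k + 2)) x y :=
    fun k x y h1 h2 h3 => hmin k (hK.above_trans (hc.step k) (hc.step (k + 1)) h1 h2 h3)
  -- Reducing the index modulo `n` makes the chosen directions periodic.
  set ex : ℕ → ℝ := fun k => dx (k % n) with hex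
  set ey : ℕ → ℝ := fun k => dy (k % n) with hey
  have hl' : ∀ k, Dir K (c k) (ex k) (ey k) := fun k => by
    rw [← perM k]; exact hl _
  have hr' : ∀ k, Dir K (c (k + 1)) (ex k) (ey k) := fun k => by
    rw [← perM1 k]; exact hr _
  have hne : ∀ k, ex k * ey (k + 1) - ex (k + 1) * ey k ≠ 0 := fun k h0 =>
    notriple k _ _ (hl' k) (hr' k) (hK.dir_parallel (hl' (k + 1)) (hr' k) (by linarith)
      (hr' (k + 1)))
  -- The first turn itself serves as `σ`, so its product with itself is positive.
  refine ⟨n, c, ex 0 * ey 1 - ex 1 * ey 0, ex, ey, hc, fun k => by simp [hex],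
    fun k => by simp [hey], hl', hr', notriple, fun k => ?_⟩
  set σ := ex 0 * ey 1 - ex 1 * ey 0 with hσ
  have hσ0 : σ ≠ 0 := hne 0
  induction k with
  | zero => exact mul_self_pos.2 hσ0
  | succ k ih =>
    by_contra hlt
    have hlt' : 0 < σ * (ex (k + 2) * ey (k + 1) - ex (k + 1) * ey (k + 2)) := by
      have := mul_ne_zero hσ0 (hne (k + 1))
      have h1 : σ * (ex (k + 1) * ey (k + 2) - ex (k + 2) * ey (k + 1)) < 0 :=
        lt_of_le_of_ne (not_lt.1 hlt) this
      linarith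
    rcases le_or_gt 0 (σ * (ex k * ey (k + 2) - ex (k + 2) * ey k)) with h2 | h2
    · exact notriple (k + 1) _ _ (hK.dir_between (hr' k) (hl' (k + 1)) ih h2 hlt'.le
        (by linarith)) (hl' (k + 2)) (hr' (k + 2))
    · exact notriple k _ _ (hl' k) (hr' k) (hK.dir_between (hl' (k + 2)) (hr' (k + 1)) hlt'
        (by linarith) ih.le (by linarith))

namespace Winding

variable {α : Type*} {K : α → ℝ → ℝ → ℝ → Prop} {n : ℕ} {c : ℕ → α} {σ : ℝ} {dx dy : ℕ → ℝ}

/-- A winding cycle occupies all directions. -/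
theorem cover (W : Winding K n c σ dx dy) (hK : ConeFamily K) {x y : ℝ}
    (hxy : 0 < x * x + y * y) : ∃ k, Dir K (c k) x y := by
  by_contra! hno
  -- Up to the factor `σ`, `g` and `s` are the cross and dot products of the missed direction with
  -- `d k`. A passage of `g` from nonpositive to positive would put that direction between `d k` and
  -- `d (k + 1)`, hence in the cone `c (k + 1)`. By periodicity `g` is then always positive or never
  -- positive.
  set g : ℕ → ℝ := fun k => σ * (x * dy k - dx k * y) with hg
  set s : ℕ → ℝ := fun k => x * dx k + y * dy k with hs
  have key : ∀ k, 0 < s k * g (k + 1) - g k * s (k + 1) := fun k => by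
    have := mul_pos hxy (W.turn k)
    simp only [hs, hg]
    nlinarith
  have gper : ∀ k, g (k + n) = g k := fun k => by simp only [hg, W.perx, W.pery]
  have sper : ∀ k, s (k + n) = s k := fun k => by simp only [hs, W.perx, W.pery]
  have hstep : ∀ k, g k ≤ 0 → g (k + 1) ≤ 0 := fun k hk => by
    by_contra! h1
    refine hno (k + 1) (hK.dir_between (W.right k) (W.left (k + 1)) (W.turn k) ?_ h1.le ?_) <;>
      simp only [hg] at hk h1 <;> linarith
  -- The quotient `s / g` is, up to `σ`, the cotangent of the angle to `d k`. While `g` has constant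
  -- sign it decreases strictly, which contradicts periodicity.
  have hanti : (∀ k, 0 < g k * g (k + 1)) → False := fun hp => by
    have hlt : StrictAnti fun k => s k / g k := strictAnti_nat_of_succ_lt fun k => by
      have h1 := hp k
      have h2 : s k / g k - s (k + 1) / g (k + 1)
          = (s k * g (k + 1) - g k * s (k + 1)) / (g k * g (k + 1)) := by
        have := left_ne_zero_of_mul h1.ne'
        have := right_ne_zero_of_mul h1.ne'
        field_simp
      have := div_pos (key k) h1
      linarith
    have := hlt (show 0 < n from W.cyc.pos)
    have h1 := gper 0
    have h2 := sper 0
    rw [zero_add] at h1 h2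
    simp only [h1, h2, lt_irrefl] at this
  by_cases hall : ∀ k, 0 < g k
  · exact hanti fun k => mul_pos (hall k) (hall (k + 1))
  · push Not at hall
    obtain ⟨k0, hk0⟩ := hall
    have h1 : ∀ j, g (k0 + j) ≤ 0 := fun j => by
      induction j with
      | zero => exact hk0
      | succ j ih => exact hstep _ ih
    have h2 : ∀ k, g k ≤ 0 := fun k => by
      have h3 : ∀ j, g (k + j * n) = g k := fun j => by
        induction j with
        | zero => simp
        | succ j ih => rw [Nat.succ_mul, ← add_assoc, gper, ih]
      obtain ⟨m, hm⟩ : ∃ m, k + k0 * n = k0 + m := ⟨k + k0 * n - k0, by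
        have := Nat.le_mul_of_pos_right k0 W.cyc.pos
        omega⟩
      rw [← h3 k0, hm]
      exact h1 m
    have h3 : ∀ k, g (k + 1) ≠ 0 := fun k h0 => by
      have e1 := key k
      have e2 := key (k + 1)
      rw [h0] at e1 e2
      have h4 := h2 k
      have h5 := h2 (k + 1 + 1)
      have h6 : 0 < s (k + 1) := by
        by_contra! h7
        linarith [mul_nonneg_of_nonpos_of_nonpos h4 h7]
      linarith [mul_nonpos_of_nonneg_of_nonpos h6.le h5]
    have h4 : ∀ k, g k < 0 := fun k => by
      refine lt_of_le_of_ne (h2 k) ?_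
      rw [← gper k]
      obtain ⟨m, hm⟩ : ∃ m, k + n = m + 1 := ⟨k + n - 1, by have := W.cyc.pos; omega⟩
      rw [hm]
      exact h3 m
    exact hanti fun k => mul_pos_of_neg_of_neg (h4 k) (h4 (k + 1))

/-- Being above a winding cycle propagates along segments that avoid the cones and go in the
direction in which the cycle turns. -/
theorem exists_under (W : Winding K n c σ dx dy) (hK : ConeFamily K) {x y z x' y' z' : ℝ}
    (hturn : 0 < σ * (x * y' - x' * y))
    (free : ∀ a, ∀ s t : ℝ, 0 ≤ s → 0 ≤ t →
      ¬ K a (s * x + t * x') (s * y + t * y') (s * z + t * z'))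
    (h : ∃ k, Under K (c k) x y z) : ∃ k, Under K (c k) x' y' z' := by
  by_contra! hno
  -- If a cone under some point of the segment also occupied the final direction, it would be under
  -- the endpoint by `under_of_free`.
  have base : ∀ k, ∀ s t : ℝ, 0 ≤ s → 0 ≤ t →
      Under K (c k) (s * x + t * x') (s * y + t * y') (s * z + t * z') → ¬ Dir K (c k) x' y' := by
    intro k s t hs ht hu hd
    refine hno k (hK.under_of_free hu hd fun s' t' hs' ht' hk => ?_)
    refine free (c k) (s' * s) (s' * t + t') (by positivity) (by positivity) ?_
    convert hk using 1 <;> ring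
  -- A cone under a point of the segment hands over to its successor: either the successor occupies
  -- the same direction, or the segment goes on to the shared direction `d k` and the switch is made
  -- there. After a full turn every cone of the cycle has been under a point of the segment, so by
  -- `base` none occupies the final direction, against `cover`.
  have step : ∀ k, (∃ s t : ℝ, 0 ≤ s ∧ 0 ≤ t ∧
      Under K (c k) (s * x + t * x') (s * y + t * y') (s * z + t * z')) →
      ∃ s t : ℝ, 0 ≤ s ∧ 0 ≤ t ∧
        Under K (c (k + 1)) (s * x + t * x') (s * y + t * y') (s * z + t * z') := by
    rintro k ⟨s, t, hs, ht, hu⟩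
    have hndu := base k s t hs ht hu
    set px := s * x + t * x' with hpx
    set py := s * y + t * y' with hpy
    set pz := s * z + t * z' with hpz
    have hdp : Dir K (c k) px py := let ⟨w, _, hw⟩ := hu; ⟨w, hw⟩
    by_cases hd : Dir K (c (k + 1)) px py
    · exact ⟨s, t, hs, ht, hK.under_of_above (W.cyc.step k) hu hd⟩
    -- The direction `d k` is still ahead of the current point. Otherwise the point is between `d k`
    -- and `d (k + 1)`, and the successor occupies its direction, or it is at or past `d (k + 1)`,
    -- which then lies in three consecutive cones.
    have i1 : 0 < σ * (px * dy k - dx k * py) := by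
      by_contra! h1
      have h2 := W.turn k
      rcases lt_or_ge 0 (σ * (px * dy (k + 1) - dx (k + 1) * py)) with h3 | h3
      · exact hd (hK.dir_between (W.right k) (W.left (k + 1)) h2 (by linarith) h3.le (by linarith))
      · have h4 : σ * (dx k * py - px * dy k) ≠ 0 := fun h0 => by
          rcases mul_eq_zero.1 h0 with h5 | h5
          · rw [h5] at h2; simp at h2
          · exact hd (hK.dir_parallel (W.left k) hdp h5 (W.right k))
        have h5 : 0 < σ * (dx k * py - px * dy k) := lt_of_le_of_ne (by linarith) h4.symm
        exact W.notriple k _ _ (hK.dir_between (W.left k) hdp h5 h2.le (by linarith)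
          (by linarith)) (W.left (k + 1)) (W.right (k + 1))
    have hs0 : s ≠ 0 := by
      rintro rfl
      have ht0 : t ≠ 0 := by
        rintro rfl
        obtain ⟨w, hw⟩ := hdp
        simp only [hpx, hpy, zero_mul, add_zero] at hw
        exact hK.axis hw
      have ht1 : 0 < t := lt_of_le_of_ne ht ht0.symm
      apply hndu
      apply hK.dir_of_smul ht1
      simpa [hpx, hpy] using hdp
    have hs1 : 0 < s := lt_of_le_of_ne hs hs0.symm
    have i2 : 0 < σ * (px * y' - x' * py) := by
      have := mul_pos hs1 hturn
      simp only [hpx, hpy]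
      nlinarith
    have i3 : 0 < σ * (dx k * y' - x' * dy k) := by
      by_contra! h1
      exact hndu (hK.dir_between hdp (W.left k) i1 i2.le (by linarith) (by linarith))
    -- Cramer coefficients of the point of the segment that lies over the direction `d k`.
    set r := σ * (dx k * y' - x' * dy k) with hr
    set q := σ * (px * dy k - dx k * py) with hq
    have ex : r * px + q * x' = (σ * (px * y' - x' * py)) * dx k := by rw [hr, hq]; ring
    have ey : r * py + q * y' = (σ * (px * y' - x' * py)) * dy k := by rw [hr, hq]; ring
    have d1 : Dir K (c k) (r * px + q * x') (r * py + q * y') := by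
      rw [ex, ey]; exact hK.dir_smul i2 (W.left k)
    have d2 : Dir K (c (k + 1)) (r * px + q * x') (r * py + q * y') := by
      rw [ex, ey]; exact hK.dir_smul i2 (W.right k)
    have hu' : Under K (c k) (r * px + q * x') (r * py + q * y') (r * pz + q * z') := by
      refine hK.under_of_free hu d1 fun s' t' hs' ht' hk => ?_
      refine free (c k) ((s' + t' * r) * s) ((s' + t' * r) * t + t' * q) (by positivity)
        (by positivity) ?_
      convert hk using 1 <;> simp only [hpx, hpy, hpz] <;> ring
    refine ⟨r * s, r * t + q, by positivity, by positivity, ?_⟩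
    convert hK.under_of_above (W.cyc.step k) hu' d2 using 1 <;> simp only [hpx, hpy, hpz] <;> ring
  obtain ⟨k0, hk0⟩ := h
  have hall : ∀ j, ∃ s t : ℝ, 0 ≤ s ∧ 0 ≤ t ∧
      Under K (c (k0 + j)) (s * x + t * x') (s * y + t * y') (s * z + t * z') := fun j => by
    induction j with
    | zero => exact ⟨1, 0, zero_le_one, le_rfl, by simpa using hk0⟩
    | succ j ih => exact step _ ih
  have hpos : 0 < x' * x' + y' * y' := by
    by_contra! h0
    have hx : x' = 0 := by nlinarith [mul_self_nonneg x', mul_self_nonneg y']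
    have hy : y' = 0 := by nlinarith [mul_self_nonneg x', mul_self_nonneg y']
    subst hx hy
    simp at hturn
  obtain ⟨k, hk⟩ := W.cover hK hpos
  have h3 : ∀ j, c (k + j * n) = c k := fun j => by
    induction j with
    | zero => simp
    | succ j ih => rw [Nat.succ_mul, ← add_assoc, W.cyc.per, ih]
  obtain ⟨m, hm⟩ : ∃ m, k + k0 * n = k0 + m := ⟨k + k0 * n - k0, by
    have := Nat.le_mul_of_pos_right k0 W.cyc.pos
    omega⟩
  obtain ⟨s, t, hs, ht, hu⟩ := hall m
  rw [← hm] at hu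
  exact base _ s t hs ht hu (by rw [h3]; exact hk)

end Winding

/-! ### Coordinates and cones over subsets of the sphere -/

/-- The vector with the given coordinates. -/
def vec (x y z : ℝ) : EuclideanSpace ℝ (Fin 3) := !₂[x, y, z]

@[simp] theorem vec_zero (x y z : ℝ) : vec x y z 0 = x := rfl
@[simp] theorem vec_one (x y z : ℝ) : vec x y z 1 = y := rfl
@[simp] theorem vec_two (x y z : ℝ) : vec x y z 2 = z := rfl

theorem ext3 {p q : EuclideanSpace ℝ (Fin 3)} (h0 : p 0 = q 0) (h1 : p 1 = q 1)
    (h2 : p 2 = q 2) : p = q := by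
  ext i; fin_cases i <;> assumption

theorem S2.ext3 {p q : S2} (h0 : p.1 0 = q.1 0) (h1 : p.1 1 = q.1 1) (h2 : p.1 2 = q.1 2) :
    p = q := Subtype.ext (SphereTriang.ext3 h0 h1 h2)

theorem norm_sq3 (p : EuclideanSpace ℝ (Fin 3)) :
    ‖p‖ ^ 2 = p 0 ^ 2 + p 1 ^ 2 + p 2 ^ 2 := by
  rw [EuclideanSpace.norm_sq_eq, Fin.sum_univ_three]
  simp

theorem S2.sq_sum (p : S2) : p.1 0 ^ 2 + p.1 1 ^ 2 + p.1 2 ^ 2 = 1 := by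
  have h : ‖p.1‖ = 1 := by simp
  rw [← norm_sq3, h, one_pow]

/-- Radial projection of a nonzero vector to the sphere. -/
def nrm (v : EuclideanSpace ℝ (Fin 3)) (h : v ≠ 0) : S2 :=
  ⟨‖v‖⁻¹ • v, by simp [norm_smul, inv_mul_cancel₀ (norm_ne_zero_iff.2 h)]⟩

/-- The cone over a subset of the sphere, as a relation between coordinates. -/
def Cn (A : Set S2) (x y z : ℝ) : Prop :=
  ∃ p ∈ A, ∃ r : ℝ, 0 < r ∧ p.1 0 = r * x ∧ p.1 1 = r * y ∧ p.1 2 = r * z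

theorem cn_of_mem {A : Set S2} {p : S2} (hp : p ∈ A) : Cn A (p.1 0) (p.1 1) (p.1 2) :=
  ⟨p, hp, 1, one_pos, by simp⟩

theorem Cn.smul {A : Set S2} {s x y z : ℝ} (hs : 0 < s) (h : Cn A x y z) :
    Cn A (s * x) (s * y) (s * z) := by
  obtain ⟨p, hp, r, hr, h0, h1, h2⟩ := h
  refine ⟨p, hp, r / s, by positivity, ?_, ?_, ?_⟩ <;> field_simp <;> assumption

theorem cn_smul_iff {A : Set S2} {s x y z : ℝ} (hs : 0 < s) :
    Cn A (s * x) (s * y) (s * z) ↔ Cn A x y z := by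
  refine ⟨fun h => ?_, Cn.smul hs⟩
  have := h.smul (inv_pos.2 hs)
  simpa [← mul_assoc, inv_mul_cancel₀ hs.ne'] using this

theorem S2.eq_of_smul {p q : S2} {r s x y z : ℝ} (hr : 0 < r) (hs : 0 < s) (h0 : p.1 0 = r * x)
    (h1 : p.1 1 = r * y) (h2 : p.1 2 = r * z) (h0' : q.1 0 = s * x) (h1' : q.1 1 = s * y)
    (h2' : q.1 2 = s * z) : p = q := by
  have e1 := p.sq_sum
  have e2 := q.sq_sum
  rw [h0, h1, h2] at e1
  rw [h0', h1', h2'] at e2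
  have e3 : r ^ 2 * (x ^ 2 + y ^ 2 + z ^ 2) = 1 := by linarith
  have e4 : s ^ 2 * (x ^ 2 + y ^ 2 + z ^ 2) = 1 := by linarith
  have e5 : x ^ 2 + y ^ 2 + z ^ 2 ≠ 0 := fun h => by simp [h] at e3
  have e6 : r ^ 2 = s ^ 2 := mul_right_cancel₀ e5 (e3.trans e4.symm)
  have e7 : r = s := by nlinarith
  subst e7
  exact S2.ext3 (h0.trans h0'.symm) (h1.trans h1'.symm) (h2.trans h2'.symm)

theorem cn_mem_iff {A : Set S2} {p : S2} : Cn A (p.1 0) (p.1 1) (p.1 2) ↔ p ∈ A := by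
  refine ⟨?_, cn_of_mem⟩
  rintro ⟨q, hq, r, hr, h0, h1, h2⟩
  have : q = p := S2.eq_of_smul hr one_pos h0 h1 h2 (by simp) (by simp) (by simp)
  rwa [← this]

theorem cn_of_smul_mem {A : Set S2} {p : S2} {r x y z : ℝ} (hr : 0 < r) (h0 : p.1 0 = r * x)
    (h1 : p.1 1 = r * y) (h2 : p.1 2 = r * z) : Cn A x y z ↔ p ∈ A := by
  rw [← cn_mem_iff, h0, h1, h2, cn_smul_iff hr]

theorem cn_iff_nrm {A : Set S2} {x y z : ℝ} (h : vec x y z ≠ 0) :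
    Cn A x y z ↔ nrm (vec x y z) h ∈ A :=
  cn_of_smul_mem (inv_pos.2 (norm_pos_iff.2 h)) (by simp [nrm]) (by simp [nrm]) (by simp [nrm])

theorem Cn.ne_zero {A : Set S2} {x y z : ℝ} (h : Cn A x y z) : vec x y z ≠ 0 := by
  obtain ⟨p, -, r, -, h0, h1, h2⟩ := h
  intro hv
  have h3 : x = 0 := congrArg (· 0) hv
  have h4 : y = 0 := congrArg (· 1) hv
  have h5 : z = 0 := congrArg (· 2) hv
  subst h3 h4 h5
  have := p.sq_sum
  rw [h0, h1, h2] at this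
  simp at this

theorem vec_ne_zero {x y z : ℝ} (h : (x, y) ≠ (0, 0)) : vec x y z ≠ 0 := fun hv => h (by
  have h3 : x = 0 := congrArg (· 0) hv
  have h4 : y = 0 := congrArg (· 1) hv
  rw [h3, h4])

theorem Cn.inter {A B : Set S2} {x y z : ℝ} (h : Cn A x y z) (h' : Cn B x y z) :
    Cn (A ∩ B) x y z := by
  rw [cn_iff_nrm h.ne_zero] at *
  exact ⟨h, h'⟩

theorem continuous_coord (i : Fin 3) : Continuous fun p : S2 => p.1 i :=
  (EuclideanSpace.proj (𝕜 := ℝ) i).continuous.comp continuous_subtype_val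

/-- A continuous path of nonzero vectors gives a continuous path on the sphere. -/
theorem continuousAt_nrm {X : Type*} [TopologicalSpace X] {f : X → EuclideanSpace ℝ (Fin 3)}
    (hf : Continuous f) (h : ∀ t, f t ≠ 0) : Continuous fun t => nrm (f t) (h t) := by
  refine Continuous.subtype_mk ?_ _
  exact (hf.norm.inv₀ fun t => norm_ne_zero_iff.2 (h t)).smul hf

theorem continuous_vec {X : Type*} [TopologicalSpace X] {f g h : X → ℝ} (hf : Continuous f)
    (hg : Continuous g) (hh : Continuous h) : Continuous fun t => vec (f t) (g t) (h t) := by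
  unfold vec
  fun_prop

/-- The part of the sphere in a convex cone is connected. -/
theorem isPreconnected_cone {C : Set (EuclideanSpace ℝ (Fin 3))} (hC : Convex ℝ C)
    (h0 : (0 : EuclideanSpace ℝ (Fin 3)) ∉ C) (hs : ∀ x ∈ C, ∀ t : ℝ, 0 < t → t • x ∈ C) :
    IsPreconnected {p : S2 | p.1 ∈ C} := by
  rw [← Topology.IsInducing.subtypeVal.isPreconnected_image]
  have : Subtype.val '' {p : S2 | p.1 ∈ C} = (fun x => ‖x‖⁻¹ • x) '' C := by
    ext x
    constructor
    · rintro ⟨p, hp, rfl⟩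
      have h : ‖p.1‖ = 1 := by simp
      exact ⟨p.1, hp, by simp [h]⟩
    · rintro ⟨y, hy, rfl⟩
      have hy0 : y ≠ 0 := fun h => h0 (h ▸ hy)
      exact ⟨nrm y hy0, hs y hy _ (inv_pos.2 (norm_pos_iff.2 hy0)), rfl⟩
  rw [this]
  refine hC.isPreconnected.image _ ?_
  refine ContinuousOn.smul (ContinuousOn.inv₀ continuous_norm.continuousOn fun x hx => ?_)
    continuousOn_id
  exact norm_ne_zero_iff.2 fun h => h0 (h ▸ hx)

/-! ### Spherical triangles -/

/-- The determinant of three vectors. -/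
def det3 (p q r : EuclideanSpace ℝ (Fin 3)) : ℝ :=
  p 0 * (q 1 * r 2 - q 2 * r 1) - p 1 * (q 0 * r 2 - q 2 * r 0) + p 2 * (q 0 * r 1 - q 1 * r 0)

/-- The coefficient of `p` in the expansion of `x` in the basis `p`, `q`, `r`. -/
def bar (p q r x : EuclideanSpace ℝ (Fin 3)) : ℝ := det3 x q r / det3 p q r

theorem det3_rot (p q r : EuclideanSpace ℝ (Fin 3)) : det3 q r p = det3 p q r := by
  unfold det3; ring

theorem bar_comb (p q r x y : EuclideanSpace ℝ (Fin 3)) (s t : ℝ) :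
    bar p q r (s • x + t • y) = s * bar p q r x + t * bar p q r y := by
  simp only [bar, det3, PiLp.add_apply, PiLp.smul_apply, smul_eq_mul]
  ring

theorem bar_smul (p q r x : EuclideanSpace ℝ (Fin 3)) (s : ℝ) :
    bar p q r (s • x) = s * bar p q r x := by
  simpa using bar_comb p q r x 0 s 0

theorem bar_self {p q r : EuclideanSpace ℝ (Fin 3)} (h : det3 p q r ≠ 0) : bar p q r p = 1 :=
  div_self h

theorem bar_second (p q r : EuclideanSpace ℝ (Fin 3)) : bar p q r q = 0 := by
  have : det3 q q r = 0 := by unfold det3; ring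
  rw [bar, this, zero_div]

theorem bar_third (p q r : EuclideanSpace ℝ (Fin 3)) : bar p q r r = 0 := by
  have : det3 r q r = 0 := by unfold det3; ring
  rw [bar, this, zero_div]

theorem bar_expand {p q r : EuclideanSpace ℝ (Fin 3)} (h : det3 p q r ≠ 0)
    (x : EuclideanSpace ℝ (Fin 3)) : x = bar p q r x • p + bar q r p x • q + bar r p q x • r := by
  have h1 : bar q r p x = det3 x r p / det3 p q r := by rw [bar, det3_rot p q r]
  have h2 : bar r p q x = det3 x p q / det3 p q r := by rw [bar, det3_rot q r p, det3_rot p q r]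
  rw [h1, h2, bar]
  apply ext3 <;> simp only [PiLp.add_apply, PiLp.smul_apply, smul_eq_mul] <;> field_simp <;>
    unfold det3 <;> ring

theorem continuous_bar (p q r : EuclideanSpace ℝ (Fin 3)) :
    Continuous fun x : S2 => bar p q r x.1 := by
  unfold bar det3
  have := continuous_coord
  fun_prop

theorem convex_bar_pos (p q r : EuclideanSpace ℝ (Fin 3)) : Convex ℝ {x | 0 < bar p q r x} := by
  intro x hx y hy s t hs ht hst
  simp only [Set.mem_ofPred_eq] at *
  rw [bar_comb]
  rcases hs.eq_or_lt with rfl | hs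
  · obtain rfl : t = 1 := by linarith
    simpa using hy
  · positivity

theorem convex_bar_neg (p q r : EuclideanSpace ℝ (Fin 3)) : Convex ℝ {x | bar p q r x < 0} := by
  intro x hx y hy s t hs ht hst
  simp only [Set.mem_ofPred_eq] at *
  rw [bar_comb]
  rcases hs.eq_or_lt with rfl | hs
  · obtain rfl : t = 1 := by linarith
    simpa using hy
  · nlinarith

/-- The open convex spherical triangle. -/
def tri (p q r : EuclideanSpace ℝ (Fin 3)) : Set S2 :=
  {x | 0 < bar p q r x.1 ∧ 0 < bar q r p x.1 ∧ 0 < bar r p q x.1}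

/-- The exterior of the convex spherical triangle. -/
def triExt (p q r : EuclideanSpace ℝ (Fin 3)) : Set S2 :=
  {x | bar p q r x.1 < 0 ∨ bar q r p x.1 < 0 ∨ bar r p q x.1 < 0}

theorem isOpen_tri (p q r : EuclideanSpace ℝ (Fin 3)) : IsOpen (tri p q r) :=
  (isOpen_lt continuous_const (continuous_bar p q r)).inter
    ((isOpen_lt continuous_const (continuous_bar q r p)).inter
      (isOpen_lt continuous_const (continuous_bar r p q)))

theorem isOpen_triExt (p q r : EuclideanSpace ℝ (Fin 3)) : IsOpen (triExt p q r) :=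
  (isOpen_lt (continuous_bar p q r) continuous_const).union
    ((isOpen_lt (continuous_bar q r p) continuous_const).union
      (isOpen_lt (continuous_bar r p q) continuous_const))

theorem bar_zero (p q r : EuclideanSpace ℝ (Fin 3)) : bar p q r 0 = 0 := by
  simp [bar, det3]

theorem isPreconnected_tri (p q r : EuclideanSpace ℝ (Fin 3)) : IsPreconnected (tri p q r) := by
  refine isPreconnected_cone (C := {x | 0 < bar p q r x} ∩ ({x | 0 < bar q r p x} ∩
    {x | 0 < bar r p q x})) ?_ ?_ ?_
  · exact (convex_bar_pos p q r).inter ((convex_bar_pos q r p).inter (convex_bar_pos r p q))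
  · simp [bar_zero]
  · rintro x ⟨h1, h2, h3⟩ t ht
    simp only [Set.mem_inter_iff, Set.mem_ofPred_eq, bar_smul] at *
    exact ⟨by positivity, by positivity, by positivity⟩

theorem isPreconnected_bar_neg (p q r : EuclideanSpace ℝ (Fin 3)) :
    IsPreconnected {x : S2 | bar p q r x.1 < 0} := by
  refine isPreconnected_cone (C := {x | bar p q r x < 0}) (convex_bar_neg p q r) ?_ ?_
  · simp [bar_zero]
  · intro x hx t ht
    simp only [Set.mem_ofPred_eq, bar_smul] at *
    nlinarith

/-- The exterior is a union of three open hemispheres, which all contain the direction of -(p + q +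
r). -/
theorem isPreconnected_triExt {p q r : EuclideanSpace ℝ (Fin 3)} (h : det3 p q r ≠ 0) :
    IsPreconnected (triExt p q r) := by
  set v : EuclideanSpace ℝ (Fin 3) := (-1 : ℝ) • ((1 : ℝ) • p + (1 : ℝ) • ((1 : ℝ) • q + (1 : ℝ) • r))
    with hv
  have hq : det3 q r p ≠ 0 := by rwa [det3_rot]
  have hr : det3 r p q ≠ 0 := by rwa [det3_rot, det3_rot]
  have h1 : bar p q r v = -1 := by
    rw [hv, bar_smul, bar_comb, bar_comb, bar_self h, bar_second, bar_third]; norm_num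
  have h2 : bar q r p v = -1 := by
    rw [hv, bar_smul, bar_comb, bar_comb, bar_self hq, bar_second, bar_third]; norm_num
  have h3 : bar r p q v = -1 := by
    rw [hv, bar_smul, bar_comb, bar_comb, bar_self hr, bar_second, bar_third]; norm_num
  have hv0 : v ≠ 0 := fun h0 => by rw [h0, bar_zero] at h1; norm_num at h1
  have hpos : 0 < ‖v‖⁻¹ := inv_pos.2 (norm_pos_iff.2 hv0)
  have m1 : bar p q r (nrm v hv0).1 < 0 := by simp only [nrm, bar_smul, h1]; linarith
  have m2 : bar q r p (nrm v hv0).1 < 0 := by simp only [nrm, bar_smul, h2]; linarith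
  have m3 : bar r p q (nrm v hv0).1 < 0 := by simp only [nrm, bar_smul, h3]; linarith
  exact IsPreconnected.union (nrm v hv0) m1 (Or.inl m2) (isPreconnected_bar_neg p q r)
    (IsPreconnected.union (nrm v hv0) m2 m3 (isPreconnected_bar_neg q r p)
      (isPreconnected_bar_neg r p q))

theorem arc_symm (p q : S2) : arc p q = arc q p := by
  ext x
  constructor <;> rintro ⟨a, b, ha, hb, h⟩ <;> exact ⟨b, a, hb, ha, by rw [h, add_comm]⟩

theorem left_mem_arc (p q : S2) : p ∈ arc p q := ⟨1, 0, zero_le_one, le_rfl, by simp⟩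

theorem not_mem_of_arc {p q r x : S2} (hx : x ∈ arc p q) :
    x ∉ tri p.1 q.1 r.1 ∧ bar r.1 p.1 q.1 x.1 = 0 := by
  obtain ⟨a, b, ha, hb, h⟩ := hx
  have : bar r.1 p.1 q.1 x.1 = 0 := by rw [h, bar_comb, bar_second, bar_third]; simp
  exact ⟨fun h' => h'.2.2.ne' this, this⟩

theorem arc_bar_nonneg {p q r x : S2} (h : det3 p.1 q.1 r.1 ≠ 0) (hx : x ∈ arc p q) :
    0 ≤ bar p.1 q.1 r.1 x.1 ∧ 0 ≤ bar q.1 r.1 p.1 x.1 ∧ bar r.1 p.1 q.1 x.1 = 0 := by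
  refine ⟨?_, ?_, (not_mem_of_arc hx).2⟩ <;> obtain ⟨a, b, ha, hb, e⟩ := hx
  · rw [e, bar_comb, bar_self h, bar_second]; simpa
  · rw [e, bar_comb, bar_self (by rwa [det3_rot]), bar_third]; simpa

/-- The boundary of the triangle. -/
def triBdry (p q r : S2) : Set S2 := arc p q ∪ arc q r ∪ arc r p

/-- Points outside both open sides have nonnegative barycentric coordinates with at least one zero;
the expansion in the basis then puts them on a side of the triangle. -/
theorem mem_triBdry_iff {p q r : S2} (h : det3 p.1 q.1 r.1 ≠ 0) {x : S2} :
    x ∈ triBdry p q r ↔ x ∉ tri p.1 q.1 r.1 ∧ x ∉ triExt p.1 q.1 r.1 := by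
  have hq : det3 q.1 r.1 p.1 ≠ 0 := by rwa [det3_rot]
  have hr : det3 r.1 p.1 q.1 ≠ 0 := by rwa [det3_rot, det3_rot]
  have e := bar_expand h x.1
  constructor
  · rintro ((hx | hx) | hx)
    · obtain ⟨h1, h2, h3⟩ := arc_bar_nonneg h hx
      exact ⟨fun h' => h'.2.2.ne' h3, by rintro (h' | h' | h') <;> linarith⟩
    · obtain ⟨h1, h2, h3⟩ := arc_bar_nonneg hq hx
      exact ⟨fun h' => h'.1.ne' h3, by rintro (h' | h' | h') <;> linarith⟩
    · obtain ⟨h1, h2, h3⟩ := arc_bar_nonneg hr hx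
      exact ⟨fun h' => h'.2.1.ne' h3, by rintro (h' | h' | h') <;> linarith⟩
  · rintro ⟨h1, h2⟩
    simp only [triExt, Set.mem_ofPred_eq, not_or, not_lt] at h2
    obtain ⟨ha, hb, hc⟩ := h2
    rcases ha.eq_or_lt with ha' | ha'
    · rw [← ha', zero_smul, zero_add] at e
      exact Or.inl (Or.inr ⟨_, _, hb, hc, e⟩)
    rcases hb.eq_or_lt with hb' | hb'
    · rw [← hb', zero_smul, add_zero] at e
      exact Or.inr ⟨_, _, hc, ha, e.trans (add_comm _ _)⟩
    rcases hc.eq_or_lt with hc' | hc'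
    · rw [← hc', zero_smul, add_zero] at e
      exact Or.inl (Or.inl ⟨_, _, ha, hb, e⟩)
    exact (h1 ⟨ha', hb', hc'⟩).elim

theorem _root_.IsPreconnected.subset_of_disjoint_frontier {X : Type*} [TopologicalSpace X]
    {s t : Set X} (hs : IsPreconnected s) (hd : Disjoint s (frontier t)) (hn : (s ∩ t).Nonempty) :
    s ⊆ t := by
  have hcov : s ⊆ interior t ∪ (closure t)ᶜ := fun x hx => by
    by_contra hn
    rw [Set.mem_union, not_or, Set.mem_compl_iff, not_not] at hn
    exact Set.disjoint_left.1 hd hx ⟨hn.2, hn.1⟩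
  refine (hs.subset_left_of_subset_union isOpen_interior isClosed_closure.isOpen_compl ?_ hcov
    ?_).trans interior_subset
  · exact disjoint_compl_right.mono_left (interior_subset.trans subset_closure)
  · obtain ⟨x, hx, hxt⟩ := hn
    exact ⟨x, hx, (hcov hx).resolve_right fun h => h (subset_closure hxt)⟩

/-- Being connected and disjoint from its frontier, `F` lies in one of the two sides of the
triangle. That side is connected and misses the frontier of `F`, so it is contained in `F`. -/
theorem eq_tri_or_triExt {p q r : S2} (h : det3 p.1 q.1 r.1 ≠ 0) {F : Set S2}
    (hF : IsConnected F) (hd : Disjoint F (frontier F)) (hfr : frontier F = triBdry p q r) :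
    F = tri p.1 q.1 r.1 ∨ F = triExt p.1 q.1 r.1 := by
  have hcov : F ⊆ tri p.1 q.1 r.1 ∪ triExt p.1 q.1 r.1 := fun x hx => by
    by_contra hn
    rw [Set.mem_union, not_or] at hn
    exact Set.disjoint_left.1 hd hx (by rw [hfr, mem_triBdry_iff h]; exact hn)
  have hdisj : Disjoint (tri p.1 q.1 r.1) (triExt p.1 q.1 r.1) := by
    rw [Set.disjoint_left]
    rintro x ⟨h1, h2, h3⟩ (h' | h' | h') <;> linarith
  have key : ∀ S : Set S2, IsPreconnected S → Disjoint S (frontier F) → F ⊆ S → F = S := by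
    intro S hS hSd hFS
    exact hFS.antisymm (hS.subset_of_disjoint_frontier hSd (hF.nonempty.mono fun y hy =>
      ⟨hFS hy, hy⟩))
  rcases hF.isPreconnected.subset_or_subset (isOpen_tri _ _ _) (isOpen_triExt _ _ _) hdisj hcov
    with h1 | h1
  · refine Or.inl (key _ (isPreconnected_tri _ _ _) ?_ h1)
    rw [hfr, Set.disjoint_left]
    exact fun x hx hx' => ((mem_triBdry_iff h).1 hx').1 hx
  · refine Or.inr (key _ (isPreconnected_triExt h) ?_ h1)
    rw [hfr, Set.disjoint_left]
    exact fun x hx hx' => ((mem_triBdry_iff h).1 hx').2 hx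

theorem cn_tri_iff {p q r : S2} (h : det3 p.1 q.1 r.1 ≠ 0) {x y z : ℝ} :
    Cn (tri p.1 q.1 r.1) x y z ↔ ∃ a b c : ℝ, 0 < a ∧ 0 < b ∧ 0 < c ∧
      vec x y z = a • p.1 + b • q.1 + c • r.1 := by
  have hq : det3 q.1 r.1 p.1 ≠ 0 := by rwa [det3_rot]
  have hr : det3 r.1 p.1 q.1 ≠ 0 := by rwa [det3_rot, det3_rot]
  constructor
  · intro hc
    have h0 := hc.ne_zero
    rw [cn_iff_nrm h0] at hc
    have hpos : 0 < ‖vec x y z‖⁻¹ := inv_pos.2 (norm_pos_iff.2 h0)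
    simp only [nrm, tri, Set.mem_ofPred_eq, bar_smul, mul_pos_iff_of_pos_left hpos] at hc
    exact ⟨_, _, _, hc.1, hc.2.1, hc.2.2, bar_expand h _⟩
  · rintro ⟨a, b, c, ha, hb, hc, e⟩
    have e' : vec x y z = (1 : ℝ) • (a • p.1 + b • q.1) + c • r.1 := by rw [e, one_smul]
    have h1 : bar p.1 q.1 r.1 (vec x y z) = a := by
      rw [e', bar_comb, bar_comb, bar_self h, bar_second, bar_third]; ring
    have h2 : bar q.1 r.1 p.1 (vec x y z) = b := by
      rw [e', bar_comb, bar_comb, bar_self hq, bar_second, bar_third]; ring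
    have h3 : bar r.1 p.1 q.1 (vec x y z) = c := by
      rw [e', bar_comb, bar_comb, bar_self hr, bar_second, bar_third]; ring
    have h0 : vec x y z ≠ 0 := fun h0 => by rw [h0, bar_zero] at h1; exact ha.ne h1
    have hpos : 0 < ‖vec x y z‖⁻¹ := inv_pos.2 (norm_pos_iff.2 h0)
    rw [cn_iff_nrm h0]
    simp only [nrm, tri, Set.mem_ofPred_eq, bar_smul, mul_pos_iff_of_pos_left hpos, h1, h2, h3]
    exact ⟨ha, hb, hc⟩

theorem cn_triExt_iff {p q r : S2} {x y z : ℝ} :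
    Cn (triExt p.1 q.1 r.1) x y z ↔ bar p.1 q.1 r.1 (vec x y z) < 0 ∨
      bar q.1 r.1 p.1 (vec x y z) < 0 ∨ bar r.1 p.1 q.1 (vec x y z) < 0 := by
  by_cases h0 : vec x y z = 0
  · constructor
    · exact fun h => (h.ne_zero h0).elim
    · simp [h0, bar_zero]
  have hpos : 0 < ‖vec x y z‖⁻¹ := inv_pos.2 (norm_pos_iff.2 h0)
  rw [cn_iff_nrm h0]
  simp only [nrm, triExt, Set.mem_ofPred_eq, bar_smul, mul_neg_iff, hpos, hpos.not_gt, true_and,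
    false_and, or_false]

theorem cn_tri_iff_bar {p q r : S2} {x y z : ℝ} :
    Cn (tri p.1 q.1 r.1) x y z ↔ 0 < bar p.1 q.1 r.1 (vec x y z) ∧
      0 < bar q.1 r.1 p.1 (vec x y z) ∧ 0 < bar r.1 p.1 q.1 (vec x y z) := by
  by_cases h0 : vec x y z = 0
  · constructor
    · exact fun h => (h.ne_zero h0).elim
    · simp [h0, bar_zero]
  have hpos : 0 < ‖vec x y z‖⁻¹ := inv_pos.2 (norm_pos_iff.2 h0)
  rw [cn_iff_nrm h0]
  simp only [nrm, tri, Set.mem_ofPred_eq, bar_smul, mul_pos_iff_of_pos_left hpos]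

theorem vec_add_vert (x y z s t : ℝ) :
    vec x y (z + s * t) = (1 : ℝ) • vec x y z + t • vec 0 0 s := by
  apply ext3 <;> simp [mul_comm]

theorem bar_vert (p q r : EuclideanSpace ℝ (Fin 3)) (s : ℝ) :
    bar p q r (vec 0 0 s) = s * ((q 0 * r 1 - r 0 * q 1) / det3 p q r) := by
  simp only [bar]
  rw [← mul_div_assoc]
  congr 1
  simp only [det3, vec_zero, vec_one, vec_two]
  ring

theorem inner3 (u v : EuclideanSpace ℝ (Fin 3)) :
    ⟪u, v⟫_ℝ = u 0 * v 0 + u 1 * v 1 + u 2 * v 2 := by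
  simp [PiLp.inner_apply, Fin.sum_univ_three, mul_comm]

theorem southPole_coords : southPole.1 0 = 0 ∧ southPole.1 1 = 0 ∧ southPole.1 2 = -1 := by
  simp [southPole, northPole]

theorem northPole_coords : northPole.1 0 = 0 ∧ northPole.1 1 = 0 ∧ northPole.1 2 = 1 := by
  simp [northPole]

theorem northPole_mem_iff {A : Set S2} : northPole ∈ A ↔ Cn A 0 0 1 := by
  obtain ⟨h0, h1, h2⟩ := northPole_coords
  rw [← cn_mem_iff, h0, h1, h2]

theorem southPole_mem_iff {A : Set S2} : southPole ∈ A ↔ Cn A 0 0 (-1) := by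
  obtain ⟨h0, h1, h2⟩ := southPole_coords
  rw [← cn_mem_iff, h0, h1, h2]

/-! ### Consequences of genericity, and the shape of the faces -/

namespace ShortestPathEmbedding

variable {V : Type*} {G : SimpleGraph V} {Γ : ShortestPathEmbedding G}

/-- The standing assumptions: a generic triangulation with at least four vertices and the poles in
different faces. -/
structure IsGood (Γ : ShortestPathEmbedding G) : Prop where
  finite : Finite V
  card : 4 ≤ Nat.card V
  triang : Γ.IsTriangulation
  generic : Γ.IsGeneric
  sep : Γ.PolesSeparated

variable (Γ) in
/-- The horizontal determinant of two vertices; it is positive if the second is east of the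
first. -/
def dt (i j : V) : ℝ := (Γ.pos i).1 0 * (Γ.pos j).1 1 - (Γ.pos j).1 0 * (Γ.pos i).1 1

theorem dt_swap (i j : V) : Γ.dt j i = -Γ.dt i j := by unfold dt; ring

theorem rt_adj_iff {i j : V} : Γ.Rt.Adj i j ↔ G.Adj i j ∧ 0 < Γ.dt i j := by
  change G.Adj i j ∧ _ ↔ _
  rw [Matrix.det_fin_two_of, dt, mul_comm ((Γ.pos i).1 1)]

theorem isBoundedBy_rot {F : Set S2} {i j k : V} (h : Γ.IsBoundedBy F i j k) :
    Γ.IsBoundedBy F j k i := by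
  obtain ⟨h1, h2, h3, h4⟩ := h
  exact ⟨h2, h3, h1, by rw [h4, Set.union_assoc, Set.union_comm]⟩

theorem isBoundedBy_swap {F : Set S2} {i j k : V} (h : Γ.IsBoundedBy F i j k) :
    Γ.IsBoundedBy F j i k := by
  obtain ⟨h1, h2, h3, h4⟩ := h
  refine ⟨h1.symm, h3.symm, h2.symm, ?_⟩
  rw [h4, arc_symm (Γ.pos j) (Γ.pos i), arc_symm (Γ.pos i) (Γ.pos k), arc_symm (Γ.pos k) (Γ.pos j),
    Set.union_assoc, Set.union_assoc, Set.union_comm (arc (Γ.pos j) (Γ.pos k))]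

theorem arc_subset_drawing {i j : V} (h : G.Adj i j) : arc (Γ.pos i) (Γ.pos j) ⊆ Γ.drawing :=
  fun _ hx => Or.inr (Set.mem_iUnion.2 ⟨i, Set.mem_iUnion.2 ⟨j, Set.mem_iUnion.2 ⟨h, hx⟩⟩⟩)

theorem pos_mem_drawing (i : V) : Γ.pos i ∈ Γ.drawing := Or.inl ⟨i, rfl⟩

theorem mem_drawing {x : S2} (h : x ∈ Γ.drawing) :
    (∃ i, x = Γ.pos i) ∨ ∃ i j, G.Adj i j ∧ x ∈ arc (Γ.pos i) (Γ.pos j) := by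
  rcases h with ⟨i, rfl⟩ | h
  · exact Or.inl ⟨i, rfl⟩
  · simp only [Set.mem_iUnion] at h
    obtain ⟨i, j, h1, h2⟩ := h
    exact Or.inr ⟨i, j, h1, h2⟩

theorem vertex_of_frontier {F : Set S2} {i j k v : V} (h : Γ.IsBoundedBy F i j k)
    (hv : Γ.pos v ∈ frontier F) : v = i ∨ v = j ∨ v = k := by
  obtain ⟨h1, h2, h3, h4⟩ := h
  rw [h4] at hv
  rcases hv with (hv | hv) | hv
  · rcases Γ.vertex_mem_arc _ _ _ h1 hv with h | h <;> simp [h]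
  · rcases Γ.vertex_mem_arc _ _ _ h2 hv with h | h <;> simp [h]
  · rcases Γ.vertex_mem_arc _ _ _ h3 hv with h | h <;> simp [h]

theorem mem_frontier_of_isBoundedBy {F : Set S2} {i j k : V} (h : Γ.IsBoundedBy F i j k) :
    Γ.pos i ∈ frontier F := by
  rw [h.2.2.2]
  exact Or.inl (Or.inl (left_mem_arc _ _))

theorem face_connected {F : Set S2} (hF : F ∈ Γ.faces) : IsConnected F := by
  obtain ⟨x, hx, rfl⟩ := hF
  exact isConnected_connectedComponentIn_iff.2 hx

theorem face_subset {F : Set S2} (hF : F ∈ Γ.faces) : F ⊆ Γ.drawingᶜ := by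
  obtain ⟨x, hx, rfl⟩ := hF
  exact connectedComponentIn_subset _ _

theorem face_eq {F F' : Set S2} (hF : F ∈ Γ.faces) (hF' : F' ∈ Γ.faces) {x : S2} (hx : x ∈ F)
    (hx' : x ∈ F') : F = F' := by
  obtain ⟨y, hy, rfl⟩ := hF
  obtain ⟨y', hy', rfl⟩ := hF'
  rw [connectedComponentIn_eq hx, connectedComponentIn_eq hx']

theorem exists_face {x : S2} (hx : x ∉ Γ.drawing) : ∃ F ∈ Γ.faces, x ∈ F :=
  ⟨_, ⟨x, hx, rfl⟩, mem_connectedComponentIn hx⟩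

theorem subset_face {F A : Set S2} (hF : F ∈ Γ.faces) (hA : IsPreconnected A)
    (hAd : A ⊆ Γ.drawingᶜ) {x : S2} (hx : x ∈ A) (hxF : x ∈ F) : A ⊆ F := by
  obtain ⟨y, hy, rfl⟩ := hF
  rw [connectedComponentIn_eq hxF]
  exact hA.subset_connectedComponentIn hx hAd

namespace IsGood

variable (h : Γ.IsGood)
include h

/-- Dependent horizontal parts put both vertices on a vertical plane through the origin, so on a
great circle through the poles. If one horizontal part vanishes, the normal is taken from the other
vertex. -/
theorem dt_ne {i j : V} (hij : i ≠ j) : Γ.dt i j ≠ 0 := by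
  intro h0
  have key : ∀ a b : ℝ, (a, b) ≠ (0, 0) → a * (Γ.pos i).1 0 + b * (Γ.pos i).1 1 = 0 →
      a * (Γ.pos j).1 0 + b * (Γ.pos j).1 1 = 0 → False := by
    intro a b hab hi hj
    have h1 := h.generic.2 {p : S2 | ⟪vec a b 0, p.1⟫_ℝ = 0} ⟨_, vec_ne_zero hab, rfl⟩
      (by change ⟪_, _⟫_ℝ = 0; simp [inner3, northPole_coords])
      (by change ⟪_, _⟫_ℝ = 0; simp [inner3, southPole_coords])
    rw [Set.encard_le_one_iff] at h1
    refine hij (h1 i j ?_ ?_) <;> change ⟪_, _⟫_ℝ = 0 <;> simpa [inner3]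
  unfold dt at h0
  by_cases hi : ((Γ.pos i).1 0, (Γ.pos i).1 1) = (0, 0)
  · rw [Prod.mk.injEq] at hi
    by_cases hj : ((Γ.pos j).1 0, (Γ.pos j).1 1) = (0, 0)
    · rw [Prod.mk.injEq] at hj
      exact key 1 0 (by simp) (by simp [hi]) (by simp [hj])
    · refine key (-(Γ.pos j).1 1) ((Γ.pos j).1 0) (fun h' => hj ?_) (by simp [hi]) (by ring)
      simp only [Prod.mk.injEq, neg_eq_zero] at h' ⊢
      exact h'.symm
  · refine key (-(Γ.pos i).1 1) ((Γ.pos i).1 0) (fun h' => hi ?_) (by ring) (by linarith)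
    simp only [Prod.mk.injEq, neg_eq_zero] at h' ⊢
    exact h'.symm

theorem det3_ne {i j k : V} (hij : i ≠ j) (hjk : j ≠ k) (hik : i ≠ k) :
    det3 (Γ.pos i).1 (Γ.pos j).1 (Γ.pos k).1 ≠ 0 := by
  intro h0
  have hdet : Matrix.det !![(Γ.pos i).1 0, (Γ.pos i).1 1, (Γ.pos i).1 2;
      (Γ.pos j).1 0, (Γ.pos j).1 1, (Γ.pos j).1 2;
      (Γ.pos k).1 0, (Γ.pos k).1 1, (Γ.pos k).1 2] = 0 := by
    rw [Matrix.det_fin_three, ← h0, det3]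
    simp
    ring
  obtain ⟨v, hv, hv0⟩ := Matrix.exists_mulVec_eq_zero_iff.2 hdet
  have e0 := congrFun hv0 0
  have e1 := congrFun hv0 1
  have e2 := congrFun hv0 2
  simp [Matrix.mulVec, dotProduct, Fin.sum_univ_three] at e0 e1 e2
  have h1 := h.generic.1 {p : S2 | ⟪vec (v 0) (v 1) (v 2), p.1⟫_ℝ = 0} ⟨_, fun hz => hv (by
    ext i
    fin_cases i
    · exact congrArg (· 0) hz
    · exact congrArg (· 1) hz
    · exact congrArg (· 2) hz), rfl⟩
  have h2 : ({i, j, k} : Set V).encard = 3 := by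
    rw [Set.encard_eq_three]
    exact ⟨i, j, k, hij, hik, hjk, rfl⟩
  have h3 : ({i, j, k} : Set V).encard ≤ 2 := by
    refine (Set.encard_le_encard ?_).trans h1
    rintro l (rfl | rfl | rfl) <;> change ⟪_, _⟫_ℝ = 0 <;> rw [inner3] <;>
      simp only [vec_zero, vec_one, vec_two] <;> linarith
  rw [h2] at h3
  exact absurd h3 (by decide)

theorem exists_ne (i : V) : ∃ j, i ≠ j := by
  have := h.finite
  have : Nontrivial V := Finite.one_lt_card_iff_nontrivial.1 (by have := h.card; omega)
  obtain ⟨j, hj⟩ := _root_.exists_ne i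
  exact ⟨j, hj.symm⟩

theorem dir_ne (i : V) : 0 < (Γ.pos i).1 0 * (Γ.pos i).1 0 + (Γ.pos i).1 1 * (Γ.pos i).1 1 := by
  by_contra! h0
  obtain ⟨j, hj⟩ := h.exists_ne i
  apply h.dt_ne hj
  have hx : (Γ.pos i).1 0 = 0 := by
    nlinarith [mul_self_nonneg ((Γ.pos i).1 0), mul_self_nonneg ((Γ.pos i).1 1)]
  have hy : (Γ.pos i).1 1 = 0 := by
    nlinarith [mul_self_nonneg ((Γ.pos i).1 0), mul_self_nonneg ((Γ.pos i).1 1)]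
  simp [dt, hx, hy]

omit h in
theorem arc_coeff {i j : V} {x : S2} {a b : ℝ} (hx : x.1 = a • (Γ.pos i).1 + b • (Γ.pos j).1) :
    a * Γ.dt i j = x.1 0 * (Γ.pos j).1 1 - (Γ.pos j).1 0 * x.1 1 ∧
      b * Γ.dt i j = (Γ.pos i).1 0 * x.1 1 - x.1 0 * (Γ.pos i).1 1 := by
  rw [hx]
  simp only [dt, PiLp.add_apply, PiLp.smul_apply, smul_eq_mul]
  constructor <;> ring

theorem axis_notMem_drawing {P : S2} (h0 : P.1 0 = 0) (h1 : P.1 1 = 0) : P ∉ Γ.drawing := by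
  intro hP
  rcases mem_drawing hP with ⟨i, rfl⟩ | ⟨i, j, hij, hP⟩
  · have := h.dir_ne i
    rw [h0, h1] at this
    simp at this
  · obtain ⟨a, b, -, -, e⟩ := hP
    obtain ⟨ha, hb⟩ := arc_coeff e
    rw [h0, h1] at ha hb
    have hne := h.dt_ne hij.ne
    have ha0 : a = 0 := by simpa [hne] using ha
    have hb0 : b = 0 := by simpa [hne] using hb
    have h2 : P.1 2 = 0 := by rw [e, ha0, hb0]; simp
    have := P.sq_sum
    rw [h0, h1, h2] at this
    norm_num at this

/-- Since the horizontal determinant is nonzero, the two coefficients of a point of the arc are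
continuous functions of its horizontal coordinates. -/
theorem isClosed_arc {i j : V} (hij : i ≠ j) : IsClosed (arc (Γ.pos i) (Γ.pos j)) := by
  have hne := h.dt_ne hij
  set A : S2 → ℝ := fun x => (x.1 0 * (Γ.pos j).1 1 - (Γ.pos j).1 0 * x.1 1) / Γ.dt i j with hA
  set B : S2 → ℝ := fun x => ((Γ.pos i).1 0 * x.1 1 - x.1 0 * (Γ.pos i).1 1) / Γ.dt i j with hB
  have hc := continuous_coord
  have hAc : Continuous A := by simp only [hA]; fun_prop
  have hBc : Continuous B := by simp only [hB]; fun_prop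
  have : arc (Γ.pos i) (Γ.pos j) = {x | 0 ≤ A x} ∩ ({x | 0 ≤ B x} ∩
      {x : S2 | x.1 = A x • (Γ.pos i).1 + B x • (Γ.pos j).1}) := by
    ext x
    constructor
    · rintro ⟨a, b, ha, hb, e⟩
      obtain ⟨ha', hb'⟩ := arc_coeff e
      have e1 : A x = a := by simp only [hA]; rw [← ha']; field_simp
      have e2 : B x = b := by simp only [hB]; rw [← hb']; field_simp
      refine ⟨?_, ?_, ?_⟩
      · change 0 ≤ A x; rwa [e1]
      · change 0 ≤ B x; rwa [e2]
      · change x.1 = _; rw [e1, e2]; exact e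
    · rintro ⟨ha, hb, e⟩
      exact ⟨_, _, ha, hb, e⟩
  rw [this]
  refine (isClosed_le continuous_const hAc).inter ((isClosed_le continuous_const hBc).inter
    (isClosed_eq continuous_subtype_val ?_))
  fun_prop

theorem isClosed_drawing : IsClosed Γ.drawing := by
  have := h.finite
  refine (Set.finite_range _).isClosed.union ?_
  exact isClosed_iUnion_of_finite fun i => isClosed_iUnion_of_finite fun j =>
    isClosed_iUnion_of_finite fun hij => h.isClosed_arc hij.ne

theorem isOpen_face {F : Set S2} (hF : F ∈ Γ.faces) : IsOpen F := by
  have : LocallyConnectedSpace S2 :=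
    ChartedSpace.locallyConnectedSpace (EuclideanSpace ℝ (Fin 2)) S2
  obtain ⟨x, hx, rfl⟩ := hF
  exact h.isClosed_drawing.isOpen_compl.connectedComponentIn

/-- Every face is a convex triangle or the exterior of one. -/
theorem face_eq_tri {F : Set S2} (hF : F ∈ Γ.faces) {i j k : V} (hb : Γ.IsBoundedBy F i j k) :
    F = tri (Γ.pos i).1 (Γ.pos j).1 (Γ.pos k).1 ∨
      F = triExt (Γ.pos i).1 (Γ.pos j).1 (Γ.pos k).1 := by
  refine eq_tri_or_triExt (h.det3_ne hb.1.ne hb.2.1.ne hb.2.2.1.ne.symm) (face_connected hF) ?_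
    hb.2.2.2
  rw [Set.disjoint_iff_inter_eq_empty]
  exact (h.isOpen_face hF).inter_frontier_eq

theorem finite_faces : Γ.faces.Finite := by
  have := h.finite
  refine (((Set.finite_range fun t : V × V × V =>
    tri (Γ.pos t.1).1 (Γ.pos t.2.1).1 (Γ.pos t.2.2).1)).union
    (Set.finite_range fun t : V × V × V =>
    triExt (Γ.pos t.1).1 (Γ.pos t.2.1).1 (Γ.pos t.2.2).1)).subset fun F hF => ?_
  obtain ⟨i, j, k, hb⟩ := h.triang F hF
  rcases h.face_eq_tri hF hb with e | e
  · exact Or.inl ⟨(i, j, k), e.symm⟩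
  · exact Or.inr ⟨(i, j, k), e.symm⟩

end IsGood

/-! ### Polar and nonpolar faces -/

variable (Γ) in
/-- `F` contains the north pole (`s = 1`) or the south pole (`s = -1`). -/
def IsPolarFace (F : Set S2) (s : ℝ) : Prop := F ∈ Γ.faces ∧ (s = 1 ∨ s = -1) ∧ Cn F 0 0 s

theorem isPolarFace_one_iff {F : Set S2} : Γ.IsPolarFace F 1 ↔ Γ.IsNorthFace F := by
  simp [IsPolarFace, IsNorthFace, northPole_mem_iff]

theorem isPolarFace_neg_one_iff {F : Set S2} : Γ.IsPolarFace F (-1) ↔ Γ.IsSouthFace F := by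
  simp [IsPolarFace, IsSouthFace, southPole_mem_iff]

theorem IsPolarFace.eq {F F' : Set S2} {s : ℝ} (hF : Γ.IsPolarFace F s)
    (hF' : Γ.IsPolarFace F' s) : F = F' := by
  obtain ⟨p, hp, -⟩ := hF.2.2.inter hF'.2.2
  exact face_eq hF.1 hF'.1 hp.1 hp.2

variable (Γ) in
/-- `F` is the convex triangle with vertices `w`, `m`, `e`, from west to east, and contains no
pole. -/
structure IsNonpolarTri (F : Set S2) (w m e : V) : Prop where
  face : F ∈ Γ.faces
  bdd : Γ.IsBoundedBy F w m e
  wm : 0 < Γ.dt w m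
  me : 0 < Γ.dt m e
  we : 0 < Γ.dt w e
  cn : ∀ x y z, Cn F x y z ↔ ∃ a b c : ℝ, 0 < a ∧ 0 < b ∧ 0 < c ∧
    vec x y z = a • (Γ.pos w).1 + b • (Γ.pos m).1 + c • (Γ.pos e).1

namespace IsGood

variable (h : Γ.IsGood)
include h

theorem exists_polarFace {s : ℝ} (hs : s = 1 ∨ s = -1) : ∃ F, Γ.IsPolarFace F s := by
  rcases hs with rfl | rfl
  · obtain ⟨F, hF, hm⟩ := exists_face (h.axis_notMem_drawing northPole_coords.1
      northPole_coords.2.1)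
    exact ⟨F, isPolarFace_one_iff.2 ⟨hF, hm⟩⟩
  · obtain ⟨F, hF, hm⟩ := exists_face (h.axis_notMem_drawing southPole_coords.1
      southPole_coords.2.1)
    exact ⟨F, isPolarFace_neg_one_iff.2 ⟨hF, hm⟩⟩

theorem not_polar_neg {F : Set S2} {s : ℝ} (hF : Γ.IsPolarFace F s) : ¬ Γ.IsPolarFace F (-s) := by
  intro hF'
  rcases hF.2.1 with rfl | rfl
  · exact h.sep F ⟨isPolarFace_one_iff.1 hF, isPolarFace_neg_one_iff.1 hF'⟩
  · rw [neg_neg] at hF'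
    exact h.sep F ⟨isPolarFace_one_iff.1 hF', isPolarFace_neg_one_iff.1 hF⟩

/-- The barycentric coordinates of a pole in a polar face are all positive, if the face is a convex
triangle, or all negative. -/
theorem polar_cases {F : Set S2} {s : ℝ} (hF : Γ.IsPolarFace F s) {i j k : V}
    (hb : Γ.IsBoundedBy F i j k) :
    let D := det3 (Γ.pos i).1 (Γ.pos j).1 (Γ.pos k).1
    (F = tri (Γ.pos i).1 (Γ.pos j).1 (Γ.pos k).1 ∧ 0 < s * (Γ.dt j k / D) ∧
      0 < s * (Γ.dt k i / D) ∧ 0 < s * (Γ.dt i j / D)) ∨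
    (F = triExt (Γ.pos i).1 (Γ.pos j).1 (Γ.pos k).1 ∧ s * (Γ.dt j k / D) < 0 ∧
      s * (Γ.dt k i / D) < 0 ∧ s * (Γ.dt i j / D) < 0) := by
  intro D
  have hD : D ≠ 0 := h.det3_ne hb.1.ne hb.2.1.ne hb.2.2.1.ne.symm
  have hs0 : s ≠ 0 := by rcases hF.2.1 with rfl | rfl <;> norm_num
  have e1 : ∀ s', bar (Γ.pos i).1 (Γ.pos j).1 (Γ.pos k).1 (vec 0 0 s') = s' * (Γ.dt j k / D) :=
    fun s' => bar_vert _ _ _ _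
  have e2 : ∀ s', bar (Γ.pos j).1 (Γ.pos k).1 (Γ.pos i).1 (vec 0 0 s') = s' * (Γ.dt k i / D) :=
    fun s' => by rw [bar_vert, det3_rot]; rfl
  have e3 : ∀ s', bar (Γ.pos k).1 (Γ.pos i).1 (Γ.pos j).1 (vec 0 0 s') = s' * (Γ.dt i j / D) :=
    fun s' => by rw [bar_vert, det3_rot, det3_rot]; rfl
  rcases h.face_eq_tri hF.1 hb with e | e
  · left
    have := hF.2.2
    rw [e, cn_tri_iff_bar, e1, e2, e3] at this
    exact ⟨e, this⟩
  · right
    -- Here the separation of the poles enters: the opposite pole is not in the exterior `F`, so its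
    -- coordinates are nonnegative and those of the pole are nonpositive. Genericity makes them
    -- nonzero.
    have h1 : ¬ Cn F 0 0 (-s) := fun hc => h.not_polar_neg hF ⟨hF.1, by
      rcases hF.2.1 with rfl | rfl <;> simp, hc⟩
    rw [e, cn_triExt_iff, e1, e2, e3] at h1
    have n1 : s * (Γ.dt j k / D) ≠ 0 := mul_ne_zero hs0 (div_ne_zero (h.dt_ne hb.2.1.ne) hD)
    have n2 : s * (Γ.dt k i / D) ≠ 0 := mul_ne_zero hs0 (div_ne_zero (h.dt_ne hb.2.2.1.ne) hD)
    have n3 : s * (Γ.dt i j / D) ≠ 0 := mul_ne_zero hs0 (div_ne_zero (h.dt_ne hb.1.ne) hD)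
    simp only [not_or, not_lt, neg_mul, Left.nonneg_neg_iff] at h1
    exact ⟨e, lt_of_le_of_ne h1.1 n1, lt_of_le_of_ne h1.2.1 n2, lt_of_le_of_ne h1.2.2 n3⟩

/-- Polar faces are closed under moving towards the pole. -/
theorem polar_up {F : Set S2} {s : ℝ} (hF : Γ.IsPolarFace F s) {x y z t : ℝ} (ht : 0 ≤ t)
    (hc : Cn F x y z) : Cn F x y (z + s * t) := by
  obtain ⟨i, j, k, hb⟩ := h.triang F hF.1
  rcases h.polar_cases hF hb with ⟨e, h1, h2, h3⟩ | ⟨e, h1, h2, h3⟩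
  · rw [e, cn_tri_iff_bar] at hc ⊢
    simp only [vec_add_vert, bar_comb, bar_vert] at *
    obtain ⟨c1, c2, c3⟩ := hc
    refine ⟨?_, ?_, ?_⟩
    · have := mul_nonneg ht h1.le; unfold dt at this; linarith
    · have := mul_nonneg ht h2.le; unfold dt at this; rw [det3_rot]; linarith
    · have := mul_nonneg ht h3.le; unfold dt at this; rw [det3_rot, det3_rot]; linarith
  · rw [e, cn_triExt_iff] at hc ⊢
    simp only [vec_add_vert, bar_comb, bar_vert] at *
    rcases hc with c | c | c
    · left; have := mul_nonneg ht (neg_nonneg.2 h1.le); unfold dt at this; linarith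
    · right; left; have := mul_nonneg ht (neg_nonneg.2 h2.le); unfold dt at this
      rw [det3_rot]; linarith
    · right; right; have := mul_nonneg ht (neg_nonneg.2 h3.le); unfold dt at this
      rw [det3_rot, det3_rot]; linarith

/-- The points between a vertex of a polar face and the pole are in the face. -/
theorem polar_vertex {F : Set S2} {s : ℝ} (hF : Γ.IsPolarFace F s) {v : V}
    (hv : Γ.pos v ∈ frontier F) {t : ℝ} (ht : 0 < t) :
    Cn F ((Γ.pos v).1 0) ((Γ.pos v).1 1) ((Γ.pos v).1 2 + s * t) := by
  obtain ⟨i', j', k', hb'⟩ := h.triang F hF.1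
  obtain ⟨j, k, hb⟩ : ∃ j k, Γ.IsBoundedBy F v j k := by
    rcases vertex_of_frontier hb' hv with rfl | rfl | rfl
    · exact ⟨_, _, hb'⟩
    · exact ⟨_, _, isBoundedBy_rot hb'⟩
    · exact ⟨_, _, isBoundedBy_rot (isBoundedBy_rot hb')⟩
  have ev : vec ((Γ.pos v).1 0) ((Γ.pos v).1 1) ((Γ.pos v).1 2) = (Γ.pos v).1 :=
    ext3 rfl rfl rfl
  have hD := h.det3_ne hb.1.ne hb.2.1.ne hb.2.2.1.ne.symm
  rcases h.polar_cases hF hb with ⟨e, h1, h2, h3⟩ | ⟨e, h1, h2, h3⟩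
  · rw [e, cn_tri_iff_bar]
    simp only [vec_add_vert, bar_comb, bar_vert, ev, bar_self hD, bar_second, bar_third]
    refine ⟨?_, ?_, ?_⟩
    · have := mul_pos ht h1; unfold dt at this; linarith
    · have := mul_pos ht h2; unfold dt at this; rw [det3_rot]; linarith
    · have := mul_pos ht h3; unfold dt at this; rw [det3_rot, det3_rot]; linarith
  · rw [e, cn_triExt_iff]
    simp only [vec_add_vert, bar_comb, bar_vert, ev, bar_self hD, bar_second, bar_third]
    right; left
    have := mul_pos ht (neg_pos.2 h2); unfold dt at this; rw [det3_rot]; linarith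

/-- The coordinates of the pole all have the same sign, so the three horizontal determinants do too.
In a suitable orientation the boundary of a polar face is a directed cycle of `Rt`. -/
theorem polar_cyc {F : Set S2} {s : ℝ} (hF : Γ.IsPolarFace F s) :
    ∃ i j k, Γ.IsBoundedBy F i j k ∧ 0 < Γ.dt i j ∧ 0 < Γ.dt j k ∧ 0 < Γ.dt k i := by
  obtain ⟨i, j, k, hb⟩ := h.triang F hF.1
  have key : ∃ r : ℝ, 0 < r * Γ.dt i j ∧ 0 < r * Γ.dt j k ∧ 0 < r * Γ.dt k i := by
    rcases h.polar_cases hF hb with ⟨e, h1, h2, h3⟩ | ⟨e, h1, h2, h3⟩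
    · refine ⟨s / det3 (Γ.pos i).1 (Γ.pos j).1 (Γ.pos k).1, ?_, ?_, ?_⟩ <;>
        rw [div_mul_eq_mul_div, mul_div_assoc] <;> assumption
    · refine ⟨-s / det3 (Γ.pos i).1 (Γ.pos j).1 (Γ.pos k).1, ?_, ?_, ?_⟩ <;>
        rw [div_mul_eq_mul_div, mul_div_assoc, neg_mul] <;> linarith
  obtain ⟨r, h1, h2, h3⟩ := key
  rcases lt_trichotomy r 0 with hr | hr | hr
  · have e1 := neg_of_mul_pos_right h1 hr.le
    have e2 := neg_of_mul_pos_right h2 hr.le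
    have e3 := neg_of_mul_pos_right h3 hr.le
    refine ⟨j, i, k, isBoundedBy_swap hb, ?_, ?_, ?_⟩ <;> rw [dt_swap] <;> linarith
  · simp [hr] at h1
  · exact ⟨i, j, k, hb, pos_of_mul_pos_right h1 hr.le, pos_of_mul_pos_right h2 hr.le,
      pos_of_mul_pos_right h3 hr.le⟩

theorem isNonpolarTri {F : Set S2} (hF : F ∈ Γ.faces) (hN : ¬ Γ.IsPolarFace F 1)
    (hS : ¬ Γ.IsPolarFace F (-1)) {i j k : V} (hb : Γ.IsBoundedBy F i j k)
    (hij : 0 < Γ.dt i j) (hjk : 0 < Γ.dt j k) (hik : 0 < Γ.dt i k) :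
    Γ.IsNonpolarTri F i j k := by
  have hD := h.det3_ne hb.1.ne hb.2.1.ne hb.2.2.1.ne.symm
  have hN' : ¬ Cn F 0 0 1 := fun h => hN ⟨hF, by simp, h⟩
  have hS' : ¬ Cn F 0 0 (-1) := fun h => hS ⟨hF, by simp, h⟩
  have e : F = tri (Γ.pos i).1 (Γ.pos j).1 (Γ.pos k).1 := by
    -- Opposite poles have opposite coordinates; if both are outside the exterior, these coordinates
    -- are zero, against genericity.
    refine (h.face_eq_tri hF hb).resolve_right fun e => ?_
    rw [e, cn_triExt_iff] at hN' hS'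
    simp only [bar_vert, not_or, not_lt] at hN' hS'
    have : ((Γ.pos j).1 0 * (Γ.pos k).1 1 - (Γ.pos k).1 0 * (Γ.pos j).1 1) /
      det3 (Γ.pos i).1 (Γ.pos j).1 (Γ.pos k).1 ≠ 0 := div_ne_zero hjk.ne' hD
    apply this
    linarith [hN'.1, hS'.1]
  refine ⟨hF, hb, hij, hjk, hik, fun x y z => ?_⟩
  rw [e, cn_tri_iff hD]

/-- Every face without poles is a convex triangle with a western, a middle and an eastern
vertex. -/
theorem exists_isNonpolarTri {F : Set S2} (hF : F ∈ Γ.faces) (hN : ¬ Γ.IsPolarFace F 1)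
    (hS : ¬ Γ.IsPolarFace F (-1)) : ∃ w m e, Γ.IsNonpolarTri F w m e := by
  obtain ⟨i, j, k, hb⟩ := h.triang F hF
  have hD := h.det3_ne hb.1.ne hb.2.1.ne hb.2.2.1.ne.symm
  have hN' : ¬ Cn F 0 0 1 := fun h => hN ⟨hF, by simp, h⟩
  have hS' : ¬ Cn F 0 0 (-1) := fun h => hS ⟨hF, by simp, h⟩
  have d1 : Γ.dt j k / det3 (Γ.pos i).1 (Γ.pos j).1 (Γ.pos k).1 ≠ 0 :=
    div_ne_zero (h.dt_ne hb.2.1.ne) hD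
  have e : F = tri (Γ.pos i).1 (Γ.pos j).1 (Γ.pos k).1 := by
    refine (h.face_eq_tri hF hb).resolve_right fun e => ?_
    rw [e, cn_triExt_iff] at hN' hS'
    simp only [bar_vert, not_or, not_lt] at hN' hS'
    apply d1
    unfold dt
    linarith [hN'.1, hS'.1]
  rw [e, cn_tri_iff_bar] at hN' hS'
  simp only [bar_vert] at hN' hS'
  rw [det3_rot (Γ.pos j).1, det3_rot (Γ.pos i).1] at hN' hS'
  -- If the determinants had the same sign around the cycle, one pole would have positive
  -- coordinates and lie in the triangle. The six remaining sign patterns are the six orders from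
  -- west to east.
  have h1 : ¬ (0 < Γ.dt i j ∧ 0 < Γ.dt j k ∧ 0 < Γ.dt k i) := by
    rintro ⟨p1, p2, p3⟩
    rcases hD.lt_or_gt with hD' | hD'
    · refine hS' ⟨?_, ?_, ?_⟩ <;>
        exact mul_pos_of_neg_of_neg (by norm_num) (div_neg_of_pos_of_neg (by assumption) hD')
    · refine hN' ⟨?_, ?_, ?_⟩ <;>
        exact mul_pos (by norm_num) (div_pos (by assumption) hD')
  have h2 : ¬ (Γ.dt i j < 0 ∧ Γ.dt j k < 0 ∧ Γ.dt k i < 0) := by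
    rintro ⟨p1, p2, p3⟩
    rcases hD.lt_or_gt with hD' | hD'
    · refine hN' ⟨?_, ?_, ?_⟩ <;>
        exact mul_pos (by norm_num) (div_pos_of_neg_of_neg (by assumption) hD')
    · refine hS' ⟨?_, ?_, ?_⟩ <;>
        exact mul_pos_of_neg_of_neg (by norm_num) (div_neg_of_neg_of_pos (by assumption) hD')
  have hb' := isBoundedBy_swap hb
  have s1 := dt_swap (Γ := Γ) i j
  have s2 := dt_swap (Γ := Γ) j k
  have s3 := dt_swap (Γ := Γ) k i
  rcases (h.dt_ne hb.1.ne).lt_or_gt with a | a <;>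
  rcases (h.dt_ne hb.2.1.ne).lt_or_gt with b | b <;>
  rcases (h.dt_ne hb.2.2.1.ne).lt_or_gt with c | c
  · exact (h2 ⟨a, b, c⟩).elim
  · exact ⟨_, _, _, h.isNonpolarTri hF hN hS (isBoundedBy_rot (isBoundedBy_rot hb'))
      (by linarith) (by linarith) (by linarith)⟩
  · exact ⟨_, _, _, h.isNonpolarTri hF hN hS hb' (by linarith) (by linarith) (by linarith)⟩
  · exact ⟨_, _, _, h.isNonpolarTri hF hN hS (isBoundedBy_rot hb) (by linarith) (by linarith)
      (by linarith)⟩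
  · exact ⟨_, _, _, h.isNonpolarTri hF hN hS (isBoundedBy_rot hb') (by linarith) (by linarith)
      (by linarith)⟩
  · exact ⟨_, _, _, h.isNonpolarTri hF hN hS (isBoundedBy_rot (isBoundedBy_rot hb))
      (by linarith) (by linarith) (by linarith)⟩
  · exact ⟨_, _, _, h.isNonpolarTri hF hN hS hb (by linarith) (by linarith) (by linarith)⟩
  · exact (h1 ⟨a, b, c⟩).elim

end IsGood

end ShortestPathEmbedding

/-! ### Due north in coordinates -/

/-- On the right half of the unit circle, the height is a strictly increasing function of the slope
z / r. Latitude can therefore be compared after rescaling to a common horizontal part. -/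
theorem slope_lt {r z r' z' : ℝ} (hr : 0 < r) (hr' : 0 < r') (h : r ^ 2 + z ^ 2 = 1)
    (h' : r' ^ 2 + z' ^ 2 = 1) (hz : z' < z) : z' * r < z * r' := by
  by_contra! hc
  have e : (z * r') ^ 2 - (z' * r) ^ 2 = z ^ 2 - z' ^ 2 := by
    linear_combination z ^ 2 * h' - z' ^ 2 * h
  rcases le_or_gt 0 z' with h0 | h0
  · have h1 : 0 ≤ z * r' := mul_nonneg (by linarith) hr'.le
    nlinarith
  · have h1 : z' * r < 0 := mul_neg_of_neg_of_pos h0 hr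
    have h2 : z < 0 := by
      by_contra! h3
      linarith [mul_nonneg h3 hr'.le]
    nlinarith

theorem lt_of_slope_lt {r z r' z' : ℝ} (hr : 0 < r) (hr' : 0 < r') (h : r ^ 2 + z ^ 2 = 1)
    (h' : r' ^ 2 + z' ^ 2 = 1) (hs : z' * r < z * r') : z' < z := by
  rcases lt_trichotomy z' z with h1 | h1 | h1
  · exact h1
  · subst h1
    have : r = r' := by nlinarith
    subst this
    exact (lt_irrefl _ hs).elim
  · linarith [slope_lt hr' hr h' h h1]

theorem exists_angle {x y : ℝ} (hxy : 0 < x * x + y * y) :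
    ∃ ρ θ : ℝ, 0 < ρ ∧ x = ρ * Real.cos θ ∧ y = ρ * Real.sin θ := by
  refine ⟨‖(⟨x, y⟩ : ℂ)‖, Complex.arg ⟨x, y⟩, ?_, ?_, ?_⟩
  · rw [norm_pos_iff]
    intro h
    have h1 : x = 0 := congrArg Complex.re h
    have h2 : y = 0 := congrArg Complex.im h
    simp [h1, h2] at hxy
  · rw [Complex.norm_mul_cos_arg]
  · rw [Complex.norm_mul_sin_arg]

theorem mem_longitude_of_coords {p : S2} {r ρ θ : ℝ} (hr : 0 < r) (hρ : 0 < ρ)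
    (h0 : p.1 0 = r * (ρ * Real.cos θ)) (h1 : p.1 1 = r * (ρ * Real.sin θ)) :
    p ∈ longitude θ :=
  ⟨r * ρ, mul_pos hr hρ, by rw [h0, mul_assoc], by rw [h1, mul_assoc]⟩

theorem S2.horiz_sq {p : S2} {r θ : ℝ} (h0 : p.1 0 = r * Real.cos θ)
    (h1 : p.1 1 = r * Real.sin θ) : r ^ 2 + p.1 2 ^ 2 = 1 := by
  have := p.sq_sum
  rw [h0, h1] at this
  linear_combination this - r ^ 2 * Real.sin_sq_add_cos_sq θ

theorem dueNorth_of_coords {p q : S2} {r r' x y z z' : ℝ} (hr : 0 < r) (hr' : 0 < r')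
    (hxy : 0 < x * x + y * y) (hz : z' < z) (h0 : p.1 0 = r * x) (h1 : p.1 1 = r * y)
    (h2 : p.1 2 = r * z) (h0' : q.1 0 = r' * x) (h1' : q.1 1 = r' * y) (h2' : q.1 2 = r' * z') :
    DueNorth p q := by
  obtain ⟨ρ, θ, hρ, rfl, rfl⟩ := exists_angle hxy
  refine ⟨⟨θ, mem_longitude_of_coords hr hρ h0 h1,
    mem_longitude_of_coords hr' hρ h0' h1'⟩, ?_⟩
  refine lt_of_slope_lt (r := r * ρ) (r' := r' * ρ) (by positivity) (by positivity)
    (S2.horiz_sq (θ := θ) (by rw [h0]; ring) (by rw [h1]; ring))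
    (S2.horiz_sq (θ := θ) (by rw [h0']; ring) (by rw [h1']; ring)) ?_
  rw [h2, h2']
  have := mul_lt_mul_of_pos_left hz (show 0 < r * r' * ρ by positivity)
  linarith

theorem DueNorth.coords {p q : S2} (h : DueNorth p q) :
    ∃ r r' x y z z' : ℝ, 0 < r ∧ 0 < r' ∧ 0 < x * x + y * y ∧ z' < z ∧ p.1 0 = r * x ∧
      p.1 1 = r * y ∧ p.1 2 = r * z ∧ q.1 0 = r' * x ∧ q.1 1 = r' * y ∧ q.1 2 = r' * z' := by
  obtain ⟨⟨θ, ⟨r, hr, h0, h1⟩, ⟨r', hr', h0', h1'⟩⟩, hz⟩ := h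
  refine ⟨r, r', Real.cos θ, Real.sin θ, p.1 2 / r, q.1 2 / r', hr, hr', ?_, ?_, h0, h1, ?_, h0',
    h1', ?_⟩
  · nlinarith [Real.sin_sq_add_cos_sq θ]
  · rw [div_lt_div_iff₀ hr' hr]
    exact slope_lt hr hr' (S2.horiz_sq h0 h1) (S2.horiz_sq h0' h1') hz
  · field_simp
  · field_simp

/-- Some point of `A` is due north of some point of `B`, in terms of cones. -/
theorem exists_dueNorth_iff {A B : Set S2} : (∃ p ∈ A, ∃ q ∈ B, DueNorth p q) ↔
    ∃ x y z z' : ℝ, 0 < x * x + y * y ∧ Cn A x y z ∧ Cn B x y z' ∧ z' < z := by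
  constructor
  · rintro ⟨p, hp, q, hq, h⟩
    obtain ⟨r, r', x, y, z, z', hr, hr', hxy, hz, h0, h1, h2, h0', h1', h2'⟩ := h.coords
    exact ⟨x, y, z, z', hxy, ⟨p, hp, r, hr, h0, h1, h2⟩, ⟨q, hq, r', hr', h0', h1', h2'⟩, hz⟩
  · rintro ⟨x, y, z, z', hxy, ⟨p, hp, r, hr, h0, h1, h2⟩, ⟨q, hq, r', hr', h0', h1', h2'⟩, hz⟩
    exact ⟨p, hp, q, hq, dueNorth_of_coords hr hr' hxy hz h0 h1 h2 h0' h1' h2'⟩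

/-- The cone is the preimage of `A` under radial projection, which is continuous on the open set of
nonzero vectors. -/
theorem isOpen_cn {A : Set S2} (hA : IsOpen A) :
    IsOpen {v : EuclideanSpace ℝ (Fin 3) | Cn A (v 0) (v 1) (v 2)} := by
  have e : {v : EuclideanSpace ℝ (Fin 3) | Cn A (v 0) (v 1) (v 2)} =
      Subtype.val '' {v : {v : EuclideanSpace ℝ (Fin 3) // v ≠ 0} | nrm v.1 v.2 ∈ A} := by
    ext v
    have hv : vec (v 0) (v 1) (v 2) = v := ext3 rfl rfl rfl
    constructor
    · intro hc
      have h0 := Cn.ne_zero hc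
      refine ⟨⟨v, hv ▸ h0⟩, ?_, rfl⟩
      have := (cn_iff_nrm h0).1 hc
      change nrm v _ ∈ A
      convert this using 2
      exact hv.symm
    · rintro ⟨⟨w, hw⟩, hm, rfl⟩
      have hv' : vec (w 0) (w 1) (w 2) = w := ext3 rfl rfl rfl
      change Cn A (w 0) (w 1) (w 2)
      rw [cn_iff_nrm (by rwa [hv'])]
      simp only [hv']
      exact hm
  rw [e]
  refine isOpen_ne.isOpenMap_subtype_val _ (hA.preimage ?_)
  exact continuousAt_nrm continuous_subtype_val fun v => v.2

theorem eventually_cn {A : Set S2} (hA : IsOpen A) {f g k : ℝ → ℝ} (hf : Continuous f)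
    (hg : Continuous g) (hk : Continuous k) (h : Cn A (f 0) (g 0) (k 0)) :
    ∀ᶠ t in 𝓝 (0 : ℝ), Cn A (f t) (g t) (k t) :=
  (continuous_vec hf hg hk).continuousAt.eventually ((isOpen_cn hA).mem_nhds h)

theorem pos_sq_of_ne {x y : ℝ} (h : 0 < x * x + y * y) (z : ℝ) : vec x y z ≠ 0 :=
  vec_ne_zero fun h0 => by
    rw [Prod.mk.injEq] at h0
    simp [h0] at h

/-- The limit of a vertical segment in the cone over `A` is in the closure of `A`. -/
theorem mem_closure_of_vert {A : Set S2} {x y z s ε : ℝ} (hxy : 0 < x * x + y * y) (hε : 0 < ε)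
    (h : ∀ t, 0 < t → t < ε → Cn A x y (z + s * t)) : Cn (closure A) x y z := by
  rw [cn_iff_nrm (pos_sq_of_ne hxy z)]
  have hc : Continuous fun t : ℝ => nrm (vec x y (z + s * t)) (pos_sq_of_ne hxy _) :=
    continuousAt_nrm (continuous_vec continuous_const continuous_const (by fun_prop)) _
  have ht : Filter.Tendsto (fun t : ℝ => nrm (vec x y (z + s * t)) (pos_sq_of_ne hxy _)) (𝓝[>] 0)
      (𝓝 (nrm (vec x y z) (pos_sq_of_ne hxy z))) := by
    have := (hc.tendsto 0).mono_left (nhdsWithin_le_nhds (s := Set.Ioi 0))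
    simpa using this
  refine mem_closure_of_tendsto ht ?_
  filter_upwards [Ioo_mem_nhdsGT hε] with t ht
  rw [← cn_iff_nrm]
  exact h t ht.1 ht.2

/-! ### Vertical lines, triangles without poles, and down-faces -/

namespace ShortestPathEmbedding

variable {V : Type*} {G : SimpleGraph V} {Γ : ShortestPathEmbedding G}

theorem not_cn_drawing {F : Set S2} (hF : F ∈ Γ.faces) {x y z : ℝ} (hc : Cn F x y z) :
    ¬ Cn Γ.drawing x y z := fun hd => by
  obtain ⟨p, hp, -⟩ := hc.inter hd
  exact face_subset hF hp.1 hp.2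

theorem cn_drawing_pos (v : V) :
    Cn Γ.drawing ((Γ.pos v).1 0) ((Γ.pos v).1 1) ((Γ.pos v).1 2) :=
  cn_of_mem (pos_mem_drawing v)

theorem face_eq_of_cn {F F' : Set S2} (hF : F ∈ Γ.faces) (hF' : F' ∈ Γ.faces) {x y z : ℝ}
    (hc : Cn F x y z) (hc' : Cn F' x y z) : F = F' := by
  obtain ⟨p, hp, -⟩ := hc.inter hc'
  exact face_eq hF hF' hp.1 hp.2

theorem cn_drawing_of_comb {i j : V} (hij : G.Adj i j) {s t : ℝ} (hs : 0 ≤ s) (ht : 0 ≤ t)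
    {F : Set S2} (hF : F ∈ Γ.faces) :
    ¬ Cn F (s * (Γ.pos i).1 0 + t * (Γ.pos j).1 0) (s * (Γ.pos i).1 1 + t * (Γ.pos j).1 1)
      (s * (Γ.pos i).1 2 + t * (Γ.pos j).1 2) := by
  rintro ⟨p, hp, r, hr, h0, h1, h2⟩
  refine face_subset hF hp (arc_subset_drawing hij ⟨r * s, r * t, by positivity, by positivity,
    ext3 ?_ ?_ ?_⟩) <;> simp only [h0, h1, h2, PiLp.add_apply, PiLp.smul_apply, smul_eq_mul] <;>
    ring

theorem exists_face_cn {x y z : ℝ} (hv : vec x y z ≠ 0) (hd : ¬ Cn Γ.drawing x y z) :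
    ∃ F ∈ Γ.faces, Cn F x y z := by
  rw [cn_iff_nrm hv] at hd
  obtain ⟨F, hF, hm⟩ := exists_face hd
  exact ⟨F, hF, (cn_iff_nrm hv).2 hm⟩

/-- A vertical segment that avoids the drawing stays in one face. -/
theorem cn_of_segment {F : Set S2} (hF : F ∈ Γ.faces) {x y : ℝ} (hxy : 0 < x * x + y * y)
    {I : Set ℝ} (hI : IsPreconnected I) (hd : ∀ t ∈ I, ¬ Cn Γ.drawing x y t) {t₀ : ℝ}
    (ht₀ : t₀ ∈ I) (hc : Cn F x y t₀) {t : ℝ} (ht : t ∈ I) : Cn F x y t := by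
  have hcont : Continuous fun t : ℝ => nrm (vec x y t) (pos_sq_of_ne hxy _) :=
    continuousAt_nrm (continuous_vec continuous_const continuous_const continuous_id) _
  rw [cn_iff_nrm (pos_sq_of_ne hxy _)] at hc ⊢
  refine subset_face hF (hI.image _ hcont.continuousOn) ?_ ⟨t₀, ht₀, rfl⟩ hc ⟨t, ht, rfl⟩
  rintro _ ⟨t, ht, rfl⟩ h
  exact hd t ht ((cn_iff_nrm (pos_sq_of_ne hxy _)).2 h)

/-- The combination of `w` and `e` with these coefficients is the point of the cone over the base
that lies vertically over or under `dt w e` times `m`. -/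
theorem dt_base_x (w m e : V) : Γ.dt m e * (Γ.pos w).1 0 + Γ.dt w m * (Γ.pos e).1 0 =
    Γ.dt w e * (Γ.pos m).1 0 := by unfold dt; ring

theorem dt_base_y (w m e : V) : Γ.dt m e * (Γ.pos w).1 1 + Γ.dt w m * (Γ.pos e).1 1 =
    Γ.dt w e * (Γ.pos m).1 1 := by unfold dt; ring

namespace IsNonpolarTri

variable {F : Set S2} {w m e : V} (hT : Γ.IsNonpolarTri F w m e)
include hT

theorem expand {x y z : ℝ} (hc : Cn F x y z) : ∃ a b c : ℝ, 0 < a ∧ 0 < b ∧ 0 < c ∧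
    x = a * (Γ.pos w).1 0 + b * (Γ.pos m).1 0 + c * (Γ.pos e).1 0 ∧
    y = a * (Γ.pos w).1 1 + b * (Γ.pos m).1 1 + c * (Γ.pos e).1 1 ∧
    z = a * (Γ.pos w).1 2 + b * (Γ.pos m).1 2 + c * (Γ.pos e).1 2 := by
  obtain ⟨a, b, c, ha, hb, hc, e⟩ := (hT.cn _ _ _).1 hc
  exact ⟨a, b, c, ha, hb, hc, congrArg (· 0) e, congrArg (· 1) e, congrArg (· 2) e⟩

theorem cn_of_comb {a b c : ℝ} (ha : 0 < a) (hb : 0 < b) (hc : 0 < c) :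
    Cn F (a * (Γ.pos w).1 0 + b * (Γ.pos m).1 0 + c * (Γ.pos e).1 0)
      (a * (Γ.pos w).1 1 + b * (Γ.pos m).1 1 + c * (Γ.pos e).1 1)
      (a * (Γ.pos w).1 2 + b * (Γ.pos m).1 2 + c * (Γ.pos e).1 2) :=
  (hT.cn _ _ _).2 ⟨a, b, c, ha, hb, hc, ext3 rfl rfl rfl⟩

theorem cn_add {x y z x' y' z' : ℝ} (h : Cn F x y z) (h' : Cn F x' y' z') :
    Cn F (x + x') (y + y') (z + z') := by
  obtain ⟨a, b, c, ha, hb, hc, rfl, rfl, rfl⟩ := hT.expand h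
  obtain ⟨a', b', c', ha', hb', hc', rfl, rfl, rfl⟩ := hT.expand h'
  convert hT.cn_of_comb (add_pos ha ha') (add_pos hb hb') (add_pos hc hc') using 1 <;> ring

theorem not_cn_west {z : ℝ} : ¬ Cn F ((Γ.pos w).1 0) ((Γ.pos w).1 1) z := fun hz => by
  obtain ⟨a, b, c, ha, hb, hc, h0, h1, -⟩ := hT.expand hz
  have : b * Γ.dt w m + c * Γ.dt w e = 0 := by
    unfold dt
    linear_combination (Γ.pos w).1 1 * h0 - (Γ.pos w).1 0 * h1
  linarith [mul_pos hb hT.wm, mul_pos hc hT.we]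

theorem not_cn_east {z : ℝ} : ¬ Cn F ((Γ.pos e).1 0) ((Γ.pos e).1 1) z := fun hz => by
  obtain ⟨a, b, c, ha, hb, hc, h0, h1, -⟩ := hT.expand hz
  have : a * Γ.dt w e + b * Γ.dt m e = 0 := by
    unfold dt
    linear_combination -(Γ.pos e).1 1 * h0 + (Γ.pos e).1 0 * h1
  linarith [mul_pos ha hT.we, mul_pos hb hT.me]

/-- A triangle with points due north of its middle vertex has this vertex below its base. -/
theorem base_above_of_cn {t : ℝ} (ht : 0 < t)
    (hc : Cn F ((Γ.pos m).1 0) ((Γ.pos m).1 1) ((Γ.pos m).1 2 + t)) :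
    Γ.dt w e * (Γ.pos m).1 2 < Γ.dt m e * (Γ.pos w).1 2 + Γ.dt w m * (Γ.pos e).1 2 := by
  obtain ⟨a, b, c, ha, hb, hc, h0, h1, h2⟩ := hT.expand hc
  have e1 : a * Γ.dt w e = (1 - b) * Γ.dt m e := by
    unfold dt
    linear_combination -(Γ.pos e).1 1 * h0 + (Γ.pos e).1 0 * h1
  have e2 : c * Γ.dt w e = (1 - b) * Γ.dt w m := by
    unfold dt
    linear_combination (Γ.pos w).1 1 * h0 - (Γ.pos w).1 0 * h1
  have h3 : 0 < 1 - b := pos_of_mul_pos_left (by rw [← e1]; exact mul_pos ha hT.we) hT.me.le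
  have e3 : (1 - b) * (Γ.dt m e * (Γ.pos w).1 2 + Γ.dt w m * (Γ.pos e).1 2 -
      Γ.dt w e * (Γ.pos m).1 2) = Γ.dt w e * t := by
    linear_combination Γ.dt w e * h2 * (-1) - (Γ.pos w).1 2 * e1 - (Γ.pos e).1 2 * e2
  have h4 := pos_of_mul_pos_right (e3 ▸ mul_pos hT.we ht) h3.le
  linarith

/-- The vector from `dt w e` times `m` to the base point over it is vertical of length `B`. Adding t
/ B times it to `m` raises `m` by `t`, and the coefficient of `m` stays positive until t = B / dt w
e. -/
theorem cn_above_middle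
    (h : Γ.dt w e * (Γ.pos m).1 2 < Γ.dt m e * (Γ.pos w).1 2 + Γ.dt w m * (Γ.pos e).1 2) :
    ∃ ε : ℝ, 0 < ε ∧ ∀ t, 0 < t → t < ε →
      Cn F ((Γ.pos m).1 0) ((Γ.pos m).1 1) ((Γ.pos m).1 2 + t) := by
  set B := Γ.dt m e * (Γ.pos w).1 2 + Γ.dt w m * (Γ.pos e).1 2 - Γ.dt w e * (Γ.pos m).1 2 with hB
  have hB0 : 0 < B := by linarith
  have hwe := hT.we
  refine ⟨B / Γ.dt w e, by positivity, fun t ht hlt => ?_⟩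
  have h1 : t / B * Γ.dt w e < 1 := by
    rw [lt_div_iff₀ hwe] at hlt
    rw [div_mul_eq_mul_div, div_lt_one hB0]
    exact hlt
  have := hT.cn_of_comb (a := t / B * Γ.dt m e) (b := 1 - t / B * Γ.dt w e)
    (c := t / B * Γ.dt w m) (mul_pos (by positivity) hT.me) (by linarith)
    (mul_pos (by positivity) hT.wm)
  convert this using 1
  · linear_combination -(t / B) * dt_base_x (Γ := Γ) w m e
  · linear_combination -(t / B) * dt_base_y (Γ := Γ) w m e
  · have : t / B * B = t := by field_simp
    rw [hB] at this
    linear_combination -this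

end IsNonpolarTri

namespace IsGood

variable (h : Γ.IsGood)
include h

/-- The plane of an edge is not vertical, as its horizontal determinant is nonzero, so a vertical
line off the axis meets the cone over each arc at most once. -/
theorem finite_drawing {x y : ℝ} (hxy : 0 < x * x + y * y) :
    {z | Cn Γ.drawing x y z}.Finite := by
  have := h.finite
  have hsub : {z | Cn Γ.drawing x y z} ⊆ (⋃ i : V, {z | Cn {Γ.pos i} x y z}) ∪
      ⋃ (i : V) (j : V) (_ : G.Adj i j), {z | Cn (arc (Γ.pos i) (Γ.pos j)) x y z} := by
    rintro z ⟨p, hp, hz⟩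
    rcases mem_drawing hp with ⟨i, rfl⟩ | ⟨i, j, hij, hm⟩
    · exact Or.inl (Set.mem_iUnion.2 ⟨i, _, rfl, hz⟩)
    · refine Or.inr ?_
      simp only [Set.mem_iUnion]
      exact ⟨i, j, hij, p, hm, hz⟩
  refine Set.Finite.subset (Set.Finite.union (Set.finite_iUnion fun i => ?_)
    (Set.finite_iUnion fun i => Set.finite_iUnion fun j => Set.finite_iUnion fun hij => ?_)) hsub
  · refine Set.Subsingleton.finite ?_
    rintro z ⟨_, rfl, r, hr, h0, h1, h2⟩ z' ⟨_, rfl, r', hr', h0', h1', h2'⟩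
    have e0 : (r - r') * x = 0 := by linarith
    have e1 : (r - r') * y = 0 := by linarith
    have : r = r' := by
      by_contra hne
      have hne' : r - r' ≠ 0 := sub_ne_zero.2 hne
      simp only [mul_eq_zero, hne', false_or] at e0 e1
      simp [e0, e1] at hxy
    subst this
    exact mul_left_cancel₀ hr.ne' (h2.symm.trans h2')
  · refine Set.Subsingleton.finite ?_
    have key : ∀ z, Cn (arc (Γ.pos i) (Γ.pos j)) x y z →
        z * Γ.dt i j = (x * (Γ.pos j).1 1 - (Γ.pos j).1 0 * y) * (Γ.pos i).1 2 +
          ((Γ.pos i).1 0 * y - x * (Γ.pos i).1 1) * (Γ.pos j).1 2 := by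
      rintro z ⟨p, ⟨a, b, -, -, e⟩, r, hr, h0, h1, h2⟩
      obtain ⟨ha, hb⟩ := arc_coeff e
      have e2 : p.1 2 = a * (Γ.pos i).1 2 + b * (Γ.pos j).1 2 := by
        rw [e]; simp
      apply mul_left_cancel₀ hr.ne'
      rw [h0, h1] at ha hb
      rw [h2] at e2
      linear_combination Γ.dt i j * e2 + (Γ.pos i).1 2 * ha + (Γ.pos j).1 2 * hb
    intro z hz z' hz'
    exact mul_right_cancel₀ (h.dt_ne hij.ne) ((key z hz).trans (key z' hz').symm)

theorem isolated {x y : ℝ} (hxy : 0 < x * x + y * y) (z : ℝ) :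
    ∃ ε : ℝ, 0 < ε ∧ ∀ t, t ≠ z → |t - z| < ε → ¬ Cn Γ.drawing x y t := by
  have hfin := (h.finite_drawing hxy).subset (Set.sdiff_subset (t := {z}))
  have := hfin.isClosed.isOpen_compl.mem_nhds (x := z) (fun hz => hz.2 rfl)
  obtain ⟨ε, hε, hb⟩ := Metric.mem_nhds_iff.1 this
  refine ⟨ε, hε, fun t htz ht hc => ?_⟩
  exact hb (show t ∈ Metric.ball z ε by rwa [Metric.mem_ball, Real.dist_eq]) ⟨hc, htz⟩

/-- Just above and just below any point there is a face. -/
theorem exists_vert_face {x y : ℝ} (hxy : 0 < x * x + y * y) (z : ℝ) {s : ℝ}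
    (hs : s = 1 ∨ s = -1) : ∃ F ∈ Γ.faces, ∃ ε : ℝ, 0 < ε ∧
      ∀ t, 0 < t → t < ε → Cn F x y (z + s * t) := by
  obtain ⟨ε, hε, hiso⟩ := h.isolated hxy z
  have hd : ∀ t, 0 < t → t < ε → ¬ Cn Γ.drawing x y (z + s * t) := fun t ht hte => by
    refine hiso _ ?_ ?_
    · rcases hs with rfl | rfl
      · linarith
      · linarith
    · rcases hs with rfl | rfl <;> simp [abs_of_pos ht, hte]
  obtain ⟨F, hF, hc⟩ := exists_face_cn (pos_sq_of_ne hxy _) (hd (ε / 2) (by linarith)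
    (by linarith))
  refine ⟨F, hF, ε, hε, fun t ht hte => ?_⟩
  refine cn_of_segment hF hxy (I := (fun t => z + s * t) '' Set.Ioo 0 ε)
    (isPreconnected_Ioo.image _ (by fun_prop)) ?_ ⟨ε / 2, ⟨by linarith, by linarith⟩, rfl⟩ hc
    ⟨t, ⟨ht, hte⟩, rfl⟩
  rintro _ ⟨t, ht, rfl⟩
  exact hd t ht.1 ht.2

theorem mem_frontier_of_vert {F : Set S2} (hF : F ∈ Γ.faces) {x y z s ε : ℝ}
    (hxy : 0 < x * x + y * y) (hd : Cn Γ.drawing x y z) (hε : 0 < ε)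
    (hc : ∀ t, 0 < t → t < ε → Cn F x y (z + s * t)) : Cn (frontier F) x y z := by
  rw [(h.isOpen_face hF).frontier_eq]
  obtain ⟨p, hp, r⟩ := (mem_closure_of_vert hxy hε hc).inter hd
  exact ⟨p, ⟨hp.1, fun hpF => face_subset hF hpF hp.2⟩, r⟩

/-- Every vertex off the north face is the apex of a down-face. -/
theorem exists_down_tri {v : V} (hv : ∀ F, Γ.IsNorthFace F → Γ.pos v ∉ frontier F) :
    ∃ F w e, Γ.IsNonpolarTri F w v e ∧ ∃ t : ℝ, 0 < t ∧
      Cn F ((Γ.pos v).1 0) ((Γ.pos v).1 1) ((Γ.pos v).1 2 + t) := by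
  obtain ⟨F, hF, ε, hε, hc⟩ := h.exists_vert_face (h.dir_ne v) ((Γ.pos v).1 2) (Or.inl rfl)
  have hfr : Γ.pos v ∈ frontier F :=
    cn_mem_iff.1 (h.mem_frontier_of_vert hF (h.dir_ne v) (cn_drawing_pos v) hε hc)
  have hN : ¬ Γ.IsPolarFace F 1 := fun hN => hv F (isPolarFace_one_iff.1 hN) hfr
  have hc' := hc (ε / 2) (by linarith) (by linarith)
  rw [one_mul] at hc'
  -- The south face is closed under going down, so from a point above `v` it would reach `v` itself,
  -- which is in the drawing.
  have hS : ¬ Γ.IsPolarFace F (-1) := fun hS => by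
    have := h.polar_up hS (t := ε / 2) (by linarith) hc'
    refine not_cn_drawing hF this ?_
    convert cn_drawing_pos v using 1
    ring
  obtain ⟨w, m, e, hT⟩ := h.exists_isNonpolarTri hF hN hS
  rcases vertex_of_frontier hT.bdd hfr with rfl | rfl | rfl
  · exact (hT.not_cn_west hc').elim
  · exact ⟨F, w, e, hT, _, by linarith, hc'⟩
  · exact (hT.not_cn_east hc').elim

theorem isDownFace_of_tri {F : Set S2} {w v e : V} (hT : Γ.IsNonpolarTri F w v e) {t : ℝ}
    (ht : 0 < t) (hc : Cn F ((Γ.pos v).1 0) ((Γ.pos v).1 1) ((Γ.pos v).1 2 + t)) :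
    Γ.IsDownFace F v w e ∧ Γ.IsDownFace F v e w := by
  have hN : ¬ Γ.IsNorthFace F := fun hN => by
    obtain ⟨a, b, c, ha, hb, hc, h0, h1, -⟩ := hT.expand (northPole_mem_iff.1 hN.2)
    have : b * Γ.dt w v + c * Γ.dt w e = 0 := by
      unfold dt
      linear_combination (Γ.pos w).1 1 * h0 - (Γ.pos w).1 0 * h1
    linarith [mul_pos hb hT.wm, mul_pos hc hT.we]
  have hS : ¬ Γ.IsSouthFace F := fun hS => by
    obtain ⟨a, b, c, ha, hb, hc, h0, h1, -⟩ := hT.expand (southPole_mem_iff.1 hS.2)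
    have : b * Γ.dt w v + c * Γ.dt w e = 0 := by
      unfold dt
      linear_combination (Γ.pos w).1 1 * h0 - (Γ.pos w).1 0 * h1
    linarith [mul_pos hb hT.wm, mul_pos hc hT.we]
  have hwe := hT.we
  have hv := h.dir_ne v
  have hv' : 0 < (Γ.dt w e * (Γ.pos v).1 0) * (Γ.dt w e * (Γ.pos v).1 0) +
      (Γ.dt w e * (Γ.pos v).1 1) * (Γ.dt w e * (Γ.pos v).1 1) := by
    have := mul_pos (mul_pos hwe hwe) hv
    linarith
  -- The point of the cone over the base that lies above `dt w e` times the apex; it is then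
  -- projected to the sphere.
  set b := vec (Γ.dt w e * (Γ.pos v).1 0) (Γ.dt w e * (Γ.pos v).1 1)
    (Γ.dt v e * (Γ.pos w).1 2 + Γ.dt w v * (Γ.pos e).1 2) with hb
  have hb0 : b ≠ 0 := pos_sq_of_ne hv' _
  have hpos : 0 < ‖b‖⁻¹ := inv_pos.2 (norm_pos_iff.2 hb0)
  have hmem : nrm b hb0 ∈ arc (Γ.pos w) (Γ.pos e) := by
    refine ⟨‖b‖⁻¹ * Γ.dt v e, ‖b‖⁻¹ * Γ.dt w v, mul_nonneg hpos.le hT.me.le,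
      mul_nonneg hpos.le hT.wm.le, ?_⟩
    apply ext3
    · simp only [nrm, hb, PiLp.add_apply, PiLp.smul_apply, smul_eq_mul, vec_zero]
      linear_combination -‖b‖⁻¹ * dt_base_x (Γ := Γ) w v e
    · simp only [nrm, hb, PiLp.add_apply, PiLp.smul_apply, smul_eq_mul, vec_one]
      linear_combination -‖b‖⁻¹ * dt_base_y (Γ := Γ) w v e
    · simp only [nrm, hb, PiLp.add_apply, PiLp.smul_apply, smul_eq_mul, vec_two]
      ring
  have hdn : DueNorth (nrm b hb0) (Γ.pos v) := by
    refine dueNorth_of_coords (r := ‖b‖⁻¹) (r' := (Γ.dt w e)⁻¹) hpos (inv_pos.2 hwe) hv'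
      (hT.base_above_of_cn ht hc) rfl rfl rfl ?_ ?_ ?_ <;> field_simp
  have hbd : Γ.IsBoundedBy F v w e := isBoundedBy_swap hT.bdd
  refine ⟨⟨hT.face, hN, hS, hbd, _, hmem, hdn⟩, hT.face, hN, hS, ?_, _, arc_symm _ _ ▸ hmem, hdn⟩
  exact isBoundedBy_rot hT.bdd

/-- Down-faces in terms of their western and eastern vertices. -/
theorem tri_of_isDownFace {F : Set S2} {v u u' : V} (hD : Γ.IsDownFace F v u u') :
    ∃ w e, Γ.IsNonpolarTri F w v e ∧ (u = w ∨ u = e) ∧ ∃ ε : ℝ, 0 < ε ∧ ∀ t, 0 < t → t < ε →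
      Cn F ((Γ.pos v).1 0) ((Γ.pos v).1 1) ((Γ.pos v).1 2 + t) := by
  obtain ⟨hF, hN, hS, hb, x, ⟨a, b, ha, hb', hx⟩, hdn⟩ := hD
  obtain ⟨w, m, e, hT⟩ := h.exists_isNonpolarTri hF (isPolarFace_one_iff.not.2 hN)
    (isPolarFace_neg_one_iff.not.2 hS)
  obtain ⟨r, r', px, py, z, z', hr, hr', hxy, hz, h0, h1, h2, h0', h1', h2'⟩ := hdn.coords
  have hvu := hb.1.ne
  have hvu' := hb.2.2.1.ne.symm
  have huu' := hb.2.1.ne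
  have mv := vertex_of_frontier hT.bdd (mem_frontier_of_isBoundedBy hb)
  have mu := vertex_of_frontier hT.bdd (mem_frontier_of_isBoundedBy (isBoundedBy_rot hb))
  have mu' := vertex_of_frontier hT.bdd
    (mem_frontier_of_isBoundedBy (isBoundedBy_rot (isBoundedBy_rot hb)))
  have x0 : x.1 0 = a * (Γ.pos u).1 0 + b * (Γ.pos u').1 0 := by rw [hx]; simp
  have x1 : x.1 1 = a * (Γ.pos u).1 1 + b * (Γ.pos u').1 1 := by rw [hx]; simp
  have x2 : x.1 2 = a * (Γ.pos u).1 2 + b * (Γ.pos u').1 2 := by rw [hx]; simp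
  -- The point `x` of the base has the horizontal direction of `v`. As `a` and `b` are nonnegative
  -- and not both zero, the determinants of `v` with the two base vertices cannot have the same
  -- sign, so `v` is neither the western nor the eastern vertex.
  have hpar : a * Γ.dt v u + b * Γ.dt v u' = 0 := by
    have : (Γ.pos v).1 0 * x.1 1 - x.1 0 * (Γ.pos v).1 1 = 0 := by
      rw [h0, h1, h0', h1']; ring
    rw [x0, x1] at this
    unfold dt
    linear_combination this
  have hab : 0 < a + b := by
    rcases (add_nonneg ha hb').eq_or_lt with h3 | h3
    · exfalso
      have ha0 : a = 0 := by linarith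
      have hb0 : b = 0 := by linarith
      have := x.sq_sum
      rw [x0, x1, x2, ha0, hb0] at this
      norm_num at this
    · exact h3
  have hpos : ∀ p q : ℝ, 0 < p → 0 < q → a * p + b * q ≠ 0 := fun p q hp hq h3 => by
    have h4 := mul_nonneg ha hp.le
    have h5 := mul_nonneg hb' hq.le
    have h6 : a = 0 := by simpa [hp.ne'] using (show a * p = 0 by linarith)
    have h7 : b = 0 := by simpa [hq.ne'] using (show b * q = 0 by linarith)
    linarith
  have hww := hT.wm
  have hwe := hT.we
  have hme := hT.me
  have s1 := dt_swap (Γ := Γ) w e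
  have s2 := dt_swap (Γ := Γ) m e
  have s3 := dt_swap (Γ := Γ) w m
  have key : ∀ a b : ℝ, 0 ≤ a → 0 ≤ b → 0 < a + b →
      x.1 0 = a * (Γ.pos w).1 0 + b * (Γ.pos e).1 0 →
      x.1 1 = a * (Γ.pos w).1 1 + b * (Γ.pos e).1 1 →
      x.1 2 = a * (Γ.pos w).1 2 + b * (Γ.pos e).1 2 →
      v = m → Γ.dt w e * (Γ.pos m).1 2 < Γ.dt m e * (Γ.pos w).1 2 + Γ.dt w m * (Γ.pos e).1 2 := by
    rintro a b ha hb hab x0 x1 x2 rfl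
    have e1 : a * Γ.dt w e * r' = r * Γ.dt v e := by
      unfold dt
      have : x.1 0 * (Γ.pos e).1 1 - (Γ.pos e).1 0 * x.1 1 = a * Γ.dt w e := by
        rw [x0, x1]; unfold dt; ring
      unfold dt at this
      rw [← this, h0, h1, h0', h1']; ring
    have e2 : b * Γ.dt w e * r' = r * Γ.dt w v := by
      unfold dt
      have : (Γ.pos w).1 0 * x.1 1 - x.1 0 * (Γ.pos w).1 1 = b * Γ.dt w e := by
        rw [x0, x1]; unfold dt; ring
      unfold dt at this
      rw [← this, h0, h1, h0', h1']; ring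
    have e3 : r * (Γ.dt v e * (Γ.pos w).1 2 + Γ.dt w v * (Γ.pos e).1 2 -
        Γ.dt w e * (Γ.pos v).1 2) = Γ.dt w e * (r * r') * (z - z') := by
      have : a * (Γ.pos w).1 2 + b * (Γ.pos e).1 2 = r * z := by rw [← x2, h2]
      rw [h2']
      linear_combination -(Γ.pos w).1 2 * e1 - (Γ.pos e).1 2 * e2 + Γ.dt w e * r' * this
    have h4 := pos_of_mul_pos_right (e3 ▸ mul_pos (mul_pos hwe (mul_pos hr hr')) (sub_pos.2 hz))
      hr.le
    linarith
  rcases mv with rfl | rfl | rfl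
  · exfalso
    rcases mu with rfl | rfl | rfl
    · exact hvu rfl
    · rcases mu' with rfl | rfl | rfl
      · exact hvu' rfl
      · exact huu' rfl
      · exact hpos _ _ hww hwe hpar
    · rcases mu' with rfl | rfl | rfl
      · exact hvu' rfl
      · exact hpos _ _ hwe hww hpar
      · exact huu' rfl
  · rcases mu with rfl | rfl | rfl
    · rcases mu' with rfl | rfl | rfl
      · exact (huu' rfl).elim
      · exact (hvu' rfl).elim
      · exact ⟨u, u', hT, Or.inl rfl, hT.cn_above_middle (key a b ha hb' hab x0 x1 x2 rfl)⟩
    · exact (hvu rfl).elim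
    · rcases mu' with rfl | rfl | rfl
      · exact ⟨u', u, hT, Or.inr rfl, hT.cn_above_middle (key b a hb' ha (by linarith)
          (by linarith) (by linarith) (by linarith) rfl)⟩
      · exact (hvu' rfl).elim
      · exact (huu' rfl).elim
  · exfalso
    rcases mu with rfl | rfl | rfl
    · rcases mu' with rfl | rfl | rfl
      · exact huu' rfl
      · exact hpos (-Γ.dt v u) (-Γ.dt v u') (by linarith) (by linarith) (by linarith)
      · exact hvu' rfl
    · rcases mu' with rfl | rfl | rfl
      · exact hpos (-Γ.dt v u) (-Γ.dt v u') (by linarith) (by linarith) (by linarith)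
      · exact huu' rfl
      · exact hvu' rfl
    · exact hvu rfl

end IsGood

end ShortestPathEmbedding

/-! ### The vertical order of the faces -/

theorem isCycle_transGen {α : Type*} {R : α → α → Prop} {c : ℕ → α}
    (h : ∀ k, R (c k) (c (k + 1))) (n : ℕ) : Relation.TransGen R (c 0) (c (n + 1)) := by
  induction n with
  | zero => exact .single (h 0)
  | succ n ih => exact ih.tail (h _)

namespace ShortestPathEmbedding

variable {V : Type*} {G : SimpleGraph V} {Γ : ShortestPathEmbedding G}

variable (Γ) in
/-- Two different faces such that some point of the first is due north of some point of the
second. -/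
def Ab (F F' : Γ.faces) : Prop := F ≠ F' ∧ ∃ p ∈ F.1, ∃ q ∈ F'.1, DueNorth p q

theorem ab_iff {F F' : Γ.faces} : Γ.Ab F F' ↔ F ≠ F' ∧
    ∃ x y z z' : ℝ, 0 < x * x + y * y ∧ Cn F.1 x y z ∧ Cn F'.1 x y z' ∧ z' < z := by
  rw [Ab, exists_dueNorth_iff]

theorem ab_of_dn {F F' : Γ.faces} (h : Γ.Dn.Adj F F') : Γ.Ab F F' :=
  ⟨fun e => h.1.1 (congrArg Subtype.val e), h.2⟩

variable (Γ) in
/-- The faces without poles. -/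
def NonpolarFace : Type _ :=
  {F : Γ.faces // ¬ Γ.IsPolarFace F.1 1 ∧ ¬ Γ.IsPolarFace F.1 (-1)}

variable (Γ) in
/-- The cone over a face without poles. -/
def faceCone (F : Γ.NonpolarFace) (x y z : ℝ) : Prop := Cn F.1.1 x y z

namespace IsGood

variable (h : Γ.IsGood)
include h

/-- Convexity holds because nonpolar faces are convex triangles. A cone meeting the axis would
contain a pole. -/
theorem coneFamily : ConeFamily Γ.faceCone where
  add := fun {a} _ _ _ _ _ _ h1 h2 => by
    obtain ⟨w, m, e, hT⟩ := h.exists_isNonpolarTri a.1.2 a.2.1 a.2.2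
    exact hT.cn_add h1 h2
  smul := fun hr hc => hc.smul hr
  disj := fun {a b} _ _ _ h1 h2 =>
    Subtype.ext (Subtype.ext (face_eq_of_cn a.1.2 b.1.2 h1 h2))
  axis := fun {a z} hc => by
    have hz : z ≠ 0 := fun hz => hc.ne_zero (by subst hz; exact ext3 rfl rfl rfl)
    rcases hz.lt_or_gt with hz | hz
    · have := Cn.smul (inv_pos.2 (neg_pos.2 hz)) hc
      refine a.2.2 ⟨a.1.2, Or.inr rfl, ?_⟩
      rwa [mul_zero, show (-z)⁻¹ * z = -1 by field_simp] at this
    · have := Cn.smul (inv_pos.2 hz) hc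
      refine a.2.1 ⟨a.1.2, Or.inl rfl, ?_⟩
      rwa [mul_zero, inv_mul_cancel₀ hz.ne'] at this

/-- The north face is closed under going up, so it would contain the higher point as well. -/
theorem not_ab_north {F F' : Γ.faces} (hF : Γ.Ab F F') : ¬ Γ.IsPolarFace F'.1 1 := fun hN => by
  obtain ⟨hne, x, y, z, z', hxy, h1, h2, h3⟩ := ab_iff.1 hF
  have := h.polar_up hN (t := z - z') (by linarith) h2
  rw [one_mul, add_sub_cancel] at this
  exact hne (Subtype.ext (face_eq_of_cn F.2 F'.2 h1 this))

theorem not_ab_south {F F' : Γ.faces} (hF : Γ.Ab F F') : ¬ Γ.IsPolarFace F.1 (-1) := fun hN => by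
  obtain ⟨hne, x, y, z, z', hxy, h1, h2, h3⟩ := ab_iff.1 hF
  have := h.polar_up hN (t := z - z') (by linarith) h1
  rw [neg_one_mul, neg_sub, add_sub_cancel] at this
  exact hne (Subtype.ext (face_eq_of_cn F.2 F'.2 this h2))

/-- A cycle in the vertical order of the faces gives a winding cycle. -/
theorem exists_winding {R : Γ.faces → Γ.faces → Prop} (hR : ∀ F F', R F F' → Γ.Ab F F')
    {F : Γ.faces} (hF : Relation.TransGen R F F) :
    ∃ n c σ dx dy, Winding Γ.faceCone n c σ dx dy := by
  obtain ⟨n, w, hn, h0, h1, h2⟩ := exists_walk_of_transGen hF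
  obtain ⟨c, hc, -⟩ := exists_isCycle_of_walk hn w h2 (h1.trans h0.symm)
  -- Every face of the cycle has one above it and one below it, so it is not polar. The predecessor
  -- of `c k` is `c (k + (n - 1))`.
  have hnp : ∀ k, ¬ Γ.IsPolarFace (c k).1 1 ∧ ¬ Γ.IsPolarFace (c k).1 (-1) := fun k => by
    refine ⟨?_, h.not_ab_south (hR _ _ (hc.step k))⟩
    have := h.not_ab_north (hR _ _ (hc.step (k + (n - 1))))
    rwa [show k + (n - 1) + 1 = k + n by have := hc.pos; omega, hc.per] at this
  set c' : ℕ → Γ.NonpolarFace := fun k => ⟨c k, hnp k⟩ with hc'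
  have hstep : ∀ k, AboveRel Γ.faceCone (c' k) (c' (k + 1)) := fun k => by
    obtain ⟨hne, x, y, z, z', -, h1, h2, h3⟩ := ab_iff.1 (hR _ _ (hc.step k))
    exact ⟨fun e => hne (congrArg Subtype.val e), x, y, z, z', h1, h2, h3⟩
  have := isCycle_transGen hstep (n - 1)
  have e : c' (n - 1 + 1) = c' 0 := Subtype.ext (by
    simp only [hc', show n - 1 + 1 = 0 + n by have := hc.pos; omega]
    exact hc.per 0)
  rw [e] at this
  exact h.coneFamily.exists_winding this

/-- Paths between the polar faces in both directions exclude cycles in the vertical order. -/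
theorem not_transGen_of_hasFacePath {N S : Set S2} (hN : Γ.IsNorthFace N) (hS : Γ.IsSouthFace S)
    (hNS : Γ.HasFacePath N S) (hSN : Γ.HasFacePath S N)
    {R : Γ.faces → Γ.faces → Prop} (hR : ∀ F F', R F F' → Γ.Ab F F') (F : Γ.faces) :
    ¬ Relation.TransGen R F F := by
  intro hF
  obtain ⟨n, c, σ, dx, dy, W⟩ := h.exists_winding hR hF
  rw [← isPolarFace_one_iff] at hN
  rw [← isPolarFace_neg_one_iff] at hS
  -- The cycle covers the direction of `v`, and a cone above `v` would meet the north face, which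
  -- contains everything vertically above its vertices.
  have hstart : ∀ v, Γ.pos v ∈ frontier N →
      ∃ k, Under Γ.faceCone (c k) ((Γ.pos v).1 0) ((Γ.pos v).1 1) ((Γ.pos v).1 2) := by
    intro v hv
    obtain ⟨k, z, hz⟩ := W.cover h.coneFamily (h.dir_ne v)
    refine ⟨k, z, ?_, hz⟩
    by_contra! hle
    rcases hle.eq_or_lt with rfl | hlt
    · exact not_cn_drawing (c k).1.2 hz (cn_drawing_pos v)
    · have := h.polar_vertex hN hv (sub_pos.2 hlt)
      rw [one_mul, add_sub_cancel] at this
      exact (c k).2.1 (face_eq_of_cn hN.1 (c k).1.2 this hz ▸ hN)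
  -- The south face contains everything vertically below its vertices.
  have hend : ∀ v, Γ.pos v ∈ frontier S →
      ¬ ∃ k, Under Γ.faceCone (c k) ((Γ.pos v).1 0) ((Γ.pos v).1 1) ((Γ.pos v).1 2) := by
    rintro v hv ⟨k, z, hlt, hz⟩
    have := h.polar_vertex hS hv (sub_pos.2 hlt)
    rw [neg_one_mul, neg_sub, add_sub_cancel] at this
    exact (c k).2.2 (face_eq_of_cn hS.1 (c k).1.2 this hz ▸ hS)
  have hσ : σ ≠ 0 := by
    rintro rfl
    simpa using W.turn 0
  -- A cycle turning west is followed along the path from south to north, traversed backwards; a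
  -- cycle turning east along the path from north to south.
  rcases hσ.lt_or_gt with hσ | hσ
  · obtain ⟨i, j, hi, hj, hp⟩ := hSN
    refine hend i hi ?_
    clear hi
    induction hp using Relation.ReflTransGen.head_induction_on with
    | refl => exact hstart j hj
    | @head a b hab _ ih =>
      rw [rt_adj_iff] at hab
      refine W.exists_under h.coneFamily ?_
        (fun F s t hs ht => cn_drawing_of_comb hab.1.symm hs ht F.1.2) ih
      have := hab.2
      rw [← neg_neg (Γ.dt a b), ← dt_swap] at this
      exact mul_pos_of_neg_of_neg hσ (neg_pos.1 this)
  · obtain ⟨i, j, hi, hj, hp⟩ := hNS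
    refine hend j hj ?_
    clear hj
    induction hp with
    | refl => exact hstart i hi
    | tail _ hab ih =>
      rw [rt_adj_iff] at hab
      exact W.exists_under h.coneFamily (mul_pos hσ hab.2)
        (fun F s t hs ht => cn_drawing_of_comb hab.1 hs ht F.1.2) ih

/-! ### The legs of down-faces -/

/-- Assign to a vertex the face just above it, which for an apex is its down-face. For a leg from
`v` to `v'`, the down-face at `v'` has `v` as a corner, and its points close to `v` are below points
of the open face just above `v`. So edges of `DnVee` become relations in `Ab`, and cycles become
cycles. -/
theorem not_transGen_dnVee (hab : ∀ F, ¬ Relation.TransGen Γ.Ab F F) : Acyclic Γ.DnVee := by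
  have step : ∀ {v v' : V} {F : Γ.faces} {ε : ℝ}, 0 < ε →
      (∀ t, 0 < t → t < ε → Cn F.1 ((Γ.pos v).1 0) ((Γ.pos v).1 1) ((Γ.pos v).1 2 + t)) →
      Γ.DnVee.Adj v v' → ∃ F' : Γ.faces, Γ.Ab F F' ∧ ∃ ε : ℝ, 0 < ε ∧ ∀ t, 0 < t → t < ε →
        Cn F'.1 ((Γ.pos v').1 0) ((Γ.pos v').1 1) ((Γ.pos v').1 2 + t) := by
    rintro v v' F ε hε hc ⟨F', u, hD⟩
    obtain ⟨w, e, hT, hv, hup⟩ := h.tri_of_isDownFace hD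
    refine ⟨⟨F', hT.face⟩, ?_, hup⟩
    have hc1 := hc (ε / 2) (by linarith) (by linarith)
    have hne : F ≠ ⟨F', hT.face⟩ := by
      rintro rfl
      rcases hv with rfl | rfl
      · exact hT.not_cn_west hc1
      · exact hT.not_cn_east hc1
    -- Points v + η(v' + u') of the open triangle that tend to its corner `v` as η tends to 0.
    obtain ⟨u', hu'⟩ : ∃ u', ∀ η : ℝ, 0 < η → Cn F'
        ((Γ.pos v).1 0 + η * ((Γ.pos v').1 0 + (Γ.pos u').1 0))
        ((Γ.pos v).1 1 + η * ((Γ.pos v').1 1 + (Γ.pos u').1 1))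
        ((Γ.pos v).1 2 + η * ((Γ.pos v').1 2 + (Γ.pos u').1 2)) := by
      rcases hv with rfl | rfl
      · refine ⟨e, fun η hη => ?_⟩
        convert hT.cn_of_comb one_pos hη hη using 1 <;> ring
      · refine ⟨w, fun η hη => ?_⟩
        convert hT.cn_of_comb hη hη one_pos using 1 <;> ring
    have ev1 := eventually_cn (h.isOpen_face F.2)
      (f := fun η => (Γ.pos v).1 0 + η * ((Γ.pos v').1 0 + (Γ.pos u').1 0))
      (g := fun η => (Γ.pos v).1 1 + η * ((Γ.pos v').1 1 + (Γ.pos u').1 1))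
      (k := fun _ => (Γ.pos v).1 2 + ε / 2) (by fun_prop) (by fun_prop) (by fun_prop)
      (by simpa using hc1)
    have ev2 : ∀ᶠ η in 𝓝 (0 : ℝ), η * ((Γ.pos v').1 2 + (Γ.pos u').1 2) < ε / 2 := by
      refine ContinuousAt.eventually_lt (by fun_prop) continuousAt_const ?_
      simpa using hε
    have ev3 : ∀ᶠ η in 𝓝 (0 : ℝ), 0 <
        ((Γ.pos v).1 0 + η * ((Γ.pos v').1 0 + (Γ.pos u').1 0)) *
        ((Γ.pos v).1 0 + η * ((Γ.pos v').1 0 + (Γ.pos u').1 0)) +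
        ((Γ.pos v).1 1 + η * ((Γ.pos v').1 1 + (Γ.pos u').1 1)) *
        ((Γ.pos v).1 1 + η * ((Γ.pos v').1 1 + (Γ.pos u').1 1)) := by
      refine ContinuousAt.eventually_lt continuousAt_const (by fun_prop) ?_
      simpa using h.dir_ne v
    obtain ⟨η, ⟨h1, h2, h3⟩, h4⟩ := (((ev1.and (ev2.and ev3)).filter_mono
      nhdsWithin_le_nhds).and (self_mem_nhdsWithin (s := Set.Ioi (0 : ℝ)))).exists
    exact ab_iff.2 ⟨hne, _, _, _, _, h3, h1, hu' η h4, by linarith⟩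
  intro a ha
  obtain ⟨b, -, F', u', hD⟩ := Relation.TransGen.tail'_iff.1 ha
  obtain ⟨w, e, hT, -, ε, hε, hc⟩ := h.tri_of_isDownFace hD
  have key : ∀ {v : V}, Relation.TransGen Γ.DnVee.Adj a v → ∃ F : Γ.faces,
      Relation.TransGen Γ.Ab ⟨F', hT.face⟩ F ∧ ∃ ε : ℝ, 0 < ε ∧ ∀ t, 0 < t → t < ε →
        Cn F.1 ((Γ.pos v).1 0) ((Γ.pos v).1 1) ((Γ.pos v).1 2 + t) := by
    intro v hv
    induction hv with
    | single hv =>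
      obtain ⟨F, hF, hF'⟩ := step (F := ⟨F', hT.face⟩) hε hc hv
      exact ⟨F, .single hF, hF'⟩
    | tail _ hv ih =>
      obtain ⟨F, hF, ε, hε, hc⟩ := ih
      obtain ⟨F2, hF2, hF2'⟩ := step hε hc hv
      exact ⟨F2, hF.tail hF2, hF2'⟩
  obtain ⟨F, hF, ε', hε', hc'⟩ := key ha
  -- Both faces contain the point at a small height `t` above `a`, so they coincide and the chain
  -- closes up.
  obtain ⟨t, ht, ht'⟩ := exists_between (lt_min hε hε')
  have : F = ⟨F', hT.face⟩ := Subtype.ext (face_eq_of_cn F.2 hT.face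
    (hc' t ht (ht'.trans_le (min_le_right _ _))) (hc t ht (ht'.trans_le (min_le_left _ _))))
  subst this
  exact hab _ hF

/-- Acyclicity on a finite set permits induction along `DnVee`. A vertex off the north face is the
apex of a down-face; it is entered from the western base vertex and left toward the eastern one, and
both precede it. The base of the induction is the directed boundary cycle of the north face. -/
theorem stronglyConnected_of_dnVee (hv : Acyclic Γ.DnVee) : StronglyConnected Γ.Rt := by
  have := h.finite
  obtain ⟨N, hN⟩ := h.exists_polarFace (s := 1) (Or.inl rfl)
  obtain ⟨i, j, k, hb, hij, hjk, hki⟩ := h.polar_cyc hN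
  have rij : Γ.Rt.Adj i j := rt_adj_iff.2 ⟨hb.1, hij⟩
  have rjk : Γ.Rt.Adj j k := rt_adj_iff.2 ⟨hb.2.1, hjk⟩
  have rki : Γ.Rt.Adj k i := rt_adj_iff.2 ⟨hb.2.2.1, hki⟩
  have hi : ∀ v, Γ.pos v ∈ frontier N → HasPath Γ.Rt i v ∧ HasPath Γ.Rt v i := fun v hv => by
    rcases vertex_of_frontier hb hv with rfl | rfl | rfl
    · exact ⟨.refl, .refl⟩
    · exact ⟨.single rij, .head rjk (.single rki)⟩
    · exact ⟨.head rij (.single rjk), .single rki⟩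
  have hwf : WellFounded (Relation.TransGen Γ.DnVee.Adj) := by
    have : Std.Irrefl (Relation.TransGen Γ.DnVee.Adj) := ⟨hv⟩
    have : IsTrans V (Relation.TransGen Γ.DnVee.Adj) := ⟨fun _ _ _ => Relation.TransGen.trans⟩
    exact Finite.wellFounded_of_trans_of_irrefl _
  have key : ∀ v, HasPath Γ.Rt i v ∧ HasPath Γ.Rt v i := fun v => by
    induction v using hwf.induction with
    | _ v ih =>
      by_cases hvN : ∀ F, Γ.IsNorthFace F → Γ.pos v ∉ frontier F
      · obtain ⟨F, w, e, hT, t, ht, hc⟩ := h.exists_down_tri hvN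
        obtain ⟨d1, d2⟩ := h.isDownFace_of_tri hT ht hc
        have h1 := (ih w (.single ⟨F, e, d1⟩)).1
        have h2 := (ih e (.single ⟨F, w, d2⟩)).2
        exact ⟨h1.tail (rt_adj_iff.2 ⟨hT.bdd.1, hT.wm⟩),
          h2.head (rt_adj_iff.2 ⟨hT.bdd.2.1, hT.me⟩)⟩
      · push Not at hvN
        obtain ⟨F, hF, hvF⟩ := hvN
        rw [← isPolarFace_one_iff] at hF
        rw [hF.eq hN] at hvF
        exact hi v hvF
  exact fun a b => (key a).2.trans (key b).1

theorem exists_hasFacePath (hc : StronglyConnected Γ.Rt) :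
    ∃ N S : Set S2, Γ.IsNorthFace N ∧ Γ.IsSouthFace S ∧
      Γ.HasFacePath N S ∧ Γ.HasFacePath S N := by
  obtain ⟨N, hN⟩ := h.exists_polarFace (s := 1) (Or.inl rfl)
  obtain ⟨S, hS⟩ := h.exists_polarFace (s := -1) (Or.inr rfl)
  obtain ⟨i, _, _, hi⟩ := h.triang N hN.1
  obtain ⟨j, _, _, hj⟩ := h.triang S hS.1
  exact ⟨N, S, isPolarFace_one_iff.1 hN, isPolarFace_neg_one_iff.1 hS,
    ⟨i, j, mem_frontier_of_isBoundedBy hi, mem_frontier_of_isBoundedBy hj, hc i j⟩,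
    ⟨j, i, mem_frontier_of_isBoundedBy hj, mem_frontier_of_isBoundedBy hi, hc j i⟩⟩

/-! ### The vertical order is generated by the directed dual graph -/

/-- A common frontier point lies on an edge of each face. Distinct edges meet only at vertices, so
off the vertices the edges coincide. -/
theorem shareEdge_of_frontier {F F' : Set S2} (hF : F ∈ Γ.faces) (hF' : F' ∈ Γ.faces)
    (hne : F ≠ F') {p : S2} (hp : p ∈ frontier F) (hp' : p ∈ frontier F') (hpv : ∀ v, p ≠ Γ.pos v) :
    Γ.ShareEdge F F' := by
  have key : ∀ {F}, F ∈ Γ.faces → p ∈ frontier F → ∃ i j, G.Adj i j ∧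
      p ∈ arc (Γ.pos i) (Γ.pos j) ∧ arc (Γ.pos i) (Γ.pos j) ⊆ frontier F := by
    intro F hF hp
    obtain ⟨i, j, k, h1, h2, h3, h4⟩ := h.triang F hF
    rw [h4] at hp ⊢
    rcases hp with (hp | hp) | hp
    · exact ⟨i, j, h1, hp, fun x hx => Or.inl (Or.inl hx)⟩
    · exact ⟨j, k, h2, hp, fun x hx => Or.inl (Or.inr hx)⟩
    · exact ⟨k, i, h3, hp, fun x hx => Or.inr hx⟩
  obtain ⟨i, j, hij, hm, hs⟩ := key hF hp
  obtain ⟨k, l, hkl, hm', hs'⟩ := key hF' hp'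
  have e : s(i, j) = s(k, l) := by
    by_contra he
    obtain ⟨v, -, -, hv⟩ := Γ.arc_inter_arc i j k l hij hkl he p hm hm'
    exact hpv v hv
  refine ⟨hne, i, j, hij, Set.subset_inter hs ?_⟩
  rcases Sym2.eq_iff.1 e with ⟨rfl, rfl⟩ | ⟨rfl, rfl⟩
  · exact hs'
  · rwa [arc_symm]

theorem dn_of_crossing {F F' : Γ.faces} {x y z ε : ℝ} (hxy : 0 < x * x + y * y)
    (hgen : ∀ v, x * (Γ.pos v).1 1 - (Γ.pos v).1 0 * y ≠ 0) (hd : Cn Γ.drawing x y z)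
    (hε : 0 < ε) (hF : ∀ t, 0 < t → t < ε → Cn F.1 x y (z + t))
    (hF' : ∀ t, 0 < t → t < ε → Cn F'.1 x y (z - t)) : Γ.Dn.Adj F F' := by
  have c1 := hF (ε / 2) (by linarith) (by linarith)
  have c2 := hF' (ε / 2) (by linarith) (by linarith)
  -- Were the two faces equal, the crossing point would belong to the face: by `polar_up` from one
  -- side if it is polar, by convexity otherwise.
  have hne : F.1 ≠ F'.1 := by
    intro e
    rw [← e] at c2
    refine not_cn_drawing F.2 ?_ hd
    by_cases hN : Γ.IsPolarFace F.1 1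
    · have := h.polar_up hN (t := ε / 2) (by linarith) c2
      simpa using this
    by_cases hS : Γ.IsPolarFace F.1 (-1)
    · have := h.polar_up hS (t := ε / 2) (by linarith) c1
      simpa using this
    exact h.coneFamily.mid (a := ⟨F, hN, hS⟩) c2 c1 (by linarith) (by linarith)
  have f1 : Cn (frontier F.1) x y z := h.mem_frontier_of_vert F.2 (s := 1) hxy hd hε
    (by simpa using hF)
  have f2 : Cn (frontier F'.1) x y z := h.mem_frontier_of_vert F'.2 (s := -1) hxy hd hε
    (by simpa [sub_eq_add_neg] using hF')
  obtain ⟨p, hp, r, hr, h0, h1, -⟩ := f1.inter f2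
  refine ⟨h.shareEdge_of_frontier F.2 F'.2 hne hp.1 hp.2 ?_,
    exists_dueNorth_iff.2 ⟨x, y, _, _, hxy, c1, c2, by linarith⟩⟩
  rintro v rfl
  apply hgen v
  rw [h0, h1]
  ring

/-- Go down a vertical line that avoids all vertices. Each crossing of the drawing is a step of
`Dn`, and the number of crossings left decreases. -/
theorem reflTransGen_dn_of_generic {x y : ℝ} (hxy : 0 < x * x + y * y)
    (hgen : ∀ v, x * (Γ.pos v).1 1 - (Γ.pos v).1 0 * y ≠ 0) (F' : Γ.faces) {z' : ℝ}
    (hc' : Cn F'.1 x y z') (n : ℕ) : ∀ (F : Γ.faces) (z : ℝ), Cn F.1 x y z → z' < z →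
      ({t | Cn Γ.drawing x y t} ∩ Set.Ioo z' z).ncard = n → Relation.ReflTransGen Γ.Dn.Adj F F' := by
  induction n using Nat.strong_induction_on with
  | _ n ih =>
    intro F z hc hlt hcard
    set B := {t | Cn Γ.drawing x y t} ∩ Set.Ioo z' z with hB
    have hfin : B.Finite := (h.finite_drawing hxy).subset Set.inter_subset_left
    rcases B.eq_empty_or_nonempty with hBe | hBn
    · have : F = F' := by
        refine Subtype.ext (face_eq_of_cn F.2 F'.2 ?_ hc')
        refine cn_of_segment F.2 hxy (isPreconnected_Icc (a := z') (b := z)) ?_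
          (Set.right_mem_Icc.2 hlt.le) hc (Set.left_mem_Icc.2 hlt.le)
        intro t ht hd
        rcases ht.1.eq_or_lt with rfl | h1
        · exact not_cn_drawing F'.2 hc' hd
        rcases ht.2.eq_or_lt with rfl | h2
        · exact not_cn_drawing F.2 hc hd
        · exact (hBe ▸ (⟨hd, h1, h2⟩ : t ∈ B) : t ∈ (∅ : Set ℝ))
      rw [this]
    · obtain ⟨b, ⟨hbd, hb1, hb2⟩, hbmax⟩ := hfin.exists_maximalFor id _ hBn
      have habove : ∀ t, b < t → t ≤ z → Cn F.1 x y t := fun t ht htz => by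
        refine cn_of_segment F.2 hxy (isPreconnected_Ioc (a := b) (b := z)) ?_
          ⟨hb2, le_rfl⟩ hc ⟨ht, htz⟩
        intro t' ht' hd
        rcases ht'.2.eq_or_lt with rfl | h2
        · exact not_cn_drawing F.2 hc hd
        · exact absurd (hbmax ⟨hd, hb1.trans ht'.1, h2⟩ ht'.1.le) (not_le.2 ht'.1)
      obtain ⟨H, hH, ε, hε, hHc⟩ := h.exists_vert_face hxy b (s := -1) (Or.inr rfl)
      set δ := min ε (min (z - b) (b - z')) with hδ
      have hδ0 : 0 < δ := lt_min hε (lt_min (by linarith) (by linarith))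
      have hδ1 : δ ≤ ε := min_le_left _ _
      have hδ2 : δ ≤ z - b := (min_le_right _ _).trans (min_le_left _ _)
      have hδ3 : δ ≤ b - z' := (min_le_right _ _).trans (min_le_right _ _)
      have hHc' : ∀ t, 0 < t → t < ε → Cn H x y (b - t) := fun t h1 h2 => by
        simpa [sub_eq_add_neg] using hHc t h1 h2
      have hadj : Γ.Dn.Adj F ⟨H, hH⟩ := h.dn_of_crossing hxy hgen hbd hδ0
        (fun t h1 h2 => habove _ (by linarith) (by linarith))
        (fun t h1 h2 => hHc' t h1 (h2.trans_le hδ1))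
      refine .head hadj (ih _ ?_ ⟨H, hH⟩ (b - δ / 2) (hHc' _ (by linarith) (by linarith))
        (by linarith) rfl)
      rw [← hcard]
      refine Set.ncard_lt_ncard ⟨?_, ?_⟩ hfin
      · rintro t ⟨h1, h2, h3⟩
        exact ⟨h1, h2, by linarith⟩
      · intro hsub
        have := (hsub ⟨hbd, hb1, hb2⟩).2.2
        linarith

/-- Since faces are open, the common direction can be rotated slightly without leaving them. All
sufficiently small nonzero rotations avoid the finitely many vertex directions. -/
theorem transGen_dn_of_ab {F F' : Γ.faces} (hab : Γ.Ab F F') :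
    Relation.TransGen Γ.Dn.Adj F F' := by
  have := h.finite
  obtain ⟨hne, x, y, z, z', hxy, h1, h2, hz⟩ := ab_iff.1 hab
  have e1 := eventually_cn (h.isOpen_face F.2) (f := fun η => x - η * y) (g := fun η => y + η * x)
    (k := fun _ => z) (by fun_prop) (by fun_prop) (by fun_prop) (by simpa using h1)
  have e2 := eventually_cn (h.isOpen_face F'.2) (f := fun η => x - η * y)
    (g := fun η => y + η * x) (k := fun _ => z') (by fun_prop) (by fun_prop) (by fun_prop)
    (by simpa using h2)
  have e3 : ∀ᶠ η in 𝓝[≠] (0 : ℝ), ∀ v : V,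
      (x - η * y) * (Γ.pos v).1 1 - (Γ.pos v).1 0 * (y + η * x) ≠ 0 := by
    rw [Filter.eventually_all]
    intro v
    by_cases h0 : x * (Γ.pos v).1 1 - (Γ.pos v).1 0 * y = 0
    · filter_upwards [self_mem_nhdsWithin] with η hη hbad
      have hη' : η ≠ 0 := hη
      have h3 : η * (y * (Γ.pos v).1 1 + x * (Γ.pos v).1 0) = 0 := by linear_combination h0 - hbad
      have h4 : y * (Γ.pos v).1 1 + x * (Γ.pos v).1 0 = 0 := by simpa [hη'] using h3
      have h5 : (x * x + y * y) * (Γ.pos v).1 1 = 0 := by linear_combination x * h0 + y * h4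
      have h6 : (x * x + y * y) * (Γ.pos v).1 0 = 0 := by linear_combination x * h4 - y * h0
      have h7 : (Γ.pos v).1 1 = 0 := by simpa [hxy.ne'] using h5
      have h8 : (Γ.pos v).1 0 = 0 := by simpa [hxy.ne'] using h6
      have := h.dir_ne v
      simp [h7, h8] at this
    · refine nhdsWithin_le_nhds ?_
      refine ContinuousAt.eventually_ne (by fun_prop) ?_
      simpa using h0
  obtain ⟨η, ⟨c1, c2⟩, c3⟩ := (((e1.and e2).filter_mono nhdsWithin_le_nhds).and e3).exists
  have hxy' : 0 < (x - η * y) * (x - η * y) + (y + η * x) * (y + η * x) := by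
    have : (x - η * y) * (x - η * y) + (y + η * x) * (y + η * x) =
      (1 + η ^ 2) * (x * x + y * y) := by ring
    rw [this]
    positivity
  exact (Relation.reflTransGen_iff_eq_or_transGen.1
    (h.reflTransGen_dn_of_generic hxy' c3 F' c2 _ F z c1 hz rfl)).resolve_left hne.symm

theorem not_transGen_ab (hac : Acyclic Γ.Dn) (F : Γ.faces) : ¬ Relation.TransGen Γ.Ab F F := by
  intro hF
  refine hac F ?_
  have : ∀ {F'}, Relation.TransGen Γ.Ab F F' → Relation.TransGen Γ.Dn.Adj F F' := by
    intro F' hF'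
    induction hF' with
    | single h' => exact h.transGen_dn_of_ab h'
    | tail _ h' ih => exact ih.trans (h.transGen_dn_of_ab h')
  exact this hF

end IsGood

end ShortestPathEmbedding

/-! ### Disks and longitudes -/

/-- Points of a fibre of `Circle.exp` differ by multiples of 2π, while an interval with two points
contains two at distance at most 1. -/
theorem subsingleton_of_circleExp {A : Set ℝ} (hA : IsPreconnected A) {c : Circle}
    (h : ∀ t ∈ A, Circle.exp t = c) : A.Subsingleton := by
  have key : ∀ t₁ ∈ A, ∀ t₂ ∈ A, ¬ t₁ < t₂ := by
    intro t₁ h₁ t₂ h₂ hlt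
    have hm : min t₂ (t₁ + 1) ∈ A := hA.ordConnected.out h₁ h₂
      ⟨le_min hlt.le (by linarith), min_le_left _ _⟩
    obtain ⟨m, hm⟩ := Circle.exp_eq_exp.1 ((h _ hm).trans (h _ h₁).symm)
    have h3 : t₁ < min t₂ (t₁ + 1) := lt_min hlt (by linarith)
    have h4 : min t₂ (t₁ + 1) ≤ t₁ + 1 := min_le_right _ _
    have hpi := Real.pi_gt_three
    rcases lt_or_ge m 1 with hm1 | hm1
    · have : (m : ℝ) ≤ 0 := by exact_mod_cast Int.lt_add_one_iff.1 hm1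
      nlinarith
    · have : (1 : ℝ) ≤ m := by exact_mod_cast hm1
      nlinarith
  intro t₁ h₁ t₂ h₂
  rcases lt_trichotomy t₁ t₂ with h | h | h
  · exact (key _ h₁ _ h₂ h).elim
  · exact h
  · exact (key _ h₂ _ h₁ h).elim

/-- The difference s(exp t) - t takes values in 2πℤ, so it is constant; yet its values at 0 and 2π
differ by 2π. -/
theorem not_continuous_section {s : Circle → ℝ} (hs : Continuous s)
    (h : ∀ c, Circle.exp (s c) = c) : False := by
  have hk : Continuous fun t : ℝ => s (Circle.exp t) - t :=
    (hs.comp Circle.exp.continuous).sub continuous_id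
  have hsub := subsingleton_of_circleExp (c := 1) (isPreconnected_range hk) (by
    rintro _ ⟨t, rfl⟩
    simp only [Circle.exp_sub, h, div_self'])
  have := hsub ⟨0, rfl⟩ ⟨2 * Real.pi, rfl⟩
  simp only [Circle.exp_two_pi, Circle.exp_zero] at this
  linarith [Real.pi_pos]

/-- The closed unit disk of the plane. -/
abbrev unitDisk : Set (EuclideanSpace ℝ (Fin 2)) := Metric.closedBall 0 1

/-- A continuous map from the unit disk to the circle lifts to the line. -/
theorem exists_circle_lift (f : C(unitDisk, Circle)) :
    ∃ g : unitDisk → ℝ, Continuous g ∧ ∀ x, Circle.exp (g x) = f x := by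
  have hsc : ∀ p : unitInterval × unitDisk,
      (p.1 : ℝ) • (p.2 : EuclideanSpace ℝ (Fin 2)) ∈ unitDisk := by
    rintro ⟨t, x, hx⟩
    simp only [unitDisk, mem_closedBall_zero_iff] at hx ⊢
    rw [norm_smul, Real.norm_eq_abs, abs_of_nonneg t.2.1]
    exact mul_le_one₀ t.2.2 (norm_nonneg _) hx
  -- The radial contraction is a homotopy from the constant map at f(0) to `f`; lifting it through
  -- the covering map lifts `f`.
  let H : C(unitInterval × unitDisk, Circle) := f.comp ⟨fun p => ⟨_, hsc p⟩, by fun_prop⟩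
  obtain ⟨a, ha⟩ : ∃ a, Circle.exp a = f ⟨0, by simp⟩ := ⟨_, Circle.exp_arg _⟩
  have H0 : ∀ x, H (0, x) = Circle.exp (ContinuousMap.const unitDisk a x) := fun x => by
    simp [H, ha]
  have hl := Circle.isCoveringMap_exp.liftHomotopy_lifts H (ContinuousMap.const unitDisk a) H0
  refine ⟨fun x => Circle.isCoveringMap_exp.liftHomotopy H (ContinuousMap.const unitDisk a) H0
    (1, x), by fun_prop, fun x => ?_⟩
  have := congrFun hl (1, x)
  simpa [H] using this

/-- The horizontal direction of a point of the sphere that is not a pole. -/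
def hdir (p : S2) (hp : (⟨p.1 0, p.1 1⟩ : ℂ) ≠ 0) : Circle :=
  ⟨(‖(⟨p.1 0, p.1 1⟩ : ℂ)‖⁻¹ : ℝ) • (⟨p.1 0, p.1 1⟩ : ℂ), by
    rw [Submonoid.unitSphere]
    simp [hp]⟩

theorem hdir_eq_exp_iff {p : S2} (hp : (⟨p.1 0, p.1 1⟩ : ℂ) ≠ 0) {θ : ℝ} :
    hdir p hp = Circle.exp θ ↔ p ∈ longitude θ := by
  have hn := norm_pos_iff.2 hp
  rw [Circle.ext_iff, Complex.ext_iff]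
  simp only [hdir, Circle.coe_exp, Complex.exp_ofReal_mul_I_re, Complex.exp_ofReal_mul_I_im,
    Complex.smul_re, Complex.smul_im, smul_eq_mul]
  constructor
  · rintro ⟨h0, h1⟩
    exact ⟨_, hn, by rw [← h0]; field_simp, by rw [← h1]; field_simp⟩
  · rintro ⟨r, hr, h0, h1⟩
    have : ‖(⟨p.1 0, p.1 1⟩ : ℂ)‖ = r := by
      rw [← sq_eq_sq₀ hn.le hr.le, ← Complex.normSq_eq_norm_sq, Complex.normSq_mk, h0, h1]
      linear_combination r ^ 2 * Real.sin_sq_add_cos_sq θ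
    rw [this, h0, h1]
    constructor <;> field_simp

/-- A disk without poles cannot meet every longitude in a connected set. -/
theorem not_forall_longitude_of_disk {U : Set S2} (hU : IsTopologicalDisk U)
    (hax : ∀ p ∈ U, (⟨p.1 0, p.1 1⟩ : ℂ) ≠ 0) (hm : ∀ θ, IsConnected (longitude θ ∩ U)) :
    False := by
  obtain ⟨e⟩ := hU
  have : CompactSpace U := e.symm.compactSpace
  let π : U → Circle := fun p => hdir p.1 (hax p.1 p.2)
  have hc2 : Continuous fun p : U => (⟨p.1.1 0, p.1.1 1⟩ : ℂ) := by
    have h0 : Continuous fun p : U => p.1.1 0 := (continuous_coord 0).comp continuous_subtype_val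
    have h1 : Continuous fun p : U => p.1.1 1 := (continuous_coord 1).comp continuous_subtype_val
    exact Complex.equivRealProdCLM.symm.continuous.comp (h0.prodMk h1)
  have hπ : Continuous π := by
    refine Continuous.subtype_mk ?_ _
    exact (hc2.norm.inv₀ fun p => norm_ne_zero_iff.2 (hax p.1 p.2)).smul hc2
  -- On a disk the longitude angle has a continuous real lift.
  obtain ⟨g, hg, hgf⟩ := exists_circle_lift ⟨π ∘ e.symm, hπ.comp e.symm.continuous⟩
  let Θ : U → ℝ := g ∘ e
  have hΘ : Continuous Θ := hg.comp e.continuous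
  have hΘπ : ∀ p, Circle.exp (Θ p) = π p := fun p => by
    have := hgf (e p)
    simpa [Θ] using this
  -- The lift is constant on each longitude, because the intersection with `U` is connected and the
  -- fibres of `Circle.exp` are discrete.
  have hfib : ∀ p q : U, π p = π q → Θ p = Θ q := by
    intro p q hpq
    have hpre : IsPreconnected {r : U | r.1 ∈ longitude (Θ p)} := by
      rw [← Topology.IsInducing.subtypeVal.isPreconnected_image]
      convert (hm (Θ p)).isPreconnected using 1
      ext x
      constructor
      · rintro ⟨r, hr, rfl⟩
        exact ⟨hr, r.2⟩
      · rintro ⟨h1, h2⟩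
        exact ⟨⟨x, h2⟩, h1, rfl⟩
    have hmem : ∀ r : U, π r = π p → r ∈ {r : U | r.1 ∈ longitude (Θ p)} := fun r hr =>
      (hdir_eq_exp_iff (hax r.1 r.2)).1 (hr.trans (hΘπ p).symm)
    refine subsingleton_of_circleExp (c := π p) (hpre.image Θ hΘ.continuousOn) ?_
      ⟨p, hmem p rfl, rfl⟩ ⟨q, hmem q hpq.symm, rfl⟩
    rintro _ ⟨r, hr, rfl⟩
    rw [hΘπ, ← hΘπ p]
    exact (hdir_eq_exp_iff (hax r.1 r.2)).2 hr
  have hsurj : Function.Surjective π := fun c => by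
    obtain ⟨x, hx1, hx2⟩ := (hm (Complex.arg c)).nonempty
    exact ⟨⟨x, hx2⟩, ((hdir_eq_exp_iff (hax x hx2)).2 hx1).trans (Circle.exp_arg c)⟩
  -- A continuous surjection from a compact space onto the circle is a quotient map, so the lift
  -- descends to a continuous section.
  have hq : Topology.IsQuotientMap π := hπ.isClosedMap.isQuotientMap hπ hsurj
  choose σ hσ using hsurj
  have hs : ∀ p, Θ (σ (π p)) = Θ p := fun p => hfib _ _ (hσ _)
  refine not_continuous_section (s := fun c => Θ (σ c)) ?_ fun c => by rw [hΘπ, hσ]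
  rw [hq.continuous_iff]
  exact hΘ.congr fun p => (hs p).symm

/-! ### Longitudinal shellings -/

theorem longitude_eq {p : S2} {θ θ' : ℝ} (h : p ∈ longitude θ) (h' : p ∈ longitude θ') :
    longitude θ = longitude θ' := by
  obtain ⟨r, hr, h0, h1⟩ := h
  obtain ⟨r', hr', h0', h1'⟩ := h'
  have e : r = r' := by
    rw [← sq_eq_sq₀ hr.le hr'.le]
    linarith [S2.horiz_sq h0 h1, S2.horiz_sq h0' h1']
  subst e
  have e0 : Real.cos θ = Real.cos θ' := mul_left_cancel₀ hr.ne' (h0.symm.trans h0')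
  have e1 : Real.sin θ = Real.sin θ' := mul_left_cancel₀ hr.ne' (h1.symm.trans h1')
  simp only [longitude, e0, e1]

theorem longitude_ext {p q : S2} {θ : ℝ} (h : p ∈ longitude θ) (h' : q ∈ longitude θ)
    (hz : p.1 2 = q.1 2) : p = q := by
  obtain ⟨r, hr, h0, h1⟩ := h
  obtain ⟨r', hr', h0', h1'⟩ := h'
  have e : r = r' := by
    rw [← sq_eq_sq₀ hr.le hr'.le]
    have := S2.horiz_sq h0 h1
    rw [hz] at this
    linarith [S2.horiz_sq h0' h1']
  subst e
  exact S2.ext3 (h0.trans h0'.symm) (h1.trans h1'.symm) hz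

theorem ThetaMonotone.mem_of_between {U : Set S2} (hU : ThetaMonotone U) {a p b : S2} (ha : a ∈ U)
    (hb : b ∈ U) (hap : DueNorth a p) (hpb : DueNorth p b) : p ∈ U := by
  obtain ⟨⟨θ, h1, h2⟩, hz⟩ := hap
  obtain ⟨⟨θ', h3, h4⟩, hz'⟩ := hpb
  rw [longitude_eq h3 h2] at h4
  have hc := (hU.2 θ).resolve_left fun hd => Set.disjoint_left.1 hd h1 ha
  have := (hc.isPreconnected.image _ (continuous_coord 2).continuousOn).ordConnected.out
    ⟨b, ⟨h4, hb⟩, rfl⟩ ⟨a, ⟨h1, ha⟩, rfl⟩ ⟨hz'.le, hz.le⟩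
  obtain ⟨q, ⟨hq, hqU⟩, he⟩ := this
  rwa [← longitude_ext hq h2 he]

namespace ShortestPathEmbedding

variable {V : Type*} {G : SimpleGraph V} {Γ : ShortestPathEmbedding G}

variable (Γ) in
/-- The union of the closed faces in a given set of faces. -/
def faceUnion (T : Set Γ.faces) : Set S2 := ⋃ F ∈ T, closure F.1

theorem mem_faceUnion {T : Set Γ.faces} {p : S2} :
    p ∈ Γ.faceUnion T ↔ ∃ F ∈ T, p ∈ closure F.1 := by
  simp only [faceUnion, Set.mem_iUnion, exists_prop]

theorem prefixUnion_eq {m : ℕ} (f : Fin m ≃ Γ.faces) (k : ℕ) :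
    Γ.prefixUnion f k = Γ.faceUnion {F | (f.symm F : ℕ) < k} := by
  ext p
  simp only [prefixUnion, Set.mem_iUnion, exists_prop, mem_faceUnion, Set.mem_ofPred_eq]
  exact ⟨fun ⟨i, hi, hp⟩ => ⟨f i, by simpa using hi, hp⟩,
    fun ⟨F, hF, hp⟩ => ⟨f.symm F, hF, by simpa using hp⟩⟩

namespace IsGood

variable (h : Γ.IsGood)
include h

/-- Scaling (x, y, z + s·t) by a small η > 0 can bring it to (ηx, ηy, s), which is close to the pole
and hence in the open polar face. -/
theorem polar_reach {F : Set S2} {s : ℝ} (hF : Γ.IsPolarFace F s) (x y z : ℝ) :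
    ∃ t, 0 < t ∧ Cn F x y (z + s * t) := by
  have e1 := eventually_cn (h.isOpen_face hF.1) (f := fun η => η * x) (g := fun η => η * y)
    (k := fun _ => s) (by fun_prop) (by fun_prop) (by fun_prop) (by simpa using hF.2.2)
  have e2 : ∀ᶠ η in 𝓝 (0 : ℝ), η * (s * z) < 1 :=
    ContinuousAt.eventually_lt (by fun_prop) continuousAt_const (by simp)
  obtain ⟨η, ⟨h1, h2⟩, h3⟩ := (((e1.and e2).filter_mono nhdsWithin_le_nhds).and
    (self_mem_nhdsWithin (s := Set.Ioi (0 : ℝ)))).exists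
  have h3' : (0 : ℝ) < η := h3
  have hss : s * s = 1 := by rcases hF.2.1 with rfl | rfl <;> norm_num
  refine ⟨η⁻¹ - s * z, ?_, ?_⟩
  · rw [sub_pos, ← one_div, lt_div_iff₀ h3']
    linarith
  · rw [← cn_smul_iff h3']
    convert h1 using 1
    have : η * η⁻¹ = 1 := mul_inv_cancel₀ h3'.ne'
    linear_combination s * this - η * z * hss

theorem exists_dueNorth {N : Set S2} (hN : Γ.IsPolarFace N 1) {p q : S2} (hpq : DueNorth p q) :
    ∃ a ∈ N, DueNorth a p := by
  obtain ⟨r, r', x, y, z, z', hr, hr', hxy, hz, h0, h1, h2, -⟩ := hpq.coords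
  obtain ⟨t, ht, a, ha, r'', hr'', g0, g1, g2⟩ := h.polar_reach hN x y z
  exact ⟨a, ha, dueNorth_of_coords hr'' hr hxy (by linarith) g0 g1 g2 h0 h1 h2⟩

theorem exists_dueSouth {S : Set S2} (hS : Γ.IsPolarFace S (-1)) {p q : S2}
    (hpq : DueNorth p q) : ∃ b ∈ S, DueNorth q b := by
  obtain ⟨r, r', x, y, z, z', hr, hr', hxy, hz, -, -, -, h0, h1, h2⟩ := hpq.coords
  obtain ⟨t, ht, a, ha, r'', hr'', g0, g1, g2⟩ := h.polar_reach hS x y z'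
  exact ⟨a, ha, dueNorth_of_coords hr' hr'' hxy (by linarith) h0 h1 h2 g0 g1 g2⟩

/-- A face is open, so a closed face that meets it has an interior point in common with it and must
be the same face. -/
theorem mem_faceUnion_iff (T : Set Γ.faces) (F : Γ.faces) {p : S2} (hp : p ∈ F.1) :
    p ∈ Γ.faceUnion T ↔ F ∈ T := by
  refine ⟨fun hpT => ?_, fun hF => mem_faceUnion.2 ⟨F, hF, subset_closure hp⟩⟩
  obtain ⟨F', hF', hpF'⟩ := mem_faceUnion.1 hpT
  obtain ⟨q, hq, hq'⟩ := mem_closure_iff.1 hpF' F.1 (h.isOpen_face F.2) hp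
  rwa [← show F' = F from Subtype.ext (face_eq F'.2 F.2 hq' hq)]

theorem mem_prefixUnion_iff {m : ℕ} (f : Fin m ≃ Γ.faces) (k : ℕ) (F : Γ.faces) {p : S2}
    (hp : p ∈ F.1) : p ∈ Γ.prefixUnion f k ↔ (f.symm F : ℕ) < k := by
  rw [prefixUnion_eq, h.mem_faceUnion_iff _ F hp, Set.mem_ofPred_eq]

/-- If there is a longitudinal shelling, then the directed dual graph is acyclic. -/
theorem acyclic_of_longitudinallyShellable (hsh : Γ.LongitudinallyShellable) : Acyclic Γ.Dn := by
  intro F0 hF0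
  obtain ⟨n, c, σ, dx, dy, W⟩ := h.exists_winding (fun F F' => ab_of_dn) hF0
  obtain ⟨m, f, hs, hmono⟩ := hsh
  obtain ⟨N, hN⟩ := h.exists_polarFace (s := 1) (Or.inl rfl)
  obtain ⟨S, hS⟩ := h.exists_polarFace (s := -1) (Or.inr rfl)
  set idx : Γ.faces → ℕ := fun F => (f.symm F : ℕ) with hidx
  have hinj : ∀ {F F'}, idx F = idx F' → F = F' := fun he => f.symm.injective (Fin.ext he)
  have hlt : ∀ F, idx F < m := fun F => (f.symm F).2
  set iN := idx ⟨N, hN.1⟩ with hiN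
  set iS := idx ⟨S, hS.1⟩ with hiS
  have hNS : iN ≠ iS := fun he => by
    have hSN : N = S := congrArg Subtype.val (hinj he)
    exact h.not_polar_neg hN (hSN ▸ hS)
  have hdisk : ∀ k, 0 < k → k < m → IsTopologicalDisk (Γ.prefixUnion f k) := fun k h0 hk => by
    rcases hs k hk.le with ⟨h1, -⟩ | ⟨h1, -⟩ | h1
    · omega
    · omega
    · exact h1
  have hab : ∀ k, Γ.Ab (c k).1 (c (k + 1)).1 := fun k => by
    obtain ⟨hne, x, y, z, z', h1, h2, h3⟩ := W.cyc.step k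
    refine ab_iff.2 ⟨fun e => hne (Subtype.ext e), x, y, z, z', ?_, h1, h2, h3⟩
    by_contra! h0
    have hx : x = 0 := by nlinarith [mul_self_nonneg x, mul_self_nonneg y]
    have hy : y = 0 := by nlinarith [mul_self_nonneg x, mul_self_nonneg y]
    subst hx hy
    exact h.coneFamily.axis h1
  have hne : ∀ k, idx (c k).1 ≠ idx (c (k + 1)).1 := fun k he => (hab k).1 (hinj he)
  have hcN : ∀ k, idx (c k).1 ≠ iN := fun k he => (c k).2.1 (by
    have := hinj he
    rw [this]; exact hN)
  have hcS : ∀ k, idx (c k).1 ≠ iS := fun k he => (c k).2.2 (by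
    have := hinj he
    rw [this]; exact hS)
  -- If the whole cycle precedes both polar faces, the prefix ending just before the first polar
  -- face is a disk that contains no pole and meets every longitude.
  by_cases hall : ∀ k, idx (c k).1 < min iN iS
  · set a := min iN iS with ha
    have ha0 : 0 < a := (Nat.zero_le _).trans_lt (hall 0)
    have ham : a < m := (min_le_left _ _).trans_lt (hlt _)
    have hU := hdisk a ha0 ham
    refine not_forall_longitude_of_disk hU (fun p hp hp0 => ?_) fun θ => ?_
    · have h0 : p.1 0 = 0 := congrArg Complex.re hp0
      have h1 : p.1 1 = 0 := congrArg Complex.im hp0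
      have h2 : p.1 2 = 1 ∨ p.1 2 = -1 := by
        rw [← sq_eq_one_iff]
        have := p.sq_sum
        rw [h0, h1] at this
        linarith
      rcases h2 with h2 | h2
      · have hpN : p ∈ N := by
          have := hN.2.2
          rwa [← h2, cn_of_smul_mem (p := p) one_pos
            (by simp [h0]) (by simp [h1]) (by simp)] at this
        have := (h.mem_prefixUnion_iff f a ⟨N, hN.1⟩ hpN).1 hp
        exact absurd this (not_lt.2 (min_le_left _ _))
      · have hpS : p ∈ S := by
          have := hS.2.2
          rwa [← h2, cn_of_smul_mem (p := p) one_pos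
            (by simp [h0]) (by simp [h1]) (by simp)] at this
        have := (h.mem_prefixUnion_iff f a ⟨S, hS.1⟩ hpS).1 hp
        exact absurd this (not_lt.2 (min_le_right _ _))
    · refine ((hmono a ham.le hU).2 θ).resolve_left fun hd => ?_
      obtain ⟨k, z, p, hp, r, hr, h0, h1, h2⟩ := W.cover h.coneFamily (x := Real.cos θ)
        (y := Real.sin θ) (by nlinarith [Real.sin_sq_add_cos_sq θ])
      exact Set.disjoint_left.1 hd ⟨r, hr, h0, h1⟩
        ((h.mem_prefixUnion_iff f a _ hp).2 (hall k))
  · push Not at hall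
    obtain ⟨k0, hk0⟩ := hall
    have hk0' : min iN iS < idx (c k0).1 := by
      have := hcN k0
      have := hcS k0
      omega
    rcases hNS.lt_or_gt with hlt' | hlt'
    -- A θ-monotone prefix that contains the north face and a face `F'` contains every face above
    -- `F'`. So beyond the index of the north face, indices increase strictly along the cycle, which
    -- is absurd after one turn.
    · have hup : ∀ {F F'} (k), iN < k → k ≤ m → Γ.Ab F F' → idx F' < k → idx F < k := by
        intro F F' k hk hkm hFF hF'
        -- The full prefix need not be a disk, but it contains every face.
        rcases hkm.eq_or_lt with rfl | hkm
        · exact hlt _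
        have hU := hmono k hkm.le (hdisk k (by omega) hkm)
        obtain ⟨-, p, hp, q, hq, hpq⟩ := hFF
        obtain ⟨a, ha, hap⟩ := h.exists_dueNorth hN hpq
        exact (h.mem_prefixUnion_iff f k F hp).1 (hU.mem_of_between
          ((h.mem_prefixUnion_iff f k ⟨N, hN.1⟩ ha).2 hk)
          ((h.mem_prefixUnion_iff f k F' hq).2 hF') hap hpq)
      have hstep : ∀ k, iN < idx (c k).1 → idx (c k).1 < idx (c (k + 1)).1 := fun k hk => by
        -- The shortest prefix that contains both `c (k + 1)` and the north face.
        have h1 := hup (max (idx (c (k + 1)).1 + 1) (iN + 1)) (by omega)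
          (max_le (hlt _) (hlt _)) (hab k) (by omega)
        have := hne k
        omega
      have hj : ∀ j, iN < idx (c (k0 + j)).1 ∧ idx (c k0).1 + j ≤ idx (c (k0 + j)).1 := fun j => by
        induction j with
        | zero => exact ⟨by rw [add_zero]; omega, le_rfl⟩
        | succ j ih =>
          have := hstep _ ih.1
          rw [← add_assoc]
          omega
      have h1 := (hj n).2
      rw [W.cyc.per] at h1
      have := W.cyc.pos
      omega
    -- With the south face first, prefixes are closed under going down, so indices decrease along
    -- the cycle.
    · have hdown : ∀ {F F'} (k), iS < k → k ≤ m → Γ.Ab F F' → idx F < k → idx F' < k := by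
        intro F F' k hk hkm hFF hF
        rcases hkm.eq_or_lt with rfl | hkm
        · exact hlt _
        have hU := hmono k hkm.le (hdisk k (by omega) hkm)
        obtain ⟨-, p, hp, q, hq, hpq⟩ := hFF
        obtain ⟨b, hb, hqb⟩ := h.exists_dueSouth hS hpq
        exact (h.mem_prefixUnion_iff f k F' hq).1 (hU.mem_of_between
          ((h.mem_prefixUnion_iff f k F hp).2 hF)
          ((h.mem_prefixUnion_iff f k ⟨S, hS.1⟩ hb).2 hk) hpq hqb)
      have hstep : ∀ k, iS < idx (c (k + 1)).1 → idx (c (k + 1)).1 < idx (c k).1 := fun k hk => by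
        have h1 := hdown (max (idx (c k).1 + 1) (iS + 1)) (by omega)
          (max_le (hlt _) (hlt _)) (hab k) (by omega)
        have := hne k
        omega
      have hj : ∀ j k, iS < idx (c (k + j)).1 → idx (c (k + j)).1 + j ≤ idx (c k).1 := fun j => by
        induction j with
        | zero => exact fun k _ => le_rfl
        | succ j ih =>
          intro k hk
          change idx (c (k + j + 1)).1 + (j + 1) ≤ _
          have h1 := hstep (k + j) hk
          have h2 := ih k (hk.trans h1)
          omega
      have h1 := hj n k0 (by rw [W.cyc.per]; omega)
      rw [W.cyc.per] at h1
      have := W.cyc.pos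
      omega

end IsGood

end ShortestPathEmbedding

/-! ### Regions above a graph over the directions -/

theorem cn_axis_pos {A : Set S2} {z : ℝ} (hz : 0 < z) : Cn A 0 0 z ↔ northPole ∈ A := by
  rw [northPole_mem_iff]
  have := cn_smul_iff (A := A) (x := 0) (y := 0) (z := 1) hz
  simpa using this

theorem cn_axis_neg {A : Set S2} {z : ℝ} (hz : z < 0) : Cn A 0 0 z ↔ southPole ∈ A := by
  rw [southPole_mem_iff]
  have := cn_smul_iff (A := A) (x := 0) (y := 0) (z := -1) (neg_pos.2 hz)
  simpa using this

theorem cn_compl_iff {A : Set S2} {x y z : ℝ} (hv : vec x y z ≠ 0) :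
    Cn Aᶜ x y z ↔ ¬ Cn A x y z := by
  rw [cn_iff_nrm hv, cn_iff_nrm hv, Set.mem_compl_iff]

/-- Two closed sets that cover the sphere, the first above the second, with at most one common
point on every longitude. -/
structure IsSplit (U W : Set S2) : Prop where
  closed_left : IsClosed U
  closed_right : IsClosed W
  cover : U ∪ W = Set.univ
  north : northPole ∉ W
  south : southPole ∉ U
  up : ∀ {x y z z' : ℝ}, 0 < x * x + y * y → z < z' → Cn U x y z → Cn U x y z'
  thin : ∀ {x y z z' : ℝ}, 0 < x * x + y * y → z < z' → Cn U x y z → Cn W x y z → ¬ Cn W x y z'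

namespace IsSplit

variable {U W : Set S2} (hs : IsSplit U W)
include hs

/-- Over each direction `U` is a closed up-set, and the height is its infimum. `W` contains
everything below, the height itself by closedness, and by thinness nothing above. -/
theorem exists_height : ∃ H : ℝ → ℝ → ℝ, H 0 0 = 0 ∧ ∀ x y z, vec x y z ≠ 0 →
    (Cn U x y z ↔ H x y ≤ z) ∧ (Cn W x y z ↔ z ≤ H x y) := by
  have hUW : ∀ {x y z}, vec x y z ≠ 0 → ¬ Cn U x y z → Cn W x y z := fun {x y z} hv hn => by
    rw [cn_iff_nrm hv] at hn ⊢
    have : nrm _ hv ∈ U ∪ W := hs.cover ▸ Set.mem_univ _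
    exact this.resolve_left hn
  have hnU : northPole ∈ U := by
    have : northPole ∈ U ∪ W := hs.cover ▸ Set.mem_univ _
    exact this.resolve_right hs.north
  have hsW : southPole ∈ W := by
    have : southPole ∈ U ∪ W := hs.cover ▸ Set.mem_univ _
    exact this.resolve_left hs.south
  have key : ∀ x y, ∃ H, (x = 0 ∧ y = 0 → H = 0) ∧ ∀ z, vec x y z ≠ 0 →
      (Cn U x y z ↔ H ≤ z) ∧ (Cn W x y z ↔ z ≤ H) := by
    intro x y
    rcases (add_nonneg (mul_self_nonneg x) (mul_self_nonneg y)).eq_or_lt with h0 | hxy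
    · have hx : x = 0 := by nlinarith [mul_self_nonneg x, mul_self_nonneg y]
      have hy : y = 0 := by nlinarith [mul_self_nonneg x, mul_self_nonneg y]
      subst hx hy
      -- On the axis `U` contains the upper half and `W` the lower half, so the value 0 is forced by
      -- the description for nonzero vectors.
      refine ⟨0, fun _ => rfl, fun z hz => ?_⟩
      have hz0 : z ≠ 0 := fun h => hz (by subst h; exact ext3 rfl rfl rfl)
      rcases hz0.lt_or_gt with hz | hz
      · simp [cn_axis_neg hz, hs.south, hsW, hz.le, hz]
      · simp [cn_axis_pos hz, hs.north, hnU, hz.le, hz]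
    · have hne : ∀ z, vec x y z ≠ 0 := pos_sq_of_ne hxy
      have hγ : Continuous fun z => nrm (vec x y z) (hne z) :=
        continuousAt_nrm (continuous_vec continuous_const continuous_const continuous_id) _
      set B := {z | Cn U x y z} with hB
      have hBc : IsClosed B := by
        have : B = (fun z => nrm (vec x y z) (hne z)) ⁻¹' U := by
          ext z; exact cn_iff_nrm (hne z)
        rw [this]
        exact hs.closed_left.preimage hγ
      have reach : ∀ {A : Set S2} (s : ℝ), IsOpen A → Cn A 0 0 s → ∃ z, Cn A x y z := by
        intro A s hA hc
        have e1 := eventually_cn hA (f := fun η => η * x) (g := fun η => η * y)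
          (k := fun _ => s) (by fun_prop) (by fun_prop) (by fun_prop) (by simpa using hc)
        obtain ⟨η, h1, h3⟩ := ((e1.filter_mono nhdsWithin_le_nhds).and
          (self_mem_nhdsWithin (s := Set.Ioi (0 : ℝ)))).exists
        have h3' : (0 : ℝ) < η := h3
        refine ⟨η⁻¹ * s, (cn_smul_iff h3').1 ?_⟩
        rwa [mul_inv_cancel_left₀ h3'.ne']
      have hBn : B.Nonempty := by
        obtain ⟨z, hz⟩ := reach 1 hs.closed_right.isOpen_compl
          ((cn_axis_pos one_pos).2 hs.north)
        rw [cn_compl_iff (hne z)] at hz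
        exact ⟨z, by_contra fun hn => hz (hUW (hne z) hn)⟩
      have hBb : BddBelow B := by
        obtain ⟨b, hb⟩ := reach (-1) hs.closed_left.isOpen_compl
          ((cn_axis_neg (by norm_num)).2 hs.south)
        rw [cn_compl_iff (hne b)] at hb
        refine ⟨b, fun z hz => ?_⟩
        by_contra! hlt
        exact hb (hs.up hxy hlt hz)
      have hmem : sInf B ∈ B := hBc.csInf_mem hBn hBb
      have hU : ∀ z, Cn U x y z ↔ sInf B ≤ z := fun z => by
        refine ⟨fun hz => csInf_le hBb hz, fun hz => ?_⟩
        rcases hz.eq_or_lt with rfl | hz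
        · exact hmem
        · exact hs.up hxy hz hmem
      have hWlt : ∀ z, z < sInf B → Cn W x y z := fun z hz =>
        hUW (hne z) fun hc => absurd ((hU z).1 hc) (not_le.2 hz)
      have hWeq : Cn W x y (sInf B) := by
        have := mem_closure_of_vert (A := W) (s := -1) (z := sInf B) hxy one_pos
          (fun t ht _ => hWlt _ (by linarith))
        rwa [hs.closed_right.closure_eq] at this
      refine ⟨sInf B, fun h => ?_, fun z _ => ⟨hU z, fun hz => ?_, fun hz => ?_⟩⟩
      · simp [h.1, h.2] at hxy
      · by_contra! hlt
        exact hs.thin hxy hlt hmem hWeq hz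
      · rcases hz.eq_or_lt with rfl | hz
        · exact hWeq
        · exact hWlt z hz
  choose H h0 hH using key
  exact ⟨H, h0 0 0 ⟨rfl, rfl⟩, hH⟩

/-- The cone over `U` is z ≥ H(x, y), with `H` continuous and positively homogeneous. Each of its
rays meets the surface z = H(w) + 1 - ‖w‖ over the unit disk exactly once. Radial projection of this
surface is a continuous bijection from a compact space to a Hausdorff one. -/
theorem isTopologicalDisk : IsTopologicalDisk U := by
  obtain ⟨H, H0, hH⟩ := hs.exists_height
  have hvne : ∀ {x y z}, H x y ≠ z → vec x y z ≠ 0 := fun {x y z} hz hv => by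
    have h1 : x = 0 := congrArg (· 0) hv
    have h2 : y = 0 := congrArg (· 1) hv
    have h3 : z = 0 := congrArg (· 2) hv
    subst h1 h2 h3
    exact hz H0
  have hcont : Continuous fun p : ℝ × ℝ => H p.1 p.2 := by
    rw [continuous_iff_continuousAt]
    intro p
    have hv : ∀ a : ℝ, Continuous fun q : ℝ × ℝ => vec q.1 q.2 a := fun a =>
      continuous_vec continuous_fst continuous_snd continuous_const
    -- H > a says that the point at height `a` is in the open complement of `U`, and H < a that it
    -- is in the open complement of `W`.
    refine tendsto_order.2 ⟨fun a ha => ?_, fun a ha => ?_⟩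
    · have h1 : Cn Uᶜ p.1 p.2 a := by
        rw [cn_compl_iff (hvne ha.ne'), (hH _ _ _ (hvne ha.ne')).1]
        exact not_le.2 ha
      filter_upwards [(hv a).continuousAt.eventually
        ((isOpen_cn hs.closed_left.isOpen_compl).mem_nhds h1)] with q (hq : Cn Uᶜ q.1 q.2 a)
      have hq0 := hq.ne_zero
      rw [cn_compl_iff hq0, (hH _ _ _ hq0).1] at hq
      exact not_le.1 hq
    · have h1 : Cn Wᶜ p.1 p.2 a := by
        rw [cn_compl_iff (hvne ha.ne), (hH _ _ _ (hvne ha.ne)).2]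
        exact not_le.2 ha
      filter_upwards [(hv a).continuousAt.eventually
        ((isOpen_cn hs.closed_right.isOpen_compl).mem_nhds h1)] with q (hq : Cn Wᶜ q.1 q.2 a)
      have hq0 := hq.ne_zero
      rw [cn_compl_iff hq0, (hH _ _ _ hq0).2] at hq
      exact not_le.1 hq
  have hhom : ∀ {l : ℝ} (x y : ℝ), 0 < l → H (l * x) (l * y) = l * H x y := by
    intro l x y hl
    by_cases h0 : (x, y) = (0, 0)
    · rw [Prod.mk.injEq] at h0
      simp [h0, H0]
    have h1 : (l * x, l * y) ≠ (0, 0) := by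
      simp only [ne_eq, Prod.mk.injEq, mul_eq_zero, hl.ne', false_or] at h0 ⊢
      exact h0
    refine eq_of_forall_ge_iff fun c => ?_
    rw [← (hH _ _ _ (vec_ne_zero h1)).1]
    have e : c = l * (c / l) := by field_simp
    rw [e, cn_smul_iff hl, (hH _ _ _ (vec_ne_zero h0)).1, mul_le_mul_iff_right₀ hl]
  let ht : EuclideanSpace ℝ (Fin 2) → ℝ := fun w => H (w 0) (w 1) + 1 - ‖w‖
  have hnorm : ∀ w : EuclideanSpace ℝ (Fin 2), ‖w‖ ^ 2 = w 0 ^ 2 + w 1 ^ 2 := fun w => by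
    rw [EuclideanSpace.norm_sq_eq, Fin.sum_univ_two]; simp
  have hscale : ∀ {w w' : EuclideanSpace ℝ (Fin 2)} {l : ℝ}, 0 ≤ l → w 0 = l * w' 0 →
      w 1 = l * w' 1 → ‖w‖ = l * ‖w'‖ := fun {w w' l} hl h0 h1 => by
    rw [← sq_eq_sq₀ (norm_nonneg _) (by positivity), mul_pow, hnorm, hnorm, h0, h1]
    ring
  have hΦne : ∀ w, vec (w 0) (w 1) (ht w) ≠ 0 := fun w hv => by
    have h1 : w 0 = 0 := congrArg (· 0) hv
    have h2 : w 1 = 0 := congrArg (· 1) hv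
    have h3 : ht w = 0 := congrArg (· 2) hv
    have h4 : ‖w‖ = 0 := by
      have := hnorm w
      rw [h1, h2] at this
      simpa using this
    simp only [ht, h1, h2, H0, h4] at h3
    norm_num at h3
  let Φ : EuclideanSpace ℝ (Fin 2) → S2 := fun w => nrm (vec (w 0) (w 1) (ht w)) (hΦne w)
  have hΦc : Continuous Φ := by
    have h0 : Continuous fun w : EuclideanSpace ℝ (Fin 2) => w 0 := by fun_prop
    have h1 : Continuous fun w : EuclideanSpace ℝ (Fin 2) => w 1 := by fun_prop
    exact continuousAt_nrm (continuous_vec h0 h1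
      (((hcont.comp (h0.prodMk h1)).add continuous_const).sub continuous_norm)) _
  have hΦU : ∀ w ∈ unitDisk, Φ w ∈ U := fun w hw => by
    rw [← cn_iff_nrm, (hH _ _ _ (hΦne w)).1]
    simp only [unitDisk, mem_closedBall_zero_iff] at hw
    simp only [ht]
    linarith
  let Ψ : unitDisk → U := fun w => ⟨Φ w, hΦU w w.2⟩
  have hΨ : Function.Bijective Ψ := by
    constructor
    · intro w w' he
      have he' : Φ w = Φ w' := congrArg Subtype.val he
      have hp : 0 < ‖vec (w.1 0) (w.1 1) (ht w)‖ := norm_pos_iff.2 (hΦne w)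
      have hp' : 0 < ‖vec (w'.1 0) (w'.1 1) (ht w')‖ := norm_pos_iff.2 (hΦne w')
      set a := ‖vec (w.1 0) (w.1 1) (ht w)‖ with ha
      set b := ‖vec (w'.1 0) (w'.1 1) (ht w')‖ with hb
      have e : ∀ i, a⁻¹ * vec (w.1 0) (w.1 1) (ht w) i =
          b⁻¹ * vec (w'.1 0) (w'.1 1) (ht w') i := fun i =>
        congrArg (fun p : S2 => p.1 i) he'
      have e' : ∀ i, vec (w.1 0) (w.1 1) (ht w) i =
          (a / b) * vec (w'.1 0) (w'.1 1) (ht w') i := fun i => by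
        have := e i
        field_simp at this ⊢
        linarith
      have l0 : 0 < a / b := div_pos hp hp'
      set l := a / b with hl
      have e0 : w.1 0 = l * w'.1 0 := e' 0
      have e1 : w.1 1 = l * w'.1 1 := e' 1
      have e2 : ht w = l * ht w' := e' 2
      have e3 := hscale l0.le e0 e1
      -- For parallel points of the surface, the homogeneous terms cancel and the constant 1 forces
      -- the ratio to be 1.
      simp only [ht, e0, e1, e3, hhom _ _ l0] at e2
      have : l = 1 := by linarith
      rw [this, one_mul] at e0 e1
      refine Subtype.ext ?_
      ext i
      fin_cases i
      · exact e0
      · exact e1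
    · rintro ⟨p, hp⟩
      set q : EuclideanSpace ℝ (Fin 2) := !₂[p.1 0, p.1 1] with hq
      have q0 : q 0 = p.1 0 := rfl
      have q1 : q 1 = p.1 1 := rfl
      have hv : vec (p.1 0) (p.1 1) (p.1 2) ≠ 0 := (cn_of_mem hp).ne_zero
      have hle : H (p.1 0) (p.1 1) ≤ p.1 2 := (hH _ _ _ hv).1.1 (cn_of_mem hp)
      -- The scale at which p / d satisfies the equation of the surface; d ≥ ‖q‖ puts q / d in the
      -- unit disk.
      set d := p.1 2 - H (p.1 0) (p.1 1) + ‖q‖ with hd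
      have hd0 : 0 < d := by
        rcases (add_nonneg (sub_nonneg.2 hle) (norm_nonneg q)).eq_or_lt with h0 | h0
        · exfalso
          have hq0 : ‖q‖ = 0 := by linarith [norm_nonneg q]
          have h1 : p.1 0 = 0 ∧ p.1 1 = 0 := by
            rw [norm_eq_zero] at hq0
            exact ⟨by rw [← q0, hq0]; rfl, by rw [← q1, hq0]; rfl⟩
          have h2 : p.1 2 = 0 := by
            rw [h1.1, h1.2, H0, hq0] at h0
            linarith
          exact hv (by rw [h1.1, h1.2, h2]; exact ext3 rfl rfl rfl)
        · exact h0
      have hdi : 0 < d⁻¹ := inv_pos.2 hd0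
      have e0 : (d⁻¹ • q) 0 = d⁻¹ * p.1 0 := rfl
      have e1 : (d⁻¹ • q) 1 = d⁻¹ * p.1 1 := rfl
      have en : ‖d⁻¹ • q‖ = d⁻¹ * ‖q‖ := hscale hdi.le rfl rfl
      have e2 : ht (d⁻¹ • q) = d⁻¹ * p.1 2 := by
        simp only [ht, e0, e1, en, hhom _ _ hdi]
        have : d⁻¹ * d = 1 := inv_mul_cancel₀ hd0.ne'
        rw [hd] at this ⊢
        linear_combination -this
      refine ⟨⟨d⁻¹ • q, ?_⟩, Subtype.ext ?_⟩
      · rw [mem_closedBall_zero_iff, en, inv_mul_le_iff₀ hd0]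
        linarith
      · have hn : 0 < ‖vec ((d⁻¹ • q) 0) ((d⁻¹ • q) 1) (ht (d⁻¹ • q))‖⁻¹ :=
          inv_pos.2 (norm_pos_iff.2 (hΦne _))
        refine S2.eq_of_smul (x := p.1 0) (y := p.1 1) (z := p.1 2) (mul_pos hn hdi) one_pos
          ?_ ?_ ?_ (by simp) (by simp) (by simp)
        · rw [mul_assoc, ← e0]; rfl
        · rw [mul_assoc, ← e1]; rfl
        · rw [mul_assoc, ← e2]; rfl
  have : CompactSpace unitDisk := isCompact_iff_compactSpace.1 (isCompact_closedBall _ _)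
  have hΨc : Continuous (Equiv.ofBijective Ψ hΨ) :=
    (hΦc.comp continuous_subtype_val).subtype_mk _
  exact ⟨hΨc.homeoOfEquivCompactToT2.symm⟩

omit hs in
theorem _root_.SphereTriang.IsTopologicalDisk.isConnected (hU : IsTopologicalDisk U) :
    IsConnected U := by
  obtain ⟨e⟩ := hU
  rw [isConnected_iff_connectedSpace]
  have : ConnectedSpace unitDisk := isConnected_iff_connectedSpace.1
    ((convex_closedBall _ _).isConnected ⟨0, by simp⟩)
  exact e.symm.surjective.connectedSpace e.symm.continuous

omit hs in
theorem _root_.SphereTriang.longitude_inter_eq (θ : ℝ) (A : Set S2) :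
    longitude θ ∩ A = (fun t => nrm (vec (Real.cos θ) (Real.sin θ) t)
      (pos_sq_of_ne (by nlinarith [Real.sin_sq_add_cos_sq θ]) t)) ''
        {t | Cn A (Real.cos θ) (Real.sin θ) t} := by
  ext p
  constructor
  · rintro ⟨⟨r, hr, h0, h1⟩, hA⟩
    have h2 : p.1 2 = r * (p.1 2 / r) := by field_simp
    refine ⟨p.1 2 / r, (cn_of_smul_mem hr h0 h1 h2).2 hA, ?_⟩
    exact S2.eq_of_smul (inv_pos.2 (norm_pos_iff.2 (pos_sq_of_ne
      (by nlinarith [Real.sin_sq_add_cos_sq θ]) _))) hr rfl rfl rfl h0 h1 h2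
  · rintro ⟨t, ht, rfl⟩
    have hne := pos_sq_of_ne (x := Real.cos θ) (y := Real.sin θ)
      (by nlinarith [Real.sin_sq_add_cos_sq θ]) t
    exact ⟨⟨_, inv_pos.2 (norm_pos_iff.2 hne), rfl, rfl⟩, (cn_iff_nrm hne).1 ht⟩

omit hs in
theorem _root_.SphereTriang.isConnected_longitude_inter {θ : ℝ} {A : Set S2}
    (hA : IsConnected {t | Cn A (Real.cos θ) (Real.sin θ) t}) :
    IsConnected (longitude θ ∩ A) := by
  rw [longitude_inter_eq]
  exact hA.image _ (continuousAt_nrm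
    (continuous_vec continuous_const continuous_const continuous_id) _).continuousOn

theorem thetaMonotone : ThetaMonotone U := by
  obtain ⟨H, H0, hH⟩ := hs.exists_height
  refine ⟨hs.isTopologicalDisk.isConnected, fun θ => Or.inr (isConnected_longitude_inter ?_)⟩
  convert isConnected_Ici (a := H (Real.cos θ) (Real.sin θ)) using 1
  ext t
  exact (hH _ _ _ (pos_sq_of_ne (by nlinarith [Real.sin_sq_add_cos_sq θ]) t)).1

end IsSplit

theorem thetaMonotone_univ : ThetaMonotone (Set.univ : Set S2) := by
  have : ConnectedSpace S2 := isConnected_iff_connectedSpace.1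
    (isConnected_sphere (by
      rw [← Module.finrank_eq_rank, finrank_euclideanSpace_fin]
      norm_num) _ zero_le_one)
  refine ⟨isConnected_univ, fun θ => Or.inr (isConnected_longitude_inter ?_)⟩
  convert isConnected_univ (α := ℝ) using 1
  ext t
  simp only [Set.mem_univ, iff_true]
  exact (cn_iff_nrm (pos_sq_of_ne (by nlinarith [Real.sin_sq_add_cos_sq θ]) t)).2 (Set.mem_univ _)

/-- An acyclic relation on a finite type has a linear extension. -/
theorem exists_equiv_fin {α : Type*} [Finite α] {R : α → α → Prop}
    (hR : ∀ a, ¬ Relation.TransGen R a a) :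
    ∃ (m : ℕ) (f : Fin m ≃ α), ∀ a b, R a b → f.symm a < f.symm b := by
  have := Fintype.ofFinite α
  let _ : PartialOrder α :=
    { le := Relation.ReflTransGen R
      le_refl := fun _ => .refl
      le_trans := fun _ _ _ => .trans
      le_antisymm := fun a b hab hba => by
        by_contra hne
        rcases Relation.reflTransGen_iff_eq_or_transGen.1 hab with h | h
        · exact hne h.symm
        · exact hR a (h.trans_left hba) }
  have : Fintype (LinearExtension α) := ‹Fintype α›
  let e := Fintype.orderIsoFinOfCardEq (LinearExtension α) rfl
  refine ⟨_, (e.toEquiv : Fin _ ≃ α), fun a b hab => ?_⟩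
  refine e.symm.strictMono (lt_of_le_of_ne (toLinearExtension.monotone (.single hab)) ?_)
  intro he
  have he' : a = b := he
  exact hR a (.single (he' ▸ hab))

theorem exists_cn_of_closure {A : Set S2} {x y z : ℝ} (hc : Cn (closure A) x y z)
    {O : Set (EuclideanSpace ℝ (Fin 3))} (hO : IsOpen O) (hv : vec x y z ∈ O) :
    ∃ v ∈ O, Cn A (v 0) (v 1) (v 2) := by
  obtain ⟨p, hp, r, hr, h0, h1, h2⟩ := hc
  have hcont : Continuous fun q : S2 => r⁻¹ • q.1 := by fun_prop
  have hp0 : r⁻¹ • p.1 = vec x y z := by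
    apply ext3 <;> simp [h0, h1, h2, hr.ne', vec_zero, vec_one, vec_two]
  obtain ⟨q, hq, hqA⟩ := mem_closure_iff.1 hp _ (hO.preimage hcont)
    (by rw [Set.mem_preimage, hp0]; exact hv)
  refine ⟨_, hq, q, hqA, r, hr, ?_, ?_, ?_⟩ <;> simp [hr.ne']

/-! ### Unions of faces closed under going up -/

namespace ShortestPathEmbedding

variable {V : Type*} {G : SimpleGraph V} {Γ : ShortestPathEmbedding G}

namespace IsGood

variable (h : Γ.IsGood)
include h

theorem exists_mem_closure_face (p : S2) : ∃ F : Γ.faces, p ∈ closure F.1 := by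
  by_cases hp : p ∈ Γ.drawing
  · have hxy : 0 < p.1 0 * p.1 0 + p.1 1 * p.1 1 := by
      by_contra! h0
      exact h.axis_notMem_drawing (by nlinarith [mul_self_nonneg (p.1 0), mul_self_nonneg (p.1 1)])
        (by nlinarith [mul_self_nonneg (p.1 0), mul_self_nonneg (p.1 1)]) hp
    obtain ⟨F, hF, ε, hε, hc⟩ := h.exists_vert_face hxy (p.1 2) (Or.inl rfl)
    exact ⟨⟨F, hF⟩, cn_mem_iff.1 (mem_closure_of_vert hxy hε hc)⟩
  · obtain ⟨F, hF, hm⟩ := exists_face hp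
    exact ⟨⟨F, hF⟩, subset_closure hm⟩

theorem exists_cn_nonaxis (F : Γ.faces) : ∃ x y z : ℝ, 0 < x * x + y * y ∧ Cn F.1 x y z := by
  obtain ⟨p, hp⟩ : F.1.Nonempty := (face_connected F.2).nonempty
  by_cases hxy : 0 < p.1 0 * p.1 0 + p.1 1 * p.1 1
  · exact ⟨_, _, _, hxy, cn_of_mem hp⟩
  have h0 : p.1 0 = 0 := by nlinarith [mul_self_nonneg (p.1 0), mul_self_nonneg (p.1 1)]
  have e1 := eventually_cn (h.isOpen_face F.2) (f := fun η => p.1 0 + η) (g := fun _ => p.1 1)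
    (k := fun _ => p.1 2) (by fun_prop) (by fun_prop) (by fun_prop)
    (by simpa using cn_of_mem hp)
  obtain ⟨η, h1, h2⟩ := ((e1.filter_mono nhdsWithin_le_nhds).and
    (self_mem_nhdsWithin (s := Set.Ioi (0 : ℝ)))).exists
  have h2' : (0 : ℝ) < η := h2
  exact ⟨_, _, _, by rw [h0]; nlinarith [mul_self_nonneg (p.1 1)], h1⟩

theorem ab_north {N : Γ.faces} (hN : Γ.IsPolarFace N.1 1) {F : Γ.faces} (hF : F ≠ N) :
    Γ.Ab N F := by
  obtain ⟨x, y, z, hxy, hc⟩ := h.exists_cn_nonaxis F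
  obtain ⟨t, ht, hct⟩ := h.polar_reach hN x y z
  exact ab_iff.2 ⟨hF.symm, x, y, _, _, hxy, hct, hc, by linarith⟩

theorem ab_south {S : Γ.faces} (hS : Γ.IsPolarFace S.1 (-1)) {F : Γ.faces} (hF : F ≠ S) :
    Γ.Ab F S := by
  obtain ⟨x, y, z, hxy, hc⟩ := h.exists_cn_nonaxis F
  obtain ⟨t, ht, hct⟩ := h.polar_reach hS x y z
  exact ab_iff.2 ⟨hF, x, y, _, _, hxy, hc, hct, by linarith⟩

/-- A vertical segment from a closed face to an open set can be moved into two open faces. -/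
theorem exists_vert_pair (F : Γ.faces) {A : Set S2} (hA : IsOpen A) {x y z d : ℝ}
    (hxy : 0 < x * x + y * y) (hc : Cn (closure F.1) x y z) (hcA : Cn A x y (z + d)) :
    ∃ F' : Γ.faces, (closure F'.1 ∩ A).Nonempty ∧
      ∃ x y z : ℝ, 0 < x * x + y * y ∧ Cn F.1 x y z ∧ Cn F'.1 x y (z + d) := by
  have hpos : IsOpen {v : EuclideanSpace ℝ (Fin 3) | 0 < v 0 * v 0 + v 1 * v 1} :=
    isOpen_lt continuous_const (by fun_prop)
  have hsh : ∀ {B : Set S2} (c : ℝ), IsOpen B →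
      IsOpen {v : EuclideanSpace ℝ (Fin 3) | Cn B (v 0) (v 1) (v 2 + c)} := fun c hB =>
    (isOpen_cn hB).preimage (f := fun v : EuclideanSpace ℝ (Fin 3) => vec (v 0) (v 1) (v 2 + c))
      (continuous_vec (by fun_prop) (by fun_prop) (by fun_prop))
  -- Move the lower end into the open face `F`, keeping the shifted end in the open set `A`. The
  -- shifted end lies in some closed face `F'`; a second small move takes it into `F'` and keeps the
  -- other end in `F`.
  obtain ⟨v, ⟨hv0, hvA⟩, hvF⟩ := exists_cn_of_closure hc (hpos.inter (hsh d hA)) ⟨hxy, hcA⟩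
  have hvA' : Cn A (v 0) (v 1) (v 2 + d) := hvA
  obtain ⟨F', hF'⟩ := h.exists_mem_closure_face (nrm _ (pos_sq_of_ne hv0 (v 2 + d)))
  rw [← cn_iff_nrm] at hF'
  obtain ⟨p, hp, -⟩ := hF'.inter hvA'
  obtain ⟨w, ⟨hw0, hwF⟩, hwF'⟩ := exists_cn_of_closure hF'
    (hpos.inter (hsh (-d) (h.isOpen_face F.2))) ⟨hv0, by
      change Cn F.1 (v 0) (v 1) (v 2 + d + -d)
      rwa [add_neg_cancel_right]⟩
  exact ⟨F', ⟨p, hp⟩, w 0, w 1, w 2 + -d, hw0, hwF, by rwa [neg_add_cancel_right]⟩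

theorem isClosed_faceUnion (T : Set Γ.faces) : IsClosed (Γ.faceUnion T) := by
  have : Finite Γ.faces := h.finite_faces
  exact T.toFinite.isClosed_biUnion fun _ _ => isClosed_closure

theorem faceUnion_inter_compl_subset (T : Set Γ.faces) :
    Γ.faceUnion T ∩ Γ.faceUnion Tᶜ ⊆ Γ.drawing := by
  rintro p ⟨h1, h2⟩
  by_contra hp
  obtain ⟨F, hF, hm⟩ := exists_face hp
  exact (h.mem_faceUnion_iff _ ⟨F, hF⟩ hm).1 h2 ((h.mem_faceUnion_iff _ ⟨F, hF⟩ hm).1 h1)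

/-- The union of a set of closed faces that is closed under going up. -/
theorem isSplit_faceUnion {T : Set Γ.faces} (hT : ∀ F F', Γ.Ab F F' → F' ∈ T → F ∈ T)
    (hne : T.Nonempty) (hne' : Tᶜ.Nonempty) : IsSplit (Γ.faceUnion T) (Γ.faceUnion Tᶜ) := by
  obtain ⟨N, hN⟩ := h.exists_polarFace (s := 1) (Or.inl rfl)
  obtain ⟨S, hS⟩ := h.exists_polarFace (s := -1) (Or.inr rfl)
  have hNT : (⟨N, hN.1⟩ : Γ.faces) ∈ T := by
    obtain ⟨F, hF⟩ := hne
    by_cases hFN : F = ⟨N, hN.1⟩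
    · rwa [← hFN]
    · exact hT _ _ (h.ab_north (N := ⟨N, hN.1⟩) hN hFN) hF
  have hST : (⟨S, hS.1⟩ : Γ.faces) ∉ T := fun hm => by
    obtain ⟨F, hF⟩ := hne'
    by_cases hFS : F = ⟨S, hS.1⟩
    · exact hF (hFS ▸ hm)
    · exact hF (hT _ _ (h.ab_south (S := ⟨S, hS.1⟩) hS hFS) hm)
  have hup : ∀ {x y z z' : ℝ}, 0 < x * x + y * y → z < z' → Cn (Γ.faceUnion T) x y z →
      Cn (Γ.faceUnion T) x y z' := fun {x y z z'} hxy hz hc => by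
    -- A point outside the union vertically above one inside it can be perturbed to give a face
    -- outside `T` above a face of `T`.
    by_contra hc'
    rw [← cn_compl_iff (pos_sq_of_ne hxy _), ← add_sub_cancel z z'] at hc'
    obtain ⟨p, hp, r⟩ := hc
    obtain ⟨F, hF, hpF⟩ := mem_faceUnion.1 hp
    obtain ⟨F', ⟨q, hq, hqT⟩, a, b, c, hab, h1, h2⟩ := h.exists_vert_pair F
      (h.isClosed_faceUnion T).isOpen_compl hxy ⟨p, hpF, r⟩ hc'
    have hF' : F' ∉ T := fun hm => hqT (mem_faceUnion.2 ⟨F', hm, hq⟩)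
    exact hF' (hT _ _ (ab_iff.2 ⟨fun e => hF' (e ▸ hF), a, b, _, _, hab, h2, h1,
      by linarith⟩) hF)
  have hdown : ∀ {x y z z' : ℝ}, 0 < x * x + y * y → z < z' → Cn (Γ.faceUnion Tᶜ) x y z' →
      Cn (Γ.faceUnion Tᶜ) x y z := fun {x y z z'} hxy hz hc => by
    by_contra hc'
    rw [← cn_compl_iff (pos_sq_of_ne hxy _), ← add_sub_cancel z' z] at hc'
    obtain ⟨p, hp, r⟩ := hc
    obtain ⟨F, hF, hpF⟩ := mem_faceUnion.1 hp
    obtain ⟨F', ⟨q, hq, hqT⟩, a, b, c, hab, h1, h2⟩ := h.exists_vert_pair F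
      (h.isClosed_faceUnion Tᶜ).isOpen_compl hxy ⟨p, hpF, r⟩ hc'
    have hF' : F' ∈ T := by_contra fun hm => hqT (mem_faceUnion.2 ⟨F', hm, hq⟩)
    exact hF (hT _ _ (ab_iff.2 ⟨fun e => hF (e ▸ hF'), a, b, _, _, hab, h1, h2,
      by linarith⟩) hF')
  refine ⟨h.isClosed_faceUnion _, h.isClosed_faceUnion _, ?_, fun hm => ?_, fun hm => ?_, hup,
    fun {x y z z'} hxy hz hU hW hW' => ?_⟩
  · refine Set.eq_univ_of_forall fun p => ?_
    obtain ⟨F, hF⟩ := h.exists_mem_closure_face p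
    by_cases hFT : F ∈ T
    · exact Or.inl (mem_faceUnion.2 ⟨F, hFT, hF⟩)
    · exact Or.inr (mem_faceUnion.2 ⟨F, hFT, hF⟩)
  · exact (h.mem_faceUnion_iff _ ⟨N, hN.1⟩ (isPolarFace_one_iff.1 hN).2).1 hm hNT
  · exact hST ((h.mem_faceUnion_iff _ ⟨S, hS.1⟩ (isPolarFace_neg_one_iff.1 hS).2).1 hm)
  -- The whole open interval would lie in both unions, hence in the drawing, which meets a vertical
  -- line off the axis in finitely many points.
  · refine (Set.Ioo_infinite hz) ((h.finite_drawing hxy).subset fun t ht => ?_)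
    obtain ⟨p, hp, r⟩ := (hup hxy ht.1 hU).inter (hdown hxy ht.2 hW')
    exact ⟨p, h.faceUnion_inter_compl_subset T hp, r⟩

/-- If the directed dual graph is acyclic, then there is a longitudinal shelling. -/
theorem longitudinallyShellable (hab : ∀ F, ¬ Relation.TransGen Γ.Ab F F) :
    Γ.LongitudinallyShellable := by
  have : Finite Γ.faces := h.finite_faces
  obtain ⟨m, f, hf⟩ := exists_equiv_fin hab
  have h0 : Γ.prefixUnion f 0 = ∅ := by simp [prefixUnion]
  have hm : Γ.prefixUnion f m = Set.univ := Set.eq_univ_of_forall fun p => by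
    obtain ⟨F, hF⟩ := h.exists_mem_closure_face p
    rw [prefixUnion_eq, mem_faceUnion]
    exact ⟨F, (f.symm F).2, hF⟩
  -- A prefix of a linear extension of `Ab` is closed under going up; the faces at positions 0 and
  -- `k` show that it and its complement are nonempty.
  have hk : ∀ k, 0 < k → k < m → ∃ W, IsSplit (Γ.prefixUnion f k) W := fun k hk hkm => by
    rw [prefixUnion_eq]
    refine ⟨_, h.isSplit_faceUnion (fun F F' hFF hF' => ?_) ⟨f ⟨0, by omega⟩, ?_⟩
      ⟨f ⟨k, hkm⟩, ?_⟩⟩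
    · exact (Fin.lt_def.1 (hf F F' hFF)).trans hF'
    · simpa using hk
    · simp
  refine ⟨m, f, fun k hkm => ?_, fun k hkm hd => ?_⟩
  · rcases Nat.eq_zero_or_pos k with rfl | hk0
    · exact Or.inl ⟨rfl, h0⟩
    rcases hkm.eq_or_lt with rfl | hkm
    · exact Or.inr (Or.inl ⟨rfl, hm⟩)
    · obtain ⟨W, hW⟩ := hk k hk0 hkm
      exact Or.inr (Or.inr hW.isTopologicalDisk)
  · rcases Nat.eq_zero_or_pos k with rfl | hk0
    · exact absurd hd.isConnected.nonempty (by simp [h0])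
    rcases hkm.eq_or_lt with rfl | hkm
    · exact hm ▸ thetaMonotone_univ
    · obtain ⟨W, hW⟩ := hk k hk0 hkm
      exact hW.thetaMonotone

end IsGood

end ShortestPathEmbedding

end SphereTriang

end

/-! ### The equivalence of the five conditions -/

theorem lemmaL {V : Type*} [Fintype V] (G : SimpleGraph V) (hn : 4 ≤ Fintype.card V)
    (Γ : SphereTriang.ShortestPathEmbedding G)
    (htri : Γ.IsTriangulation) (hgen : Γ.IsGeneric) (hpoles : Γ.PolesSeparated) :
    List.TFAE [
      Γ.LongitudinallyShellable,
      SphereTriang.Acyclic Γ.Dn,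
      SphereTriang.StronglyConnected Γ.Rt,
      ∃ N S : Set SphereTriang.S2, Γ.IsNorthFace N ∧ Γ.IsSouthFace S ∧
        Γ.HasFacePath N S ∧ Γ.HasFacePath S N,
      SphereTriang.Acyclic Γ.DnVee] := by
  have h : Γ.IsGood := ⟨inferInstance, by rwa [Nat.card_eq_fintype_card], htri, hgen, hpoles⟩
  tfae_have 1 → 2 := h.acyclic_of_longitudinallyShellable
  tfae_have 2 → 1 := fun hac => h.longitudinallyShellable (h.not_transGen_ab hac)
  tfae_have 2 → 5 := fun hac => h.not_transGen_dnVee (h.not_transGen_ab hac)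
  tfae_have 5 → 3 := h.stronglyConnected_of_dnVee
  tfae_have 3 → 4 := h.exists_hasFacePath
  tfae_have 4 → 2 := fun ⟨_, _, hN, hS, hNS, hSN⟩ =>
    h.not_transGen_of_hasFacePath hN hS hNS hSN fun _ _ =>
      SphereTriang.ShortestPathEmbedding.ab_of_dn
  tfae_finish
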